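/- Let $G$ be a Hausdorff topological group which is amenable (there is a left-invariant mean on the bounded right uniformly continuous real functions on $G$), and let $G$ act jointly continuously on a compact metric space $(X,d)$. Let $W(\mu,\nu)=\inf_\iota\int d\,d\iota$ (infimum over all joinings $\iota$ of $\mu,\nu$) be the Wasserstein distance on the Borel probability measures of $X$. *Følner sequences.* (Thick case.) If $G$ is locally compact and $\sigma$-compact with left Haar measure $\theta$, a Følner sequence is a sequence $\mathcal F=(F_n)$ of non-empty compact sets with $\theta(F_n)>0$ and $\theta(F_n\triangle KF_n)/\theta(F_n)\to0$ for all non-empty compact $K\subseteq G$; it is right Følner if instead $\theta_r(F_n)>0$ and $\theta_r(F_n\triangle F_nK)/\theta_r(F_n)\to0$ for a right Haar measure $\theta_r$. (Thin case.) For finite $F,E\subseteq G$ and a neighbourhood $V$ of $e$, let $\mathfrak m_V(F,E)$ be the maximal cardinality of a set $M\subseteq F$ admitting an injection $\phi:M\to E$ with $\phi(f)\in Vf$ for all $f\in M$, and let $\mathfrak m^r_V(F,E)$ be the same with $\phi(f)\in fV$. If $G$ is second countable, a Følner sequence is a sequence of non-empty finite sets $F_n$ with $\mathfrak m_V(F_n,gF_n)/|F_n|\to1$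 for all $g\in G$ and all open $V\ni e$; it is right Følner if instead $\mathfrak m_V(F_n,F_ng)/|F_n|\to1$ for all such $g,V$, or if $G$ is moreover locally compact and $\mathfrak m^r_V(F_n,F_ng)/|F_n|\to1$ for all such $g,V$. Here $\theta$ and $\theta_r$ denote the counting measure. *Averages.* For such $\mathcal F$ let $S_n^{\mathcal F}f(x)=\theta(F_n)^{-1}\int_{F_n}f(gx)\,d\theta(g)$ for $f\in C(X)$ (with $\theta_r$ for right Følner sequences), $\mathcal W_{\mathcal F}(x,y)=\limsup_n W\big((S_n^{\mathcal F})^*\delta_x,(S_n^{\mathcal F})^*\delta_y\big)$, and $\mathcal W=\sup_{\mathcal F}\mathcal W_{\mathcal F}$, the supremum over all (left) Følner sequences. The system $(X,G)$ is $\mathcal F$-weakly mean equicontinuous if $\mathcal W_{\mathcal F}$ is continuous on $X^2$, and weakly mean equicontinuous if $\mathcal W$ is. **Theorem.** Suppose that $G$ is locally compact and $\sigma$-compact and all Følner sequences are thick, or that $G$ is second countable and all Følner sequences are thin. Then the following are equivalent. (i) $(X,G)$ is weakly mean equicontinuous. (ii) For all $x\in X$, the orbit closure $\overline{Gx}$ carries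 exactly one invariant Borel probability measure $\mu_x$, it is ergodic, and the map $x\mapsto\mu_x$ is continuous for the weak* topology. (iii) For every Følner sequence $\mathcal F$ in $G$, the operators $S_n^{\mathcal F}$ on $C(X)$ converge in the strong operator topology. Moreover, if $(X,G)$ is $\mathcal F$-weakly mean equicontinuous for some Følner sequence $\mathcal F$ and there is an invariant Borel probability measure with support $X$, then (i)--(iii) hold. Finally, if $\mathcal W_{\mathcal F}$ is continuous for some right Følner sequence $\mathcal F$, then (i)--(iii) hold. -/

import Mathlib

open MeasureTheory Filter Topology
open scoped Pointwise symmDiff BoundedContinuousFunction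

noncomputable section

namespace WeakMean

section Amenability

variable (G : Type*) [Group G] [TopologicalSpace G]

/-- The space of bounded right uniformly continuous real functions on `G`, that is, of those
bounded continuous `f` with `sup_x |f (u x) - f x| → 0` as `u → 1`. -/
def rucb : Submodule ℝ (G →ᵇ ℝ) where
  carrier := {f | ∀ ε > 0, ∀ᶠ u in 𝓝 (1 : G), ∀ x, |f (u * x) - f x| < ε}
  zero_mem' := by
    intro ε hε
    simp [hε]
  add_mem' := by
    intro a b ha hb ε hε
    filter_upwards [ha (ε / 2) (half_pos hε), hb (ε / 2) (half_pos hε)] with u hu hv x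
    have h1 := abs_lt.1 (hu x)
    have h2 := abs_lt.1 (hv x)
    simp only [BoundedContinuousFunction.coe_add, Pi.add_apply]
    rw [abs_lt]
    constructor <;> linarith [h1.1, h1.2, h2.1, h2.2]
  smul_mem' := by
    intro c f hf ε hε
    have hc : 0 < |c| + 1 := by positivity
    filter_upwards [hf (ε / (|c| + 1)) (by positivity)] with u hu x
    have h1 := hu x
    rw [lt_div_iff₀ hc] at h1
    have h2 : c • f (u * x) - c • f x = c * (f (u * x) - f x) := by
      simp only [smul_eq_mul]; ring
    simp only [BoundedContinuousFunction.coe_smul]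
    rw [h2, abs_mul]
    nlinarith [abs_nonneg (f (u * x) - f x), abs_nonneg c]

/-- A topological group is amenable if the bounded right uniformly continuous functions carry a
mean (a positive normalized linear functional) that is invariant under left translations. -/
def IsAmenable : Prop :=
  ∃ m : rucb G →ₗ[ℝ] ℝ,
    (∀ f : rucb G, (∀ x, 0 ≤ f.1 x) → 0 ≤ m f) ∧
    (∀ f : rucb G, (∀ x, f.1 x = 1) → m f = 1) ∧
    (∀ (g : G) (f f' : rucb G), (∀ x, f'.1 x = f.1 (g * x)) → m f' = m f)

end Amenability

section Folner

variable {G : Type*} [Group G] [TopologicalSpace G]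

/-- (Left) thick Følner sequences; `θ` is meant to be a left Haar measure. -/
structure IsThickFolner [MeasurableSpace G] (θ : Measure G) (F : ℕ → Set G) : Prop where
  isCompact : ∀ n, IsCompact (F n)
  nonempty : ∀ n, (F n).Nonempty
  measure_pos : ∀ n, 0 < θ (F n)
  tendsto : ∀ K : Set G, IsCompact K → K.Nonempty →
    Tendsto (fun n => θ (F n ∆ (K * F n)) / θ (F n)) atTop (𝓝 0)

/-- Right thick Følner sequences; `θr` is meant to be a right Haar measure. -/
structure IsRightThickFolner [MeasurableSpace G] (θr : Measure G) (F : ℕ → Set G) : Prop where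
  isCompact : ∀ n, IsCompact (F n)
  nonempty : ∀ n, (F n).Nonempty
  measure_pos : ∀ n, 0 < θr (F n)
  tendsto : ∀ K : Set G, IsCompact K → K.Nonempty →
    Tendsto (fun n => θr (F n ∆ (F n * K)) / θr (F n)) atTop (𝓝 0)

/-- The `V`-matching number of two finite sets `F` and `E`: the maximal cardinality of a subset
`M` of `F` with an injection `φ : M → E` such that `φ f ∈ V f` for all `f ∈ M`. -/
def matchingNumber (V F E : Set G) : ℕ :=
  sSup {k : ℕ | ∃ M : Set G, M ⊆ F ∧ M.ncard = k ∧
    ∃ φ : G → G, Set.InjOn φ M ∧ Set.MapsTo φ M E ∧ ∀ f ∈ M, ∃ v ∈ V, φ f = v * f}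

/-- The mirror image of the `V`-matching number, with `φ f ∈ f V` for all `f ∈ M`. -/
def rightMatchingNumber (V F E : Set G) : ℕ :=
  sSup {k : ℕ | ∃ M : Set G, M ⊆ F ∧ M.ncard = k ∧
    ∃ φ : G → G, Set.InjOn φ M ∧ Set.MapsTo φ M E ∧ ∀ f ∈ M, ∃ v ∈ V, φ f = f * v}

/-- (Left) thin Følner sequences. -/
structure IsThinFolner (F : ℕ → Set G) : Prop where
  finite : ∀ n, (F n).Finite
  nonempty : ∀ n, (F n).Nonempty
  tendsto : ∀ (g : G) (V : Set G), IsOpen V → (1 : G) ∈ V →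
    Tendsto (fun n => (matchingNumber V (F n) ((fun h => g * h) '' F n) : ℝ) / (F n).ncard)
      atTop (𝓝 1)

/-- Right thin Følner sequences, with the displacement `φ f ∈ V f` of the matching on the left:
translates `F n * g` are compared with `F n` in the uniformity for which the functions
`g ↦ f (g • x)` of a continuous action on a compact space are uniformly continuous. -/
structure IsRightThinFolner (F : ℕ → Set G) : Prop where
  finite : ∀ n, (F n).Finite
  nonempty : ∀ n, (F n).Nonempty
  tendsto : ∀ (g : G) (V : Set G), IsOpen V → (1 : G) ∈ V →
    Tendsto (fun n => (matchingNumber V (F n) ((fun h => h * g) '' F n) : ℝ) / (F n).ncard)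
      atTop (𝓝 1)

/-- Mirrored right thin Følner sequences, with the displacement `φ f ∈ f V` on the right;
these are the sequences of inverses of the left thin Følner sequences. -/
structure IsMirroredThinFolner (F : ℕ → Set G) : Prop where
  finite : ∀ n, (F n).Finite
  nonempty : ∀ n, (F n).Nonempty
  tendsto : ∀ (g : G) (V : Set G), IsOpen V → (1 : G) ∈ V →
    Tendsto (fun n => (rightMatchingNumber V (F n) ((fun h => h * g) '' F n) : ℝ) / (F n).ncard)
      atTop (𝓝 1)

end Folner

section Wasserstein

variable {X : Type*} [MetricSpace X] [MeasurableSpace X]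

/-- The joinings of two measures. -/
def joinings (μ ν : Measure X) : Set (Measure (X × X)) :=
  {ι | IsProbabilityMeasure ι ∧ ι.map Prod.fst = μ ∧ ι.map Prod.snd = ν}

/-- The Wasserstein distance of two probability measures. -/
def wasserstein (μ ν : Measure X) : ℝ :=
  sInf ((fun ι : Measure (X × X) => ∫ p, dist p.1 p.2 ∂ι) '' joinings μ ν)

end Wasserstein

section Averages

theorem isFiniteMeasure_average {Ω : Type*} [MeasurableSpace Ω] (ρ : Measure Ω) :
    IsFiniteMeasure ((ρ Set.univ)⁻¹ • ρ) := by
  refine ⟨?_⟩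
  rw [Measure.smul_apply, smul_eq_mul]
  exact lt_of_le_of_lt (ENNReal.inv_mul_le_one _) ENNReal.one_lt_top

variable {G : Type*} [Group G] [TopologicalSpace G] [MeasurableSpace G] [BorelSpace G]
variable {X : Type*} [MetricSpace X] [CompactSpace X] [MulAction G X] [ContinuousSMul G X]

theorem integrable_orbit (ρ : Measure G) [IsFiniteMeasure ρ] (f : C(X, ℝ)) (x : X) :
    Integrable (fun g : G => f (g • x)) ρ := by
  refine Integrable.of_bound (C := ‖f‖) ?_ (ae_of_all _ fun g => f.norm_coe_le_norm _)
  exact (by fun_prop : Continuous fun g : G => f (g • x)).aestronglyMeasurable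

/-- The average over `F` with respect to `θ`, as an operator on `C(X)`:
`S f x = 1 / θ(F) * ∫_F f (g x) dθ(g)`. -/
def avgOp (X : Type*) [MetricSpace X] [CompactSpace X] [MulAction G X] [ContinuousSMul G X]
    (θ : Measure G) (F : Set G) : C(X, ℝ) →L[ℝ] C(X, ℝ) :=
  LinearMap.mkContinuous
    { toFun := fun f =>
        { toFun := fun x => ⨍ g in F, f (g • x) ∂θ
          continuous_toFun := by
            have := isFiniteMeasure_average (θ.restrict F)
            refine continuous_of_dominated (bound := fun _ => ‖f‖) ?_ ?_ ?_ ?_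
            · exact fun x => (integrable_orbit _ f x).aestronglyMeasurable
            · exact fun x => ae_of_all _ fun g => f.norm_coe_le_norm _
            · exact integrable_const _
            · exact ae_of_all _ fun g => by fun_prop }
      map_add' := by
        intro f f'
        ext x
        have := isFiniteMeasure_average (θ.restrict F)
        exact integral_add (integrable_orbit _ f x) (integrable_orbit _ f' x)
      map_smul' := by
        intro c f
        ext x
        exact integral_const_mul c _ } 1 (by
      intro f
      rw [one_mul, ContinuousMap.norm_le _ (norm_nonneg _)]
      intro x
      have := isFiniteMeasure_average (θ.restrict F)
      refine (norm_integral_le_of_norm_le_const (C := ‖f‖)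
        (ae_of_all _ fun g => f.norm_coe_le_norm (g • x))).trans ?_
      refine mul_le_of_le_one_right (norm_nonneg _) ?_
      refine ENNReal.toReal_le_of_le_ofReal zero_le_one ?_
      rw [ENNReal.ofReal_one, Measure.smul_apply, smul_eq_mul]
      exact ENNReal.inv_mul_le_one _)

theorem avgOp_apply (θ : Measure G) (F : Set G) (f : C(X, ℝ)) (x : X) :
    avgOp X θ F f x = ⨍ g in F, f (g • x) ∂θ := rfl

variable [MeasurableSpace X] [BorelSpace X]

/-- The measure `S* δ_x` on `X` for the average `S` over `F` with respect to `θ`: the image of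
the normalized restriction of `θ` to `F` under `g ↦ g x`. -/
def orbitMeasure (θ : Measure G) (F : Set G) (x : X) : Measure X :=
  ((θ F)⁻¹ • θ.restrict F).map (fun g => g • x)

theorem integral_orbitMeasure (θ : Measure G) (F : Set G) (x : X) (f : C(X, ℝ)) :
    ∫ y, f y ∂(orbitMeasure θ F x) = avgOp X θ F f x := by
  rw [orbitMeasure, integral_map]
  · rw [avgOp_apply, average, Measure.restrict_apply_univ]
  · exact (by fun_prop : Continuous fun g : G => g • x).measurable.aemeasurable
  · exact f.continuous.aestronglyMeasurable

/-- The pseudometric `𝒲_F`. -/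
def folnerW (θ : Measure G) (F : ℕ → Set G) (x y : X) : ℝ :=
  limsup (fun n => wasserstein (orbitMeasure θ (F n) x) (orbitMeasure θ (F n) y)) atTop

/-- Continuity of `𝒲_F`, that is, `F`-weak mean equicontinuity. -/
def FolnerWeaklyMeanEquicontinuous (X : Type*) [MetricSpace X] [CompactSpace X] [MulAction G X]
    [ContinuousSMul G X] [MeasurableSpace X] [BorelSpace X]
    (θ : Measure G) (F : ℕ → Set G) : Prop :=
  Continuous fun p : X × X => folnerW θ F p.1 p.2

/-- The pseudometric `𝒲`: the supremum of `𝒲_F` over the sequences `F` in a class `P`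
(in use: all thick, or all thin, Følner sequences). -/
def supW (θ : Measure G) (P : (ℕ → Set G) → Prop) (x y : X) : ℝ :=
  ⨆ F : {F : ℕ → Set G // P F}, folnerW θ F.1 x y

/-- Weak mean equicontinuity: continuity of `𝒲`. -/
def WeaklyMeanEquicontinuous (X : Type*) [MetricSpace X] [CompactSpace X] [MulAction G X]
    [ContinuousSMul G X] [MeasurableSpace X] [BorelSpace X]
    (θ : Measure G) (P : (ℕ → Set G) → Prop) : Prop :=
  Continuous fun p : X × X => supW θ P p.1 p.2

/-- Along every sequence in the class `P`, the averages converge in the strong operator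
topology of the bounded operators on `C(X)`. -/
def AveragesConverge (X : Type*) [MetricSpace X] [CompactSpace X] [MulAction G X]
    [ContinuousSMul G X] (θ : Measure G) (P : (ℕ → Set G) → Prop) : Prop :=
  ∀ F : ℕ → Set G, P F → ∃ S : C(X, ℝ) →L[ℝ] C(X, ℝ),
    ∀ f : C(X, ℝ), Tendsto (fun n => avgOp X θ (F n) f) atTop (𝓝 (S f))

end Averages

section UniqueErgodicity

variable (G : Type*) [Group G] (X : Type*) [MetricSpace X] [MulAction G X] [MeasurableSpace X]
  [BorelSpace X]

/-- `μ` is the one and only invariant Borel probability measure on the set `Y`; measures on `Y`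
are identified with the measures on `X` that give full mass to `Y`. -/
def IsUniqueInvariantOn (Y : Set X) (μ : ProbabilityMeasure X) : Prop :=
  (SMulInvariantMeasure G X (μ : Measure X) ∧ (μ : Measure X) Y = 1) ∧
  ∀ ν : ProbabilityMeasure X, SMulInvariantMeasure G X (ν : Measure X) →
    (ν : Measure X) Y = 1 → ν = μ

/-- Every orbit closure is uniquely ergodic, with an ergodic measure that depends continuously
(for the weak topology) on the point. -/
def ContinuouslyUniquelyErgodic : Prop :=
  ∃ μ : X → ProbabilityMeasure X, Continuous μ ∧ ∀ x : X,
    IsUniqueInvariantOn G X (closure (MulAction.orbit G x)) (μ x) ∧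
    ErgodicSMul G X (μ x : Measure X)

/-- There is an invariant Borel probability measure of full support. -/
def HasFullySupportedInvariantMeasure : Prop :=
  ∃ μ : ProbabilityMeasure X, SMulInvariantMeasure G X (μ : Measure X) ∧
    (μ : Measure X).support = Set.univ

end UniqueErgodicity

end WeakMean

end

/-!
The averages `S_n` are asymptotically invariant, and if `𝒲_F` is continuous they are asymptotically
equicontinuous, because `|S_n f x - S_n f y| ≤ ε + C W(S_n* δ_x, S_n* δ_y)`. On the closure of an
orbit there is, by amenability, an invariant measure; by the mean ergodic theorem and
equicontinuity, the averages converge at each point of its support. Weak mean equicontinuity along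
the translated sequences `F_n c_n` carries the convergence over to the whole orbit closure, with a
single limit there. The limit `S f` is then invariant and continuous, and
`S f x = ∫ f dμ_x` for the only invariant measure `μ_x` on the closure of `Gx`. If there is an
invariant measure of full support, then one Følner sequence suffices. For a right Følner sequence,
the averages forget the starting point within an orbit, which again gives unique ergodicity.

Conversely, unique ergodicity with continuous `x ↦ μ_x` makes the averages converge uniformly, since
every limit of averages at varying base points is an integral against an invariant measure; and
then `𝒲 x y = W(μ_x, μ_y)`, which is continuous by Kantorovich–Rubinstein duality.

The arguments need Følner sequences to exist. By Day's convexity argument, amenability gives almost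
invariant finite averages, first weakly and then in norm. In the thick case the superlevel sets of
an almost invariant density are almost invariant sets; in the thin case Hall's theorem turns almost
invariant averages into matchings.
-/

noncomputable section

open scoped ProbabilityTheory

namespace WeakMean

section Functionals

theorem exists_probabilityMeasure_of_functional {X : Type*} [TopologicalSpace X] [T2Space X]
    [CompactSpace X] [MeasurableSpace X] [BorelSpace X] (Λ : C(X, ℝ) →ₗ[ℝ] ℝ)
    (hΛ : ∀ f, 0 ≤ f → 0 ≤ Λ f) (hΛ_one : Λ 1 = 1) :
    ∃ ν : ProbabilityMeasure X, ∀ f : C(X, ℝ), ∫ x, f x ∂(ν : Measure X) = Λ f := by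
  let Λ' : CompactlySupportedContinuousMap X ℝ →ₚ[ℝ] ℝ := PositiveLinearMap.mk₀
    { toFun := fun f => Λ f.toContinuousMap
      map_add' := fun f g => Λ.map_add f.toContinuousMap g.toContinuousMap
      map_smul' := fun c f => Λ.map_smul c f.toContinuousMap }
    (fun f hf => hΛ f.toContinuousMap fun x => hf x)
  have integral_eq (f : C(X, ℝ)) : ∫ x, f x ∂(RealRMK.rieszMeasure Λ') = Λ f :=
    RealRMK.integral_rieszMeasure Λ' ⟨f, HasCompactSupport.of_compactSpace _⟩
  have hprob : IsProbabilityMeasure (RealRMK.rieszMeasure Λ') := by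
    have h := integral_eq 1
    simp only [ContinuousMap.one_apply, integral_const, smul_eq_mul, mul_one, hΛ_one] at h
    exact ⟨(ENNReal.toReal_eq_one_iff _).1 h⟩
  exact ⟨⟨_, hprob⟩, integral_eq⟩

theorem integrable_continuousMap {X : Type*} [TopologicalSpace X] [CompactSpace X]
    [MeasurableSpace X] [BorelSpace X] (ν : Measure X) [IsFiniteMeasure ν] (f : C(X, ℝ)) :
    Integrable (fun x => f x) ν :=
  f.continuous.integrable_of_hasCompactSupport (HasCompactSupport.of_compactSpace _)

/-- Integration against a finite measure, as a continuous linear functional on `C(X)`. -/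
def integralCLM {X : Type*} [TopologicalSpace X] [CompactSpace X] [MeasurableSpace X]
    [BorelSpace X] (ν : Measure X) [IsFiniteMeasure ν] : C(X, ℝ) →L[ℝ] ℝ :=
  LinearMap.mkContinuous
    { toFun := fun f => ∫ x, f x ∂ν
      map_add' := fun f g =>
        integral_add (integrable_continuousMap ν f) (integrable_continuousMap ν g)
      map_smul' := fun c _ => integral_const_mul c _ } (ν.real Set.univ) fun f =>
    (norm_integral_le_of_norm_le_const (ae_of_all _ f.norm_coe_le_norm)).trans_eq (mul_comm _ _)

theorem measure_eq_one_of_integral_infDist_eq_zero {X : Type*} [PseudoMetricSpace X]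
    [CompactSpace X] [MeasurableSpace X] [BorelSpace X] (ν : Measure X) [IsProbabilityMeasure ν]
    {Y : Set X} (hY : IsClosed Y) (hne : Y.Nonempty) (h : ∫ x, Metric.infDist x Y ∂ν = 0) :
    ν Y = 1 := by
  rw [integral_eq_zero_iff_of_nonneg (fun x => Metric.infDist_nonneg)
    (integrable_continuousMap ν ⟨_, Metric.continuous_infDist_pt Y⟩)] at h
  refine (mem_ae_iff_prob_eq_one hY.measurableSet).1 ?_
  filter_upwards [h] with x hx using (hY.mem_iff_infDist_zero hne).2 hx

end Functionals

section Translation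

variable {G X : Type*} [Group G] [TopologicalSpace X] [MulAction G X]

/-- The translate `x ↦ f (g x)` of a continuous function: the action of `G` on `C(X)`, written on
the left although it is a right action. -/
def translate [ContinuousConstSMul G X] (g : G) (f : C(X, ℝ)) : C(X, ℝ) :=
  ⟨fun x => f (g • x), f.continuous.comp (continuous_const_smul g)⟩

@[simp] theorem translate_apply [ContinuousConstSMul G X] (g : G) (f : C(X, ℝ)) (x : X) :
    translate g f x = f (g • x) := rfl

theorem norm_translate_le [CompactSpace X] [ContinuousConstSMul G X] (g : G) (f : C(X, ℝ)) :
    ‖translate g f‖ ≤ ‖f‖ :=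
  (ContinuousMap.norm_le _ (norm_nonneg _)).2 fun _ => f.norm_coe_le_norm _

theorem continuous_translate [TopologicalSpace G] [ContinuousSMul G X] (f : C(X, ℝ)) :
    Continuous fun g : G => translate g f :=
  ContinuousMap.continuous_of_continuous_uncurry _
    (f.continuous.comp continuous_smul : Continuous fun p : G × X => f (p.1 • p.2))

theorem eventually_forall_abs_smul_sub_lt [TopologicalSpace G] [ContinuousSMul G X]
    [CompactSpace X] (f : C(X, ℝ)) {ε : ℝ} (hε : 0 < ε) :
    ∀ᶠ u in 𝓝 (1 : G), ∀ x, |f (u • x) - f x| < ε := by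
  have htendsto := (continuous_translate (G := G) f).tendsto 1
  rw [show translate (1 : G) f = f by ext x; simp, Metric.tendsto_nhds] at htendsto
  filter_upwards [htendsto ε hε] with u hu x
  rw [dist_eq_norm] at hu
  exact ((translate u f - f).norm_coe_le_norm x).trans_lt hu

theorem smulInvariantMeasure_of_integral_translate [ContinuousConstSMul G X]
    [HasOuterApproxClosed X] [MeasurableSpace X] [BorelSpace X] {ν : Measure X} [IsFiniteMeasure ν]
    (h : ∀ (g : G) (f : C(X, ℝ)), ∫ x, translate g f x ∂ν = ∫ x, f x ∂ν) :
    SMulInvariantMeasure G X ν := by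
  refine ((smulInvariantMeasure_tfae G ν).out 0 5).2 fun g => ?_
  have := Measure.isFiniteMeasure_map ν (fun x : X => g • x)
  refine ext_of_forall_integral_eq_of_IsFiniteMeasure fun f => ?_
  rw [integral_map (continuous_const_smul g).measurable.aemeasurable
    f.continuous.aestronglyMeasurable]
  exact h g f.toContinuousMap

theorem exists_smulInvariantMeasure_of_functional [ContinuousConstSMul G X] [T2Space X]
    [CompactSpace X] [HasOuterApproxClosed X] [MeasurableSpace X] [BorelSpace X]
    (Λ : C(X, ℝ) →ₗ[ℝ] ℝ) (hΛ : ∀ f, 0 ≤ f → 0 ≤ Λ f) (hΛ_one : Λ 1 = 1)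
    (hΛ_inv : ∀ (g : G) (f : C(X, ℝ)), Λ (translate g f) = Λ f) :
    ∃ ν : ProbabilityMeasure X, SMulInvariantMeasure G X (ν : Measure X) ∧
      ∀ f : C(X, ℝ), ∫ x, f x ∂(ν : Measure X) = Λ f := by
  obtain ⟨ν, hν⟩ := exists_probabilityMeasure_of_functional Λ hΛ hΛ_one
  exact ⟨ν, smulInvariantMeasure_of_integral_translate fun g f => by rw [hν, hν, hΛ_inv], hν⟩

end Translation

section InvariantMeasure

variable {G : Type*} [Group G] [TopologicalSpace G]
variable {X : Type*} [MetricSpace X] [CompactSpace X] [MulAction G X] [ContinuousSMul G X]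

/-- The function `g ↦ f (g x)` on the group, through which means on `rucb G` act on `C(X)`. -/
def orbitFun (x : X) (f : C(X, ℝ)) : rucb G :=
  ⟨BoundedContinuousFunction.ofNormedAddCommGroup (fun g : G => f (g • x))
    (f.continuous.comp (continuous_id.smul continuous_const)) ‖f‖ fun g => f.norm_coe_le_norm _, by
    intro ε hε
    filter_upwards [eventually_forall_abs_smul_sub_lt f hε] with u hu y
    simpa [mul_smul] using hu (y • x)⟩

theorem IsAmenable.exists_invariant_on_orbitClosure [MeasurableSpace X] [BorelSpace X]
    (hG : IsAmenable G) (x : X) :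
    ∃ ν : ProbabilityMeasure X, SMulInvariantMeasure G X (ν : Measure X) ∧
      (ν : Measure X) (closure (MulAction.orbit G x)) = 1 := by
  obtain ⟨m, hpos, hone, hinv⟩ := hG
  let Λ : C(X, ℝ) →ₗ[ℝ] ℝ := m ∘ₗ
    { toFun := fun f => orbitFun x f
      map_add' := fun f g => rfl
      map_smul' := fun c f => rfl }
  obtain ⟨ν, hν, hνΛ⟩ := exists_smulInvariantMeasure_of_functional (G := G) Λ
    (fun f hf => hpos _ fun g => hf _) (hone _ fun g => rfl)
    (fun g f => hinv g _ _ fun y => congrArg f (mul_smul g y x).symm)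
  refine ⟨ν, hν, measure_eq_one_of_integral_infDist_eq_zero (ν : Measure X) isClosed_closure
    (MulAction.nonempty_orbit x).closure ?_⟩
  let d : C(X, ℝ) := ⟨_, Metric.continuous_infDist_pt (closure (MulAction.orbit G x))⟩
  have hd : orbitFun x d = (0 : rucb G) := by
    ext g
    exact Metric.infDist_zero_of_mem (subset_closure (MulAction.mem_orbit x g))
  calc ∫ y, d y ∂(ν : Measure X) = m (orbitFun x d) := hνΛ d
    _ = 0 := by rw [hd, map_zero]

end InvariantMeasure

section UniqueInvariant

variable {G X : Type*} [Group G] [MulAction G X]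

theorem smulInvariantMeasure_cond [MeasurableSpace X] {μ : Measure X} [SMulInvariantMeasure G X μ]
    {s : Set X} (hs : MeasurableSet s) (hinv : ∀ g : G, (g • ·) ⁻¹' s =ᵐ[μ] s) :
    SMulInvariantMeasure G X μ[|s] := by
  refine ⟨fun g t ht => ?_⟩
  have hae : (s ∩ (g • ·) ⁻¹' t : Set X) =ᵐ[μ] ((g • ·) ⁻¹' (s ∩ t) : Set X) :=
    (hinv g).symm.inter (ae_eq_refl _)
  rw [ProbabilityTheory.cond_apply hs, ProbabilityTheory.cond_apply hs, measure_congr hae,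
    SMulInvariantMeasure.measure_preimage_smul g (hs.inter ht)]

theorem IsUniqueInvariantOn.ergodicSMul [MeasurableSpace X] {Y : Set X} (hY : MeasurableSet Y)
    {μ : ProbabilityMeasure X} (h : IsUniqueInvariantOn G X Y μ) :
    ErgodicSMul G X (μ : Measure X) := by
  have hinv := h.1.1
  refine { aeconst_of_forall_preimage_smul_ae_eq := @fun s hs hsinv => ?_ }
  rw [eventuallyConst_set', or_iff_not_imp_left]
  intro hs_empty
  have hs₀ : (μ : Measure X) s ≠ 0 := fun h₀ => hs_empty (ae_eq_empty.2 h₀)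
  have hprob := ProbabilityTheory.cond_isProbabilityMeasure hs₀
  have hYcond : (μ : Measure X)[|s] Y = 1 :=
    (mem_ae_iff_prob_eq_one hY).1 <| ProbabilityTheory.cond_absolutelyContinuous.ae_le <|
      (mem_ae_iff_prob_eq_one hY).2 h.1.2
  have hcond : (⟨_, hprob⟩ : ProbabilityMeasure X) = μ :=
    h.2 ⟨_, hprob⟩ (smulInvariantMeasure_cond hs hsinv) hYcond
  have hs₁ : (μ : Measure X) s = 1 := by
    rw [← ProbabilityTheory.cond_apply_self hs₀ (measure_ne_top (μ : Measure X) s)]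
    exact congrArg (fun ν : ProbabilityMeasure X => (ν : Measure X) s) hcond.symm
  exact eventuallyEq_univ.2 ((mem_ae_iff_prob_eq_one hs).2 hs₁)

end UniqueInvariant

section Averaging

variable {G : Type*} [Group G] [TopologicalSpace G] [MeasurableSpace G] [BorelSpace G]
variable {X : Type*} [MetricSpace X] [CompactSpace X] [MulAction G X] [ContinuousSMul G X]

theorem avgOp_eq_integral_cond (θ : Measure G) (F : Set G) (f : C(X, ℝ)) (x : X) :
    avgOp X θ F f x = ∫ g, f (g • x) ∂θ[|F] := by
  rw [avgOp_apply, average, Measure.restrict_apply_univ, ProbabilityTheory.cond]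

theorem integrable_translate (ρ : Measure G) [IsFiniteMeasure ρ] (f : C(X, ℝ)) :
    Integrable (fun g : G => translate g f) ρ :=
  .of_bound (continuous_translate f).aestronglyMeasurable ‖f‖
    (ae_of_all _ fun g => norm_translate_le g f)

theorem avgOp_eq_integral_translate (θ : Measure G) (F : Set G) (f : C(X, ℝ)) :
    avgOp X θ F f = ∫ g, translate g f ∂θ[|F] := by
  ext x
  rw [ContinuousMap.integral_apply (integrable_translate _ f), avgOp_eq_integral_cond]
  rfl

theorem norm_avgOp_le (θ : Measure G) (F : Set G) (f : C(X, ℝ)) : ‖avgOp X θ F f‖ ≤ ‖f‖ :=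
  ((avgOp X θ F).le_of_opNorm_le (LinearMap.mkContinuous_norm_le _ zero_le_one _) f).trans_eq
    (one_mul _)

theorem abs_avgOp_le (θ : Measure G) (F : Set G) (f : C(X, ℝ)) (x : X) :
    |avgOp X θ F f x| ≤ ‖f‖ :=
  ((avgOp X θ F f).norm_coe_le_norm x).trans (norm_avgOp_le θ F f)

theorem avgOp_nonneg (θ : Measure G) (F : Set G) {f : C(X, ℝ)} (hf : 0 ≤ f) :
    0 ≤ avgOp X θ F f := fun x => by
  change 0 ≤ avgOp X θ F f x
  rw [avgOp_apply]
  exact integral_nonneg fun g => hf _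

theorem avgOp_eq_of_forall_smul_eq {θ : Measure G} {F : Set G} (h₀ : θ F ≠ 0) (h_top : θ F ≠ ⊤)
    {f : C(X, ℝ)} {x : X} {c : ℝ} (hf : ∀ g : G, f (g • x) = c) : avgOp X θ F f x = c := by
  rw [avgOp_apply]
  simp only [hf]
  exact setAverage_const h₀ h_top c

variable [MeasurableSpace X] [BorelSpace X]

theorem integral_avgOp {θ : Measure G} {F : Set G} (h₀ : θ F ≠ 0) (h_top : θ F ≠ ⊤)
    (ν : Measure X) [IsFiniteMeasure ν] [SMulInvariantMeasure G X ν] (f : C(X, ℝ)) :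
    ∫ x, avgOp X θ F f x ∂ν = ∫ x, f x ∂ν := by
  have := ProbabilityTheory.cond_isProbabilityMeasure_of_finite h₀ h_top
  calc ∫ x, avgOp X θ F f x ∂ν = integralCLM ν (∫ g, translate g f ∂θ[|F]) := by
        rw [← avgOp_eq_integral_translate]; rfl
    _ = ∫ g, ∫ x, f (g • x) ∂ν ∂θ[|F] :=
      ((integralCLM ν).integral_comp_comm (integrable_translate _ f)).symm
    _ = ∫ x, f x ∂ν := by simp [integral_smul_eq_self]

theorem tendsto_integral_of_tendsto_avgOp (θ : Measure G) (F : ℕ → Set G) (ν : Measure X)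
    [IsFiniteMeasure ν] (f : C(X, ℝ)) {φ : X → ℝ}
    (h : ∀ᵐ x ∂ν, Tendsto (fun n => avgOp X θ (F n) f x) atTop (𝓝 (φ x))) :
    Tendsto (fun n => ∫ x, avgOp X θ (F n) f x ∂ν) atTop (𝓝 (∫ x, φ x ∂ν)) :=
  tendsto_integral_of_dominated_convergence (fun _ => ‖f‖)
    (fun n => (avgOp X θ (F n) f).continuous.aestronglyMeasurable) (integrable_const _)
    (fun n => ae_of_all _ fun x => abs_avgOp_le θ (F n) f x) h

theorem integral_eq_of_tendsto_avgOp {θ : Measure G} {F : ℕ → Set G} (h₀ : ∀ n, θ (F n) ≠ 0)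
    (h_top : ∀ n, θ (F n) ≠ ⊤) {f φ : C(X, ℝ)} (hφ : ∀ (g : G) x, φ (g • x) = φ x)
    (hlim : ∀ x, Tendsto (fun n => avgOp X θ (F n) f x) atTop (𝓝 (φ x)))
    (ν : Measure X) [IsProbabilityMeasure ν] [SMulInvariantMeasure G X ν] {x : X}
    (hν : ν (closure (MulAction.orbit G x)) = 1) : ∫ y, f y ∂ν = φ x := by
  have hclosure : ∀ y ∈ closure (MulAction.orbit G x), φ y = φ x := by
    refine closure_minimal ?_ (isClosed_eq φ.continuous continuous_const)
    rintro _ ⟨g, rfl⟩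
    exact hφ g x
  have hae : ∀ᵐ y ∂ν, φ y = φ x :=
    Eventually.mono ((mem_ae_iff_prob_eq_one isClosed_closure.measurableSet).2 hν) hclosure
  have hconst := tendsto_integral_of_tendsto_avgOp θ F ν f (ae_of_all _ hlim)
  simp only [integral_avgOp (h₀ _) (h_top _)] at hconst
  calc ∫ y, f y ∂ν = ∫ y, φ y ∂ν := tendsto_nhds_unique tendsto_const_nhds hconst
    _ = φ x := by simp [integral_congr_ae hae]

theorem continuouslyUniquelyErgodic_of_tendsto (hG : IsAmenable G) {θ : Measure G}
    {F : ℕ → Set G} (h₀ : ∀ n, θ (F n) ≠ 0) (h_top : ∀ n, θ (F n) ≠ ⊤)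
    (h : ∀ f : C(X, ℝ), ∃ φ : C(X, ℝ), (∀ (g : G) x, φ (g • x) = φ x) ∧
      ∀ x, Tendsto (fun n => avgOp X θ (F n) f x) atTop (𝓝 (φ x))) :
    ContinuouslyUniquelyErgodic G X := by
  choose φ hφ hlim using h
  choose μ hμ hμ_closure using fun x : X => hG.exists_invariant_on_orbitClosure x
  have integral_eq (x : X) (ν : ProbabilityMeasure X)
      (hν : SMulInvariantMeasure G X (ν : Measure X))
      (hx : (ν : Measure X) (closure (MulAction.orbit G x)) = 1) (f : C(X, ℝ)) :
      ∫ y, f y ∂(ν : Measure X) = φ f x :=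
    integral_eq_of_tendsto_avgOp h₀ h_top (hφ f) (hlim f) _ hx
  have huniq (x : X) : IsUniqueInvariantOn G X (closure (MulAction.orbit G x)) (μ x) := by
    refine ⟨⟨hμ x, hμ_closure x⟩, fun ν hν hνx => Subtype.ext ?_⟩
    refine ext_of_forall_integral_eq_of_IsFiniteMeasure (μ := (ν : Measure X))
      (ν := (μ x : Measure X)) fun f => ?_
    exact (integral_eq x ν hν hνx f.toContinuousMap).trans
      (integral_eq x (μ x) (hμ x) (hμ_closure x) f.toContinuousMap).symm
  refine ⟨μ, continuous_iff_continuousAt.2 fun x => ?_,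
    fun x => ⟨huniq x, (huniq x).ergodicSMul isClosed_closure.measurableSet⟩⟩
  refine ProbabilityMeasure.tendsto_iff_forall_integral_tendsto.2 fun f => ?_
  have hμφ (y : X) : ∫ z, f z ∂(μ y : Measure X) = φ f.toContinuousMap y :=
    integral_eq y (μ y) (hμ y) (hμ_closure y) f.toContinuousMap
  simpa only [hμφ] using (φ f.toContinuousMap).continuous.tendsto x

end Averaging

section AsymptoticInvariance

variable {G : Type*} [Group G] [TopologicalSpace G] [MeasurableSpace G] [BorelSpace G]

/-- The averages along `F` are asymptotically invariant: `S_n (f ∘ g) - S_n f → 0` in `C(X)`. -/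
def AsymptoticallyInvariant (X : Type*) [MetricSpace X] [CompactSpace X] [MulAction G X]
    [ContinuousSMul G X] (θ : Measure G) (F : ℕ → Set G) : Prop :=
  ∀ (g : G) (f : C(X, ℝ)),
    Tendsto (fun n => avgOp X θ (F n) (translate g f) - avgOp X θ (F n) f) atTop (𝓝 0)

/-- The averages along `F` are asymptotically equicontinuous: the oscillation of `S_n f` near a
point is eventually small, where the rank after which this holds may depend on both points. -/
def AsymptoticallyEquicontinuous (X : Type*) [MetricSpace X] [CompactSpace X] [MulAction G X]
    [ContinuousSMul G X] (θ : Measure G) (F : ℕ → Set G) : Prop :=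
  ∀ (f : C(X, ℝ)), ∀ ε > 0, ∀ x : X, ∀ᶠ y in 𝓝 x, ∀ᶠ n in atTop,
    |avgOp X θ (F n) f y - avgOp X θ (F n) f x| < ε

variable {X : Type*} [MetricSpace X] [CompactSpace X] [MulAction G X] [ContinuousSMul G X]

theorem AsymptoticallyEquicontinuous.continuous_of_tendsto {θ : Measure G} {F : ℕ → Set G}
    (h : AsymptoticallyEquicontinuous X θ F) {f : C(X, ℝ)} {φ : X → ℝ}
    (hφ : ∀ x, Tendsto (fun n => avgOp X θ (F n) f x) atTop (𝓝 (φ x))) : Continuous φ := by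
  refine continuous_iff_continuousAt.2 fun x => Metric.tendsto_nhds.2 fun ε hε => ?_
  filter_upwards [h f (ε / 2) (half_pos hε) x] with y hy
  exact (le_of_tendsto ((hφ y).sub (hφ x)).abs (hy.mono fun n hn => hn.le)).trans_lt
    (half_lt_self hε)

theorem exists_tendsto_avgOp_ultrafilter (θ : Measure G) (F : ℕ → Set G) (U : Ultrafilter ℕ)
    (x : ℕ → X) :
    ∃ Λ : C(X, ℝ) →ₗ[ℝ] ℝ, ∀ f, Tendsto (fun n => avgOp X θ (F n) f (x n)) U (𝓝 (Λ f)) := by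
  have hex (f : C(X, ℝ)) : ∃ a, Tendsto (fun n => avgOp X θ (F n) f (x n)) U (𝓝 a) := by
    obtain ⟨a, -, ha⟩ := (isCompact_Icc (a := -‖f‖) (b := ‖f‖)).ultrafilter_le_nhds
      (U.map fun n => avgOp X θ (F n) f (x n)) (le_principal_iff.2 <| Filter.mem_map.2 <|
        Filter.univ_mem' fun n => abs_le.1 (abs_avgOp_le θ (F n) f (x n)))
    exact ⟨a, ha⟩
  choose Λ hΛ using hex
  exact ⟨{
    toFun := Λ
    map_add' := fun f g => tendsto_nhds_unique (hΛ (f + g)) (by simpa using (hΛ f).add (hΛ g))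
    map_smul' := fun c f =>
      tendsto_nhds_unique (hΛ (c • f)) (by simpa using (hΛ f).const_mul c) }, hΛ⟩

theorem AsymptoticallyInvariant.exists_limit_measure [MeasurableSpace X] [BorelSpace X]
    {θ : Measure G} {F : ℕ → Set G} (h₀ : ∀ n, θ (F n) ≠ 0) (h_top : ∀ n, θ (F n) ≠ ⊤)
    (hF : AsymptoticallyInvariant X θ F) (U : Ultrafilter ℕ) (hU : (U : Filter ℕ) ≤ atTop)
    (x : ℕ → X) :
    ∃ ν : ProbabilityMeasure X, SMulInvariantMeasure G X (ν : Measure X) ∧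
      ∀ f : C(X, ℝ), Tendsto (fun n => avgOp X θ (F n) f (x n)) U
        (𝓝 (∫ y, f y ∂(ν : Measure X))) := by
  obtain ⟨Λ, hΛ⟩ := exists_tendsto_avgOp_ultrafilter θ F U x
  have hpos (f : C(X, ℝ)) (hf : 0 ≤ f) : 0 ≤ Λ f :=
    ge_of_tendsto (hΛ f) (Eventually.of_forall fun n => avgOp_nonneg θ (F n) hf (x n))
  have hone : Λ 1 = 1 := tendsto_nhds_unique (hΛ 1) <| tendsto_const_nhds.congr fun n =>
    (avgOp_eq_of_forall_smul_eq (h₀ n) (h_top n) fun _ => rfl).symm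
  have hinv (g : G) (f : C(X, ℝ)) : Λ (translate g f) = Λ f := by
    have hzero : Tendsto
        (fun n => avgOp X θ (F n) (translate g f) (x n) - avgOp X θ (F n) f (x n)) U (𝓝 0) :=
      squeeze_zero_norm (fun n => ContinuousMap.norm_coe_le_norm
        (avgOp X θ (F n) (translate g f) - avgOp X θ (F n) f) (x n))
        ((tendsto_norm_zero.comp (hF g f)).mono_left hU)
    exact sub_eq_zero.1 (tendsto_nhds_unique ((hΛ _).sub (hΛ f)) hzero)
  obtain ⟨ν, hν, hνΛ⟩ := exists_smulInvariantMeasure_of_functional Λ hpos hone hinv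
  exact ⟨ν, hν, fun f => by simpa only [hνΛ] using hΛ f⟩

end AsymptoticInvariance

section UniformConvergence

/-- The operator `f ↦ (x ↦ ∫ f dμ_x)` on `C(X)` given by a weak* continuous family of probability
measures. -/
def kernelOp {X : Type*} [TopologicalSpace X] [CompactSpace X] [MeasurableSpace X] [BorelSpace X]
    (μ : X → ProbabilityMeasure X) (hμ : Continuous μ) : C(X, ℝ) →L[ℝ] C(X, ℝ) :=
  LinearMap.mkContinuous
    { toFun := fun f =>
        ⟨fun x => ∫ y, f y ∂(μ x : Measure X), continuous_iff_continuousAt.2 fun x =>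
          ProbabilityMeasure.tendsto_iff_forall_integral_tendsto.1 (hμ.tendsto x)
            (BoundedContinuousFunction.mkOfCompact f)⟩
      map_add' := fun f g => ContinuousMap.ext fun x =>
        integral_add (integrable_continuousMap _ f) (integrable_continuousMap _ g)
      map_smul' := fun c _ => ContinuousMap.ext fun _ => integral_const_mul c _ } 1 fun f => by
    rw [one_mul, ContinuousMap.norm_le _ (norm_nonneg _)]
    intro x
    exact (norm_integral_le_of_norm_le_const (ae_of_all _ f.norm_coe_le_norm)).trans_eq (by simp)

theorem kernelOp_apply {X : Type*} [TopologicalSpace X] [CompactSpace X] [MeasurableSpace X]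
    [BorelSpace X] {μ : X → ProbabilityMeasure X} (hμ : Continuous μ) (f : C(X, ℝ)) (x : X) :
    kernelOp μ hμ f x = ∫ y, f y ∂(μ x : Measure X) := rfl

theorem apply_smul_eq_of_isUniqueInvariantOn {G X : Type*} [Group G] [MetricSpace X] [MulAction G X]
    [MeasurableSpace X] {μ : X → ProbabilityMeasure X}
    (hu : ∀ x, IsUniqueInvariantOn G X (closure (MulAction.orbit G x)) (μ x)) (g : G) (x : X) :
    μ (g • x) = μ x := by
  have h := (hu (g • x)).1
  rw [MulAction.orbit_smul] at h
  exact (hu x).2 _ h.1 h.2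

variable {G : Type*} [Group G] [TopologicalSpace G] [MeasurableSpace G] [BorelSpace G]
variable {X : Type*} [MetricSpace X] [CompactSpace X] [MulAction G X] [ContinuousSMul G X]
variable [MeasurableSpace X] [BorelSpace X]
variable {μ : X → ProbabilityMeasure X} {θ : Measure G} {F : ℕ → Set G}

theorem AsymptoticallyInvariant.tendsto_avgOp_apply
    (hu : ∀ x, IsUniqueInvariantOn G X (closure (MulAction.orbit G x)) (μ x))
    (h₀ : ∀ n, θ (F n) ≠ 0) (h_top : ∀ n, θ (F n) ≠ ⊤) (hF : AsymptoticallyInvariant X θ F)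
    (f : C(X, ℝ)) (x : X) :
    Tendsto (fun n => avgOp X θ (F n) f x) atTop (𝓝 (∫ y, f y ∂(μ x : Measure X))) := by
  refine (tendsto_iff_ultrafilter ..).2 fun U hU => ?_
  obtain ⟨ν, hν, hlim⟩ := hF.exists_limit_measure h₀ h_top U hU fun _ => x
  have hne : (closure (MulAction.orbit G x)).Nonempty := (MulAction.nonempty_orbit x).closure
  let d : C(X, ℝ) := ⟨_, Metric.continuous_infDist_pt (closure (MulAction.orbit G x))⟩
  have hd (n : ℕ) : avgOp X θ (F n) d x = 0 :=
    avgOp_eq_of_forall_smul_eq (h₀ n) (h_top n) fun g =>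
      Metric.infDist_zero_of_mem (subset_closure (MulAction.mem_orbit x g))
  have hνx : ν = μ x := (hu x).2 ν hν <|
    measure_eq_one_of_integral_infDist_eq_zero (ν : Measure X) isClosed_closure hne <|
      tendsto_nhds_unique (hlim d) (tendsto_const_nhds.congr fun n => (hd n).symm)
  exact hνx ▸ hlim f

theorem exists_norm_eq_norm_apply {X : Type*} [TopologicalSpace X] [CompactSpace X] [Nonempty X]
    (f : C(X, ℝ)) : ∃ x, ‖f‖ = ‖f x‖ := by
  obtain ⟨x, -, hx⟩ := isCompact_univ.exists_isMaxOn Set.univ_nonempty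
    f.continuous.norm.continuousOn
  exact ⟨x, ((ContinuousMap.norm_le _ (norm_nonneg _)).2 fun y => hx (Set.mem_univ y)).antisymm
    (f.norm_coe_le_norm x)⟩

-- At points `x n` where `S_n f - S f` attains its norm, the averages `S_n f (x n)` converge along
-- every ultrafilter to the integral of `f` against an invariant measure `ν`, the values
-- `S f (x n) = S_n (S f) (x n)` to that of `S f`, and these two integrals agree.
theorem AsymptoticallyInvariant.tendsto_avgOp (hμ : Continuous μ)
    (hu : ∀ x, IsUniqueInvariantOn G X (closure (MulAction.orbit G x)) (μ x))
    (h₀ : ∀ n, θ (F n) ≠ 0) (h_top : ∀ n, θ (F n) ≠ ⊤) (hF : AsymptoticallyInvariant X θ F)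
    (f : C(X, ℝ)) : Tendsto (fun n => avgOp X θ (F n) f) atTop (𝓝 (kernelOp μ hμ f)) := by
  rcases isEmpty_or_nonempty X with hX | hX
  · exact tendsto_const_nhds.congr fun n => ContinuousMap.ext fun x => (hX.false x).elim
  set S := kernelOp μ hμ with hS
  have integral_eq (ν : ProbabilityMeasure X) (hν : SMulInvariantMeasure G X (ν : Measure X)) :
      ∫ x, S f x ∂(ν : Measure X) = ∫ x, f x ∂(ν : Measure X) := by
    have hlim := tendsto_integral_of_tendsto_avgOp θ F (ν : Measure X) f
      (ae_of_all _ (hF.tendsto_avgOp_apply hu h₀ h_top f))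
    simp only [integral_avgOp (h₀ _) (h_top _)] at hlim
    exact tendsto_nhds_unique hlim tendsto_const_nhds
  have avgOp_kernelOp (n : ℕ) (x : X) : avgOp X θ (F n) (S f) x = S f x :=
    avgOp_eq_of_forall_smul_eq (h₀ n) (h_top n) fun g => by
      rw [hS, kernelOp_apply, kernelOp_apply, apply_smul_eq_of_isUniqueInvariantOn hu]
  choose x hx using fun n => exists_norm_eq_norm_apply (avgOp X θ (F n) f - S f)
  refine tendsto_iff_norm_sub_tendsto_zero.2 <| (tendsto_congr hx).2 <|
    (tendsto_iff_ultrafilter ..).2 fun U hU => ?_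
  obtain ⟨ν, hν, hlim⟩ := hF.exists_limit_measure h₀ h_top U hU x
  have hzero := (hlim f).sub (hlim (S f))
  rw [integral_eq ν hν, sub_self] at hzero
  simpa [avgOp_kernelOp] using hzero.norm

end UniformConvergence

section MeanErgodic

theorem exists_measure_pos_forall_abs_sub_lt {X : Type*} [TopologicalSpace X] [MeasurableSpace X]
    {ν : Measure X} {a b : ℕ → X → ℝ} {x : X} (hx : x ∈ ν.support) {δ : ℝ}
    (ha : ∀ᶠ y in 𝓝 x, ∀ᶠ n in atTop, |a n y - a n x| < δ)
    (hb : ∀ᶠ y in 𝓝 x, ∀ᶠ n in atTop, |b n y - b n x| < δ) :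
    ∃ N, 0 < ν {y | ∀ n ≥ N, |a n y - a n x| < δ ∧ |b n y - b n x| < δ} := by
  by_contra! h
  refine ((Measure.mem_support_iff_forall x).1 hx _ ?_).ne'
    (measure_iUnion_null fun N => nonpos_iff_eq_zero.1 (h N))
  filter_upwards [ha, hb] with y hay hby
  exact Set.mem_iUnion.2 (eventually_atTop.1 (hay.and hby))

theorem exists_forall_abs_sub_lt_of_tendstoInMeasure {X : Type*} [TopologicalSpace X]
    [MeasurableSpace X] {ν : Measure X} {a b : ℕ → X → ℝ} {ξ : X → ℝ} {x : X}
    (hx : x ∈ ν.support) (ha : TendstoInMeasure ν a atTop ξ) (hb : TendstoInMeasure ν b atTop ξ)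
    (hax : ∀ ε > 0, ∀ᶠ y in 𝓝 x, ∀ᶠ n in atTop, |a n y - a n x| < ε)
    (hbx : ∀ ε > 0, ∀ᶠ y in 𝓝 x, ∀ᶠ n in atTop, |b n y - b n x| < ε) {ε : ℝ} (hε : 0 < ε) :
    ∃ N, ∀ n ≥ N, ∀ m ≥ N, |a n x - b m x| < ε := by
  have hδ : 0 < ε / 4 := by positivity
  obtain ⟨N, hN⟩ := exists_measure_pos_forall_abs_sub_lt hx (hax _ hδ) (hbx _ hδ)
  have hhalf := gt_mem_nhds (ENNReal.half_pos hN.ne')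
  rw [tendstoInMeasure_iff_dist] at ha hb
  obtain ⟨N', hN'⟩ := eventually_atTop.1
    (((ha _ hδ).eventually hhalf).and ((hb _ hδ).eventually hhalf))
  refine ⟨max N N', fun n hn m hm => ?_⟩
  -- The two exceptional sets together are smaller than the set of points behaving like `x`.
  obtain ⟨y, hyx, hy⟩ : ∃ y ∈ {y | ∀ n ≥ N, |a n y - a n x| < ε / 4 ∧ |b n y - b n x| < ε / 4},
      y ∉ {y | ε / 4 ≤ dist (a n y) (ξ y)} ∪ {y | ε / 4 ≤ dist (b m y) (ξ y)} := by
    refine Set.not_subset.1 fun hsub => ?_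
    have hlt := ENNReal.add_lt_add (hN' n (le_of_max_le_right hn)).1
      (hN' m (le_of_max_le_right hm)).2
    rw [ENNReal.add_halves] at hlt
    exact hlt.not_ge ((measure_mono hsub).trans (measure_union_le _ _))
  simp only [Set.mem_union, Set.mem_ofPred_eq, not_or, not_le, Real.dist_eq] at hy
  have hayx := (hyx n (le_of_max_le_left hn)).1
  have hbyx := (hyx m (le_of_max_le_left hm)).2
  simp only [abs_lt] at hy hayx hbyx ⊢
  constructor <;> linarith

variable {G : Type*} [Group G] [TopologicalSpace G] [MeasurableSpace G] [BorelSpace G]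
variable {X : Type*} [MetricSpace X] [CompactSpace X] [MulAction G X] [ContinuousSMul G X]
variable [MeasurableSpace X] [BorelSpace X]

theorem norm_toLp_translate (ν : Measure X) [IsFiniteMeasure ν] [SMulInvariantMeasure G X ν]
    (g : G) (f : C(X, ℝ)) :
    ‖ContinuousMap.toLp 2 ν ℝ (translate g f)‖ = ‖ContinuousMap.toLp 2 ν ℝ f‖ := by
  have norm_sq (φ : C(X, ℝ)) : ‖ContinuousMap.toLp 2 ν ℝ φ‖ ^ 2 = ∫ x, (φ * φ) x ∂ν := by
    rw [← real_inner_self_eq_norm_sq, ContinuousMap.inner_toLp]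
    simp
  refine (pow_left_inj₀ (norm_nonneg _) (norm_nonneg _) two_ne_zero).1 ?_
  rw [norm_sq, norm_sq]
  exact integral_smul_eq_self (μ := ν) ⇑(f * f) (g := g)

/-- The coboundaries in `L²(ν)`, that is, the span of the functions `φ ∘ g - φ` for continuous
`φ`. The mean ergodic theorem projects onto its orthogonal complement. -/
def coboundary (G : Type*) [Group G] [TopologicalSpace G] [MulAction G X] [ContinuousSMul G X]
    (ν : Measure X) [IsFiniteMeasure ν] : Submodule ℝ (Lp ℝ 2 ν) :=
  Submodule.span ℝ (Set.range fun p : G × C(X, ℝ) =>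
    ContinuousMap.toLp 2 ν ℝ (translate p.1 p.2 - p.2))

theorem norm_toLp_translate_sub_of_mem_orthogonal {ν : Measure X} [IsFiniteMeasure ν]
    [SMulInvariantMeasure G X ν] {ξ : Lp ℝ 2 ν} (hξ : ξ ∈ (coboundary G ν)ᗮ) (g : G)
    (f : C(X, ℝ)) :
    ‖ContinuousMap.toLp 2 ν ℝ (translate g f) - ξ‖ = ‖ContinuousMap.toLp 2 ν ℝ f - ξ‖ := by
  have inner_eq : inner ℝ (ContinuousMap.toLp 2 ν ℝ (translate g f)) ξ =
      inner ℝ (ContinuousMap.toLp 2 ν ℝ f) ξ := by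
    have h : inner ℝ (ContinuousMap.toLp 2 ν ℝ (translate g f - f)) ξ = 0 :=
      hξ _ (Submodule.subset_span ⟨(g, f), rfl⟩)
    rwa [map_sub, inner_sub_left, sub_eq_zero] at h
  refine (pow_left_inj₀ (norm_nonneg _) (norm_nonneg _) two_ne_zero).1 ?_
  rw [norm_sub_sq_real, norm_sub_sq_real (ContinuousMap.toLp 2 ν ℝ f), inner_eq,
    norm_toLp_translate]

theorem norm_toLp_avgOp_sub_le {ν : Measure X} [IsFiniteMeasure ν] [SMulInvariantMeasure G X ν]
    {ξ : Lp ℝ 2 ν} (hξ : ξ ∈ (coboundary G ν)ᗮ) {θ : Measure G} {F : Set G} (h₀ : θ F ≠ 0)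
    (h_top : θ F ≠ ⊤) (f : C(X, ℝ)) :
    ‖ContinuousMap.toLp 2 ν ℝ (avgOp X θ F f) - ξ‖ ≤ ‖ContinuousMap.toLp 2 ν ℝ f - ξ‖ := by
  have := ProbabilityTheory.cond_isProbabilityMeasure_of_finite h₀ h_top
  let T : C(X, ℝ) →L[ℝ] Lp ℝ 2 ν := ContinuousMap.toLp 2 ν ℝ
  have hint := integrable_translate (θ[|F]) f
  calc ‖T (avgOp X θ F f) - ξ‖ = ‖∫ g, (T (translate g f) - ξ) ∂θ[|F]‖ := by
        rw [integral_sub (T.integrable_comp hint) (integrable_const _),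
          avgOp_eq_integral_translate, ← T.integral_comp_comm hint]
        simp
    _ ≤ ∫ g, ‖T (translate g f) - ξ‖ ∂θ[|F] := norm_integral_le_integral_norm _
    _ = ‖T f - ξ‖ := by simp [T, norm_toLp_translate_sub_of_mem_orthogonal hξ]

theorem AsymptoticallyInvariant.exists_tendsto_avgOp_zero {θ : Measure G} {F : ℕ → Set G}
    (hF : AsymptoticallyInvariant X θ F) {ν : Measure X} [IsFiniteMeasure ν] {k : Lp ℝ 2 ν}
    (hk : k ∈ coboundary G ν) :
    ∃ c : C(X, ℝ), ContinuousMap.toLp 2 ν ℝ c = k ∧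
      Tendsto (fun n => avgOp X θ (F n) c) atTop (𝓝 0) := by
  induction hk using Submodule.span_induction with
  | mem k hk =>
    obtain ⟨⟨g, φ⟩, rfl⟩ := hk
    exact ⟨_, rfl, by simpa only [map_sub] using hF g φ⟩
  | zero => exact ⟨0, map_zero _, by simp⟩
  | add k l _ _ hk hl =>
    obtain ⟨c, rfl, hc⟩ := hk
    obtain ⟨d, rfl, hd⟩ := hl
    exact ⟨c + d, map_add _ _ _, by simpa using hc.add hd⟩
  | smul a k _ hk =>
    obtain ⟨c, rfl, hc⟩ := hk
    exact ⟨a • c, map_smul _ _ _, by simpa using hc.const_smul a⟩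

theorem AsymptoticallyInvariant.exists_tendsto_toLp {θ : Measure G} {F : ℕ → Set G}
    (h₀ : ∀ n, θ (F n) ≠ 0) (h_top : ∀ n, θ (F n) ≠ ⊤) (hF : AsymptoticallyInvariant X θ F)
    (ν : Measure X) [IsFiniteMeasure ν] [SMulInvariantMeasure G X ν] (f : C(X, ℝ)) :
    ∃ ξ : Lp ℝ 2 ν, ∀ g : G, Tendsto
      (fun n => ContinuousMap.toLp 2 ν ℝ (translate g (avgOp X θ (F n) f))) atTop (𝓝 ξ) := by
  let T : C(X, ℝ) →L[ℝ] Lp ℝ 2 ν := ContinuousMap.toLp 2 ν ℝ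
  let K := (coboundary G ν).topologicalClosure
  have : CompleteSpace K := (coboundary G ν).isClosed_topologicalClosure.completeSpace_coe
  let ξ := T f - K.starProjection (T f)
  have hξ : ξ ∈ (coboundary G ν)ᗮ := Submodule.orthogonal_le
    (coboundary G ν).le_topologicalClosure (K.sub_starProjection_mem_orthogonal (T f))
  refine ⟨ξ, fun g => tendsto_iff_norm_sub_tendsto_zero.2 ?_⟩
  simp only [norm_toLp_translate_sub_of_mem_orthogonal hξ]
  change Tendsto (fun n => ‖T (avgOp X θ (F n) f) - ξ‖) atTop (𝓝 0)
  refine tendsto_order.2 ⟨fun a ha => .of_forall fun n => ha.trans_le (norm_nonneg _),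
    fun ε hε => ?_⟩
  obtain ⟨k, hk, hkε⟩ := Metric.mem_closure_iff.1
    (K.starProjection_apply_mem (T f) : _ ∈ closure (coboundary G ν : Set (Lp ℝ 2 ν)))
    (ε / 2) (half_pos hε)
  obtain ⟨c, rfl, hc⟩ := hF.exists_tendsto_avgOp_zero hk
  have hTc : Tendsto (fun n => ‖T (avgOp X θ (F n) c)‖) atTop (𝓝 0) := by
    simpa using ((T.continuous.tendsto 0).comp hc).norm
  filter_upwards [hTc.eventually (gt_mem_nhds (half_pos hε))] with n hn
  calc ‖T (avgOp X θ (F n) f) - ξ‖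
      = ‖(T (avgOp X θ (F n) (f - c)) - ξ) + T (avgOp X θ (F n) c)‖ := by
        simp only [map_sub]; abel_nf
    _ ≤ ‖T (f - c) - ξ‖ + ‖T (avgOp X θ (F n) c)‖ := (norm_add_le _ _).trans
        (add_le_add_left (norm_toLp_avgOp_sub_le hξ (h₀ n) (h_top n) _) _)
    _ = dist (K.starProjection (T f)) (T c) + ‖T (avgOp X θ (F n) c)‖ := by
        rw [dist_eq_norm]; simp only [map_sub, ξ]; abel_nf
    _ < ε := by linarith

theorem AsymptoticallyInvariant.exists_tendsto_of_mem_support {θ : Measure G} {F : ℕ → Set G}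
    (h₀ : ∀ n, θ (F n) ≠ 0) (h_top : ∀ n, θ (F n) ≠ ⊤) (hF : AsymptoticallyInvariant X θ F)
    (hE : AsymptoticallyEquicontinuous X θ F)
    (ν : Measure X) [IsFiniteMeasure ν] [SMulInvariantMeasure G X ν] (f : C(X, ℝ))
    {x : X} (hx : x ∈ ν.support) :
    ∃ c : ℝ, ∀ g : G, Tendsto (fun n => avgOp X θ (F n) f (g • x)) atTop (𝓝 c) := by
  obtain ⟨ξ, hξ⟩ := hF.exists_tendsto_toLp h₀ h_top ν f
  have hmeas (g : G) : TendstoInMeasure ν (fun n y => avgOp X θ (F n) f (g • y)) atTop ξ :=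
    (tendstoInMeasure_of_tendsto_Lp (hξ g)).congr_left fun n => ContinuousMap.coeFn_toLp ν _
  have hequi (g : G) (ε : ℝ) (hε : ε > 0) : ∀ᶠ y in 𝓝 x, ∀ᶠ n in atTop,
      |avgOp X θ (F n) f (g • y) - avgOp X θ (F n) f (g • x)| < ε :=
    ((continuous_const_smul g).tendsto x).eventually (hE f ε hε (g • x))
  have hclose (g h : G) (ε : ℝ) (hε : ε > 0) : ∃ N, ∀ n ≥ N, ∀ m ≥ N,
      |avgOp X θ (F n) f (g • x) - avgOp X θ (F m) f (h • x)| < ε :=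
    exists_forall_abs_sub_lt_of_tendstoInMeasure hx (hmeas g) (hmeas h) (hequi g) (hequi h) hε
  have hcauchy : CauchySeq fun n => avgOp X θ (F n) f ((1 : G) • x) := by
    refine Metric.cauchySeq_iff.2 fun ε hε => ?_
    obtain ⟨N, hN⟩ := hclose 1 1 ε hε
    exact ⟨N, fun m hm n hn => hN m hm n hn⟩
  obtain ⟨c, hc⟩ := cauchySeq_tendsto_of_complete hcauchy
  refine ⟨c, fun g => ?_⟩
  have hdiff : Tendsto
      (fun n => avgOp X θ (F n) f (g • x) - avgOp X θ (F n) f ((1 : G) • x)) atTop (𝓝 0) := by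
    refine Metric.tendsto_atTop.2 fun ε hε => ?_
    obtain ⟨N, hN⟩ := hclose g 1 ε hε
    exact ⟨N, fun n hn => by simpa [Real.dist_eq] using hN n hn n hn⟩
  simpa using hdiff.add hc

end MeanErgodic

section WassersteinBasic

theorem prod_mem_joinings {X : Type*} [MeasurableSpace X] (μ ν : Measure X)
    [IsProbabilityMeasure μ] [IsProbabilityMeasure ν] : μ.prod ν ∈ joinings μ ν :=
  ⟨inferInstance, by simp [Measure.map_fst_prod], by simp [Measure.map_snd_prod]⟩

variable {X : Type*} [MetricSpace X] [MeasurableSpace X]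

theorem wasserstein_nonneg (μ ν : Measure X) : 0 ≤ wasserstein μ ν :=
  Real.sInf_nonneg (by rintro _ ⟨ι, -, rfl⟩; exact integral_nonneg fun p => dist_nonneg)

theorem wasserstein_le {μ ν : Measure X} {ι : Measure (X × X)} (h : ι ∈ joinings μ ν) :
    wasserstein μ ν ≤ ∫ p, dist p.1 p.2 ∂ι :=
  csInf_le ⟨0, by rintro _ ⟨ι, -, rfl⟩; exact integral_nonneg fun p => dist_nonneg⟩ ⟨ι, h, rfl⟩

variable [CompactSpace X] [BorelSpace X]

theorem integrable_dist (ι : Measure (X × X)) [IsFiniteMeasure ι] :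
    Integrable (fun p : X × X => dist p.1 p.2) ι :=
  integrable_continuousMap ι ⟨_, continuous_dist⟩

theorem wasserstein_le_diam (μ ν : Measure X) [IsProbabilityMeasure μ] [IsProbabilityMeasure ν] :
    wasserstein μ ν ≤ Metric.diam (Set.univ : Set X) :=
  calc wasserstein μ ν ≤ ∫ p, dist p.1 p.2 ∂(μ.prod ν) := wasserstein_le (prod_mem_joinings μ ν)
    _ ≤ ∫ _, Metric.diam (Set.univ : Set X) ∂(μ.prod ν) :=
      integral_mono (integrable_dist _) (integrable_const _) fun _ =>
        Metric.dist_le_diam_of_mem isCompact_univ.isBounded (Set.mem_univ _) (Set.mem_univ _)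
    _ = Metric.diam (Set.univ : Set X) := by simp

theorem wasserstein_self (μ : Measure X) [IsProbabilityMeasure μ] : wasserstein μ μ = 0 := by
  have hdiag : Measurable fun x : X => (x, x) := by fun_prop
  have hι : μ.map (fun x => (x, x)) ∈ joinings μ μ :=
    ⟨Measure.isProbabilityMeasure_map hdiag.aemeasurable,
      (Measure.map_map measurable_fst hdiag).trans Measure.map_id,
      (Measure.map_map measurable_snd hdiag).trans Measure.map_id⟩
  refine le_antisymm ((wasserstein_le hι).trans_eq ?_) (wasserstein_nonneg μ μ)
  rw [integral_map hdiag.aemeasurable continuous_dist.aestronglyMeasurable]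
  simp

theorem integral_sub_integral_of_mem_joinings {μ ν : Measure X} {ι : Measure (X × X)}
    (hι : ι ∈ joinings μ ν) (f : C(X, ℝ)) :
    ∫ x, f x ∂μ - ∫ x, f x ∂ν = ∫ p, (f p.1 - f p.2) ∂ι := by
  obtain ⟨hprob, rfl, rfl⟩ := hι
  rw [integral_map measurable_fst.aemeasurable f.continuous.aestronglyMeasurable,
    integral_map measurable_snd.aemeasurable f.continuous.aestronglyMeasurable, integral_sub]
  · exact integrable_continuousMap ι (f.comp ContinuousMap.fst)
  · exact integrable_continuousMap ι (f.comp ContinuousMap.snd)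

theorem exists_forall_abs_sub_le_add_mul_dist {X : Type*} [PseudoMetricSpace X] [CompactSpace X]
    (f : C(X, ℝ)) {ε : ℝ} (hε : 0 < ε) :
    ∃ C > 0, ∀ x y, |f x - f y| ≤ ε + C * dist x y := by
  obtain ⟨δ, hδ, h⟩ := Metric.uniformContinuous_iff.1
    (CompactSpace.uniformContinuous_of_continuous f.continuous) ε hε
  refine ⟨2 * ‖f‖ / δ + 1, by positivity, fun x y => ?_⟩
  rcases lt_or_ge (dist x y) δ with hclose | hfar
  · exact (h hclose).le.trans (le_add_of_nonneg_right (by positivity))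
  · calc |f x - f y| ≤ |f x| + |f y| := abs_sub _ _
      _ ≤ 2 * ‖f‖ := by
        rw [two_mul]
        exact add_le_add (f.norm_coe_le_norm x) (f.norm_coe_le_norm y)
      _ ≤ 2 * ‖f‖ / δ * dist x y := by
        rw [div_mul_eq_mul_div, le_div_iff₀ hδ]
        gcongr
      _ ≤ ε + (2 * ‖f‖ / δ + 1) * dist x y := by nlinarith [dist_nonneg (x := x) (y := y)]

theorem exists_forall_abs_integral_sub_le (f : C(X, ℝ)) {ε : ℝ} (hε : 0 < ε) :
    ∃ C > 0, ∀ (μ ν : Measure X) [IsProbabilityMeasure μ] [IsProbabilityMeasure ν],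
      |∫ x, f x ∂μ - ∫ x, f x ∂ν| ≤ ε + C * wasserstein μ ν := by
  obtain ⟨C, hC, hf⟩ := exists_forall_abs_sub_le_add_mul_dist f hε
  refine ⟨C, hC, fun μ ν _ _ => ?_⟩
  rw [← sub_le_iff_le_add', ← div_le_iff₀' hC]
  refine le_csInf ⟨_, _, prod_mem_joinings μ ν, rfl⟩ ?_
  rintro _ ⟨ι, hι, rfl⟩
  have := hι.1
  rw [div_le_iff₀' hC, sub_le_iff_le_add', integral_sub_integral_of_mem_joinings hι f]
  calc |∫ p, (f p.1 - f p.2) ∂ι| ≤ ∫ p, |f p.1 - f p.2| ∂ι := abs_integral_le_integral_abs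
    _ ≤ ∫ p, (ε + C * dist p.1 p.2) ∂ι :=
      integral_mono_of_nonneg (ae_of_all _ fun p => abs_nonneg _)
        ((integrable_const ε).add ((integrable_dist ι).const_mul _))
        (ae_of_all _ fun p => hf p.1 p.2)
    _ = ε + C * ∫ p, dist p.1 p.2 ∂ι := by
      rw [integral_add (integrable_const ε) ((integrable_dist ι).const_mul _), integral_const_mul]
      simp

end WassersteinBasic

section FolnerPseudometric

variable {G : Type*} [Group G] [TopologicalSpace G] [MeasurableSpace G] [BorelSpace G]

theorem isProbabilityMeasure_orbitMeasure {X : Type*} [MetricSpace X] [MulAction G X]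
    [ContinuousSMul G X] [MeasurableSpace X] [BorelSpace X] {θ : Measure G} {F : Set G}
    (h₀ : θ F ≠ 0) (h_top : θ F ≠ ⊤) (x : X) : IsProbabilityMeasure (orbitMeasure θ F x) :=
  have : IsProbabilityMeasure ((θ F)⁻¹ • θ.restrict F) :=
    ProbabilityTheory.cond_isProbabilityMeasure_of_finite h₀ h_top
  Measure.isProbabilityMeasure_map
    (by fun_prop : Continuous fun g : G => g • x).measurable.aemeasurable

variable {X : Type*} [MetricSpace X] [CompactSpace X] [MulAction G X] [ContinuousSMul G X]
variable [MeasurableSpace X] [BorelSpace X]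
variable {θ : Measure G} {F : ℕ → Set G}

theorem wasserstein_orbitMeasure_le_diam (h₀ : ∀ n, θ (F n) ≠ 0) (h_top : ∀ n, θ (F n) ≠ ⊤)
    (x y : X) (n : ℕ) :
    wasserstein (orbitMeasure θ (F n) x) (orbitMeasure θ (F n) y) ≤
      Metric.diam (Set.univ : Set X) :=
  have := isProbabilityMeasure_orbitMeasure (h₀ n) (h_top n) x
  have := isProbabilityMeasure_orbitMeasure (h₀ n) (h_top n) y
  wasserstein_le_diam _ _

theorem folnerW_le_diam (h₀ : ∀ n, θ (F n) ≠ 0) (h_top : ∀ n, θ (F n) ≠ ⊤)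
    (x y : X) : folnerW θ F x y ≤ Metric.diam (Set.univ : Set X) :=
  limsup_le_of_le (isBoundedUnder_of ⟨0, fun _ => wasserstein_nonneg _ _⟩ :
      IsBoundedUnder (· ≥ ·) _ _).isCoboundedUnder_le
    (Eventually.of_forall (wasserstein_orbitMeasure_le_diam h₀ h_top x y))

theorem folnerW_self (h₀ : ∀ n, θ (F n) ≠ 0) (h_top : ∀ n, θ (F n) ≠ ⊤) (x : X) :
    folnerW θ F x x = 0 := by
  have hself (n : ℕ) : wasserstein (orbitMeasure θ (F n) x) (orbitMeasure θ (F n) x) = 0 :=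
    have := isProbabilityMeasure_orbitMeasure (h₀ n) (h_top n) x
    wasserstein_self _
  simp [folnerW, hself]

theorem exists_forall_eventually_of_folnerW_lt (θ : Measure G) (f : C(X, ℝ)) {ε : ℝ}
    (hε : 0 < ε) :
    ∃ δ > 0, ∀ F : ℕ → Set G, (∀ n, θ (F n) ≠ 0) → (∀ n, θ (F n) ≠ ⊤) → ∀ x y : X,
      folnerW θ F x y < δ →
      ∀ᶠ n in atTop, |avgOp X θ (F n) f x - avgOp X θ (F n) f y| < ε := by
  obtain ⟨C, hC, hf⟩ := exists_forall_abs_integral_sub_le f (half_pos hε)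
  refine ⟨ε / 2 / C, by positivity, fun F h₀ h_top x y hxy => ?_⟩
  filter_upwards [eventually_lt_of_limsup_lt hxy
    (isBoundedUnder_of ⟨_, wasserstein_orbitMeasure_le_diam h₀ h_top x y⟩)] with n hn
  have := isProbabilityMeasure_orbitMeasure (h₀ n) (h_top n) x
  have := isProbabilityMeasure_orbitMeasure (h₀ n) (h_top n) y
  have hle := hf (orbitMeasure θ (F n) x) (orbitMeasure θ (F n) y)
  rw [integral_orbitMeasure, integral_orbitMeasure] at hle
  rw [lt_div_iff₀' hC] at hn
  linarith

theorem eventually_lt_of_continuous_uncurry {X : Type*} [TopologicalSpace X] {w : X → X → ℝ}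
    (hw : Continuous fun p : X × X => w p.1 p.2) {x : X} {δ : ℝ} (hx : w x x < δ) :
    ∀ᶠ y in 𝓝 x, w y x < δ :=
  ((hw.comp (.prodMk_left x)).tendsto x).eventually (gt_mem_nhds hx)

theorem FolnerWeaklyMeanEquicontinuous.asymptoticallyEquicontinuous
    (h₀ : ∀ n, θ (F n) ≠ 0) (h_top : ∀ n, θ (F n) ≠ ⊤)
    (h : FolnerWeaklyMeanEquicontinuous X θ F) : AsymptoticallyEquicontinuous X θ F := by
  intro f ε hε x
  obtain ⟨δ, hδ, hf⟩ := exists_forall_eventually_of_folnerW_lt θ f hε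
  filter_upwards [eventually_lt_of_continuous_uncurry h
    ((folnerW_self h₀ h_top x).trans_lt hδ)] with y hy
  exact hf F h₀ h_top y x hy

end FolnerPseudometric

section AveragingClass

variable {G : Type*} [Group G] [TopologicalSpace G] [MeasurableSpace G] [BorelSpace G]
variable {X : Type*} [MetricSpace X] [CompactSpace X] [MulAction G X] [ContinuousSMul G X]

/-- What the equivalence of (i), (ii) and (iii) needs to know about the class of all (thick or
thin) Følner sequences: it is nonempty, its averages are asymptotically invariant, and it is closed
under the translations `F_n ↦ F_n c_n`, which move the base point of an average. -/
structure IsAveragingClass (X : Type*) [MetricSpace X] [CompactSpace X] [MulAction G X]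
    [ContinuousSMul G X] (θ : Measure G) (P : (ℕ → Set G) → Prop) : Prop where
  ne_zero : ∀ F, P F → ∀ n, θ (F n) ≠ 0
  ne_top : ∀ F, P F → ∀ n, θ (F n) ≠ ⊤
  asymptoticallyInvariant : ∀ F, P F → AsymptoticallyInvariant X θ F
  translate : ∀ F, P F → ∀ c : ℕ → G, P fun n => (fun h => h * c n) '' F n
  avgOp_translate : ∀ F, P F → ∀ n (c : G) (f : C(X, ℝ)) x,
    avgOp X θ ((fun h => h * c) '' F n) f x = avgOp X θ (F n) f (c • x)
  nonempty : ∃ F, P F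

variable {θ : Measure G} {F : ℕ → Set G} {P : (ℕ → Set G) → Prop}

theorem AsymptoticallyEquicontinuous.tendsto_sub_of_mem_closure_orbit
    (hE : AsymptoticallyEquicontinuous X θ F) {f : C(X, ℝ)} {x y : X}
    (hF : ∀ g : G, Tendsto
      (fun n => avgOp X θ (F n) f (g • x) - avgOp X θ (F n) f x) atTop (𝓝 0))
    (hy : y ∈ closure (MulAction.orbit G x)) :
    Tendsto (fun n => avgOp X θ (F n) f y - avgOp X θ (F n) f x) atTop (𝓝 0) := by
  refine Metric.tendsto_nhds.2 fun ε hε => ?_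
  obtain ⟨_, hz, g, rfl⟩ := mem_closure_iff_nhds.1 hy _ (hE f (ε / 2) (half_pos hε) y)
  filter_upwards [hz, Metric.tendsto_nhds.1 (hF g) _ (half_pos hε)] with n hgy hgx
  rw [abs_sub_comm] at hgy
  rw [dist_zero_right, Real.norm_eq_abs] at hgx ⊢
  exact (abs_sub_le _ _ _).trans_lt ((add_lt_add hgy hgx).trans_eq (add_halves ε))

variable [MeasurableSpace X] [BorelSpace X]

theorem IsAveragingClass.folnerW_le_supW (hP : IsAveragingClass X θ P) (hF : P F) (x y : X) :
    folnerW θ F x y ≤ supW θ P x y :=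
  le_ciSup (f := fun F : {F : ℕ → Set G // P F} => folnerW θ F.1 x y)
    ⟨Metric.diam (Set.univ : Set X), by
      rintro _ ⟨F, rfl⟩
      exact folnerW_le_diam (hP.ne_zero _ F.2) (hP.ne_top _ F.2) x y⟩ ⟨F, hF⟩

theorem IsAveragingClass.supW_self (hP : IsAveragingClass X θ P) (x : X) :
    supW θ P x x = 0 := by
  have hself (F : {F : ℕ → Set G // P F}) : folnerW θ F.1 x x = 0 :=
    folnerW_self (hP.ne_zero _ F.2) (hP.ne_top _ F.2) x
  simp [supW, hself]

theorem WeaklyMeanEquicontinuous.eventually_forall (hP : IsAveragingClass X θ P)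
    (h : WeaklyMeanEquicontinuous X θ P) (f : C(X, ℝ)) {ε : ℝ} (hε : 0 < ε) (x : X) :
    ∀ᶠ y in 𝓝 x, ∀ F, P F → ∀ᶠ n in atTop,
      |avgOp X θ (F n) f y - avgOp X θ (F n) f x| < ε := by
  obtain ⟨δ, hδ, hf⟩ := exists_forall_eventually_of_folnerW_lt θ f hε
  filter_upwards [eventually_lt_of_continuous_uncurry h ((hP.supW_self x).trans_lt hδ)]
    with y hy F hF
  exact hf F (hP.ne_zero F hF) (hP.ne_top F hF) y x ((hP.folnerW_le_supW hF y x).trans_lt hy)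

theorem AsymptoticallyEquicontinuous.continuouslyUniquelyErgodic_of_forall_tendsto
    (hG : IsAmenable G) (h₀ : ∀ n, θ (F n) ≠ 0) (h_top : ∀ n, θ (F n) ≠ ⊤)
    (hE : AsymptoticallyEquicontinuous X θ F)
    (h : ∀ (f : C(X, ℝ)) (x : X), ∃ c, ∀ g : G,
      Tendsto (fun n => avgOp X θ (F n) f (g • x)) atTop (𝓝 c)) :
    ContinuouslyUniquelyErgodic G X := by
  refine continuouslyUniquelyErgodic_of_tendsto hG h₀ h_top fun f => ?_
  choose φ hφ using h f
  have hlim (x : X) : Tendsto (fun n => avgOp X θ (F n) f x) atTop (𝓝 (φ x)) := by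
    simpa using hφ x 1
  exact ⟨⟨φ, hE.continuous_of_tendsto hlim⟩,
    fun g x => tendsto_nhds_unique (hlim (g • x)) (hφ x g), hlim⟩

-- The averages converge at some `z` in the support of an invariant measure on the closure of `Gx`;
-- weak mean equicontinuity along the translated sequences `F_n g k⁻¹` carries this over to `g x`,
-- for `k x` close to `z`.
theorem WeaklyMeanEquicontinuous.exists_tendsto_avgOp (hG : IsAmenable G)
    (hP : IsAveragingClass X θ P) (h : WeaklyMeanEquicontinuous X θ P) (hF : P F)
    (f : C(X, ℝ)) (x : X) :
    ∃ c, ∀ g : G, Tendsto (fun n => avgOp X θ (F n) f (g • x)) atTop (𝓝 c) := by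
  have hE : AsymptoticallyEquicontinuous X θ F := fun f ε hε x =>
    (h.eventually_forall hP f hε x).mono fun _ hy => hy F hF
  obtain ⟨ν, hν, hνx⟩ := hG.exists_invariant_on_orbitClosure x
  obtain ⟨z, hz⟩ := Measure.nonempty_support (μ := (ν : Measure X))
    (IsProbabilityMeasure.ne_zero _)
  have hzx : z ∈ closure (MulAction.orbit G x) :=
    Measure.support_subset_of_isClosed isClosed_closure
      ((mem_ae_iff_prob_eq_one isClosed_closure.measurableSet).2 hνx) hz
  obtain ⟨c, hc⟩ := (hP.asymptoticallyInvariant F hF).exists_tendsto_of_mem_support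
    (hP.ne_zero F hF) (hP.ne_top F hF) hE (ν : Measure X) f hz
  refine ⟨c, fun g => Metric.tendsto_nhds.2 fun ε hε => ?_⟩
  obtain ⟨_, hy, k, rfl⟩ := mem_closure_iff_nhds.1 hzx _
    (h.eventually_forall hP f (half_pos hε) z)
  have hclose := hy _ (hP.translate F hF fun _ => g * k⁻¹)
  simp only [hP.avgOp_translate F hF, mul_smul, inv_smul_smul] at hclose
  filter_upwards [hclose, Metric.tendsto_nhds.1 (hc (g * k⁻¹)) _ (half_pos hε)] with n hn hn'
  rw [mul_smul] at hn'
  exact (dist_triangle _ _ _).trans_lt ((add_lt_add hn hn').trans_eq (add_halves ε))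

theorem WeaklyMeanEquicontinuous.continuouslyUniquelyErgodic (hG : IsAmenable G)
    (hP : IsAveragingClass X θ P) (h : WeaklyMeanEquicontinuous X θ P) :
    ContinuouslyUniquelyErgodic G X := by
  obtain ⟨F, hF⟩ := hP.nonempty
  exact AsymptoticallyEquicontinuous.continuouslyUniquelyErgodic_of_forall_tendsto hG
    (hP.ne_zero F hF) (hP.ne_top F hF)
    (fun f ε hε x => (h.eventually_forall hP f hε x).mono fun _ hy => hy F hF)
    (h.exists_tendsto_avgOp hG hP hF)

theorem FolnerWeaklyMeanEquicontinuous.continuouslyUniquelyErgodic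
    (hG : IsAmenable G) (h₀ : ∀ n, θ (F n) ≠ 0) (h_top : ∀ n, θ (F n) ≠ ⊤)
    (hF : AsymptoticallyInvariant X θ F) (h : FolnerWeaklyMeanEquicontinuous X θ F)
    (hX : HasFullySupportedInvariantMeasure G X) : ContinuouslyUniquelyErgodic G X := by
  obtain ⟨ν, hν, hsupp⟩ := hX
  have hE := h.asymptoticallyEquicontinuous h₀ h_top
  exact hE.continuouslyUniquelyErgodic_of_forall_tendsto hG h₀ h_top fun f x =>
    hF.exists_tendsto_of_mem_support h₀ h_top hE (ν : Measure X) f (hsupp ▸ Set.mem_univ x)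

-- If the averages forget the starting point within an orbit closure, then they converge at `x` to
-- the integral against any invariant measure there.
theorem AsymptoticallyEquicontinuous.exists_tendsto_avgOp (hG : IsAmenable G)
    (h₀ : ∀ n, θ (F n) ≠ 0) (h_top : ∀ n, θ (F n) ≠ ⊤) (hE : AsymptoticallyEquicontinuous X θ F)
    {f : C(X, ℝ)} {x : X} (hF : ∀ g : G, Tendsto
      (fun n => avgOp X θ (F n) f (g • x) - avgOp X θ (F n) f x) atTop (𝓝 0)) :
    ∃ c, Tendsto (fun n => avgOp X θ (F n) f x) atTop (𝓝 c) := by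
  obtain ⟨ν, hν, hνx⟩ := hG.exists_invariant_on_orbitClosure x
  refine ⟨∫ y, f y ∂(ν : Measure X), ?_⟩
  have hae : ∀ᵐ y ∂(ν : Measure X), y ∈ closure (MulAction.orbit G x) :=
    (mem_ae_iff_prob_eq_one isClosed_closure.measurableSet).2 hνx
  have hzero : Tendsto
      (fun n => ∫ y, (avgOp X θ (F n) f y - avgOp X θ (F n) f x) ∂(ν : Measure X))
      atTop (𝓝 (∫ _, (0 : ℝ) ∂(ν : Measure X))) :=
    tendsto_integral_of_dominated_convergence (fun _ => ‖f‖ + ‖f‖)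
      (fun n => ((avgOp X θ (F n) f).continuous.sub continuous_const).aestronglyMeasurable)
      (integrable_const _)
      (fun n => ae_of_all _ fun _ =>
        (abs_sub _ _).trans (add_le_add (abs_avgOp_le _ _ _ _) (abs_avgOp_le _ _ _ _)))
      (hae.mono fun _ => hE.tendsto_sub_of_mem_closure_orbit hF)
  have integral_eq (n : ℕ) :
      ∫ y, (avgOp X θ (F n) f y - avgOp X θ (F n) f x) ∂(ν : Measure X) =
        ∫ y, f y ∂(ν : Measure X) - avgOp X θ (F n) f x := by
    rw [integral_sub (integrable_continuousMap _ _) (integrable_const _),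
      integral_avgOp (h₀ n) (h_top n)]
    simp
  simp only [integral_eq, integral_zero] at hzero
  simpa using (tendsto_const_nhds (x := ∫ y, f y ∂(ν : Measure X))).sub hzero

theorem AsymptoticallyEquicontinuous.continuouslyUniquelyErgodic (hG : IsAmenable G)
    (h₀ : ∀ n, θ (F n) ≠ 0) (h_top : ∀ n, θ (F n) ≠ ⊤) (hE : AsymptoticallyEquicontinuous X θ F)
    (hF : ∀ (f : C(X, ℝ)) (g : G) x, Tendsto
      (fun n => avgOp X θ (F n) f (g • x) - avgOp X θ (F n) f x) atTop (𝓝 0)) :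
    ContinuouslyUniquelyErgodic G X := by
  refine hE.continuouslyUniquelyErgodic_of_forall_tendsto hG h₀ h_top fun f x => ?_
  obtain ⟨c, hc⟩ := hE.exists_tendsto_avgOp hG h₀ h_top (hF f · x)
  exact ⟨c, fun g => by simpa using (hF f g x).add hc⟩

-- The limit `S f` is invariant: alternating between the sequences `F_n` and `F_n g` gives averages
-- at `x` that still converge, although they alternate between those at `x` and those at `g x`.
theorem AveragesConverge.continuouslyUniquelyErgodic (hG : IsAmenable G)
    (hP : IsAveragingClass X θ P) (h : AveragesConverge X θ P) :
    ContinuouslyUniquelyErgodic G X := by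
  obtain ⟨F, hF⟩ := hP.nonempty
  obtain ⟨S, hS⟩ := h F hF
  have hlim (f : C(X, ℝ)) (x : X) : Tendsto (fun n => avgOp X θ (F n) f x) atTop (𝓝 (S f x)) :=
    ((continuous_eval_const x).tendsto _).comp (hS f)
  refine continuouslyUniquelyErgodic_of_tendsto hG (hP.ne_zero F hF) (hP.ne_top F hF)
    fun f => ⟨S f, fun g x => ?_, hlim f⟩
  obtain ⟨T, hT⟩ := h _ (hP.translate F hF fun n => if Even n then 1 else g)
  have halt := ((continuous_eval_const x).tendsto _).comp (hT f)
  simp only [Function.comp_def, hP.avgOp_translate F hF] at halt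
  have heven : Tendsto (fun n : ℕ => 2 * n) atTop atTop :=
    tendsto_atTop_mono (fun n => Nat.le_mul_of_pos_left n two_pos) tendsto_id
  have hodd : Tendsto (fun n : ℕ => 2 * n + 1) atTop atTop :=
    (tendsto_add_atTop_nat 1).comp heven
  have hTx : T f x = S f x := tendsto_nhds_unique (halt.comp heven) (by
    simpa [Function.comp_def] using (hlim f x).comp heven)
  have hTgx : T f x = S f (g • x) := tendsto_nhds_unique (halt.comp hodd) (by
    simpa [Function.comp_def] using (hlim f (g • x)).comp hodd)
  rw [← hTx, ← hTgx]

theorem ContinuouslyUniquelyErgodic.averagesConverge (hP : IsAveragingClass X θ P)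
    (h : ContinuouslyUniquelyErgodic G X) : AveragesConverge X θ P := by
  obtain ⟨μ, hμ, hu⟩ := h
  exact fun F hF => ⟨kernelOp μ hμ, (hP.asymptoticallyInvariant F hF).tendsto_avgOp hμ
    (fun x => (hu x).1) (hP.ne_zero F hF) (hP.ne_top F hF)⟩

end AveragingClass

section Kantorovich

-- The witness is the infimal convolution of `ψ` with `t d`.
theorem exists_lipschitzWith_between {X : Type*} [PseudoMetricSpace X] {φ ψ : X → ℝ} (t : NNReal)
    (h : ∀ x y, 0 ≤ φ x + ψ y + t * dist x y) :
    ∃ u : X → ℝ, LipschitzWith t u ∧ ∀ x, -φ x ≤ u x ∧ u x ≤ ψ x := by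
  rcases isEmpty_or_nonempty X with hX | hX
  · exact ⟨0, LipschitzWith.of_dist_le_mul fun x => hX.elim x, fun x => hX.elim x⟩
  have hle (x y : X) : -φ x ≤ ψ y + t * dist x y := by linarith [h x y]
  have hbdd (x : X) : BddBelow (Set.range fun y => ψ y + t * dist x y) :=
    ⟨-φ x, Set.forall_mem_range.2 (hle x)⟩
  refine ⟨fun x => ⨅ y, (ψ y + t * dist x y), LipschitzWith.of_le_add_mul t fun x x' => ?_,
    fun x => ⟨le_ciInf (hle x), (ciInf_le (hbdd x) x).trans_eq (by simp)⟩⟩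
  rw [← sub_le_iff_le_add]
  refine le_ciInf fun y => sub_le_iff_le_add.2 ((ciInf_le (hbdd x) y).trans ?_)
  calc ψ y + t * dist x y ≤ ψ y + t * (dist x x' + dist x' y) := by
        gcongr
        exact dist_triangle x x' y
    _ = ψ y + t * dist x' y + t * dist x x' := by ring

theorem linearMap_eq_of_forall_le {V : Type*} [AddCommGroup V] [Module ℝ V] {L m : V →ₗ[ℝ] ℝ}
    (h : ∀ v, L v ≤ m v) : L = m := by
  ext v
  have hneg := h (-v)
  rw [map_neg, map_neg, neg_le_neg_iff] at hneg
  exact (h v).antisymm hneg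

theorem integral_sub_le_mul_of_lipschitzWith {X : Type*} [PseudoMetricSpace X]
    [MeasurableSpace X] {μ ν : Measure X} [IsProbabilityMeasure μ]
    [IsProbabilityMeasure ν] {κ : ℝ}
    (hκ : ∀ u : C(X, ℝ), LipschitzWith 1 u → ∫ x, u x ∂μ - ∫ x, u x ∂ν ≤ κ)
    {t : NNReal} {u : C(X, ℝ)} (hu : LipschitzWith t u) :
    ∫ x, u x ∂μ - ∫ x, u x ∂ν ≤ t * κ := by
  obtain ⟨x₀⟩ := nonempty_of_isProbabilityMeasure μ
  rcases eq_or_ne t 0 with rfl | ht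
  · have hconst (x : X) : u x = u x₀ := dist_le_zero.1 (by simpa using hu.dist_le_mul x x₀)
    simp [hconst]
  · have hlip : LipschitzWith 1 ((t⁻¹ : ℝ) • u) := by
      refine LipschitzWith.of_dist_le_mul fun x y => ?_
      have ht' : (0 : ℝ) < t := NNReal.coe_pos.2 (pos_iff_ne_zero.2 ht)
      rw [ContinuousMap.smul_apply, ContinuousMap.smul_apply, dist_smul₀, Real.norm_eq_abs,
        abs_of_pos (inv_pos.2 ht'), inv_mul_le_iff₀ ht', NNReal.coe_one, one_mul]
      exact hu.dist_le_mul x y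
    have := hκ _ hlip
    simp only [ContinuousMap.smul_apply, smul_eq_mul, integral_const_mul, ← mul_sub] at this
    rwa [inv_mul_le_iff₀ (NNReal.coe_pos.2 (pos_iff_ne_zero.2 ht))] at this

variable {X : Type*} [MetricSpace X] [CompactSpace X] [MeasurableSpace X]

theorem integral_add_nonneg_of_forall_lipschitzWith [BorelSpace X] {μ ν : Measure X}
    [IsProbabilityMeasure μ] [IsProbabilityMeasure ν] {κ : ℝ}
    (hκ : ∀ u : C(X, ℝ), LipschitzWith 1 u → ∫ x, u x ∂μ - ∫ x, u x ∂ν ≤ κ)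
    {φ ψ : C(X, ℝ)} {t : NNReal} (h : ∀ x y, 0 ≤ φ x + ψ y + t * dist x y) :
    0 ≤ ∫ x, φ x ∂μ + ∫ x, ψ x ∂ν + t * κ := by
  obtain ⟨u, hu, hφψ⟩ := exists_lipschitzWith_between t h
  have hint := integral_sub_le_mul_of_lipschitzWith hκ (u := ⟨u, hu.continuous⟩) hu
  have hφ : -∫ x, φ x ∂μ ≤ ∫ x, u x ∂μ := by
    rw [← integral_neg]
    exact integral_mono (integrable_continuousMap μ φ).neg
      (integrable_continuousMap μ ⟨u, hu.continuous⟩) fun x => (hφψ x).1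
  have hψ : ∫ x, u x ∂ν ≤ ∫ x, ψ x ∂ν :=
    integral_mono (integrable_continuousMap ν ⟨u, hu.continuous⟩) (integrable_continuousMap ν ψ)
      fun x => (hφψ x).2
  simp only [ContinuousMap.coe_mk] at hint
  linarith

/-- The values of the dual Kantorovich problem for the cost `h`, where a multiple `t d` of the
distance may be bought at the price `t κ`. -/
def dualValues (μ ν : Measure X) (κ : ℝ) (h : C(X × X, ℝ)) : Set ℝ :=
  {r | ∃ (φ ψ : C(X, ℝ)) (t : NNReal), (∀ x y, h (x, y) ≤ φ x + ψ y + t * dist x y) ∧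
    r = ∫ x, φ x ∂μ + ∫ x, ψ x ∂ν + t * κ}

/-- The optimal value of the dual Kantorovich problem with price `κ` for the distance, as a
functional of the cost `h`; it is sublinear if `κ` bounds all `∫ u dμ - ∫ u dν` with `u` in
`Lip₁`. -/
def dualValue (μ ν : Measure X) (κ : ℝ) (h : C(X × X, ℝ)) : ℝ :=
  sInf (dualValues μ ν κ h)

theorem dualValues_nonempty (μ ν : Measure X) (κ : ℝ) (h : C(X × X, ℝ)) :
    (dualValues μ ν κ h).Nonempty :=
  ⟨_, ContinuousMap.const X ‖h‖, 0, 0, fun x y => by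
    simpa using (abs_le.1 (h.norm_coe_le_norm (x, y))).2, rfl⟩

variable [BorelSpace X] {μ ν : Measure X} [IsProbabilityMeasure μ] [IsProbabilityMeasure ν] {κ : ℝ}

theorem bddBelow_dualValues
    (hκ : ∀ u : C(X, ℝ), LipschitzWith 1 u → ∫ x, u x ∂μ - ∫ x, u x ∂ν ≤ κ) (h : C(X × X, ℝ)) :
    BddBelow (dualValues μ ν κ h) := by
  refine ⟨-‖h‖, ?_⟩
  rintro r ⟨φ, ψ, t, hle, rfl⟩
  have hnonneg := integral_add_nonneg_of_forall_lipschitzWith hκ (φ := φ)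
    (ψ := ψ + ContinuousMap.const X ‖h‖) (t := t) fun x y => by
      have := (abs_le.1 (h.norm_coe_le_norm (x, y))).1
      simp only [ContinuousMap.add_apply, ContinuousMap.const_apply]
      linarith [hle x y]
  simp only [ContinuousMap.add_apply, ContinuousMap.const_apply] at hnonneg
  rw [integral_add (integrable_continuousMap ν ψ) (integrable_const _)] at hnonneg
  simp only [integral_const, probReal_univ, smul_eq_mul, one_mul] at hnonneg
  linarith

theorem dualValue_le (hκ : ∀ u : C(X, ℝ), LipschitzWith 1 u → ∫ x, u x ∂μ - ∫ x, u x ∂ν ≤ κ)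
    {h : C(X × X, ℝ)} {φ ψ : C(X, ℝ)} {t : NNReal}
    (hle : ∀ x y, h (x, y) ≤ φ x + ψ y + t * dist x y) :
    dualValue μ ν κ h ≤ ∫ x, φ x ∂μ + ∫ x, ψ x ∂ν + t * κ :=
  csInf_le (bddBelow_dualValues hκ h) ⟨φ, ψ, t, hle, rfl⟩

theorem dualValue_zero_nonneg
    (hκ : ∀ u : C(X, ℝ), LipschitzWith 1 u → ∫ x, u x ∂μ - ∫ x, u x ∂ν ≤ κ) :
    0 ≤ dualValue μ ν κ 0 := by
  refine le_csInf (dualValues_nonempty μ ν κ 0) ?_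
  rintro r ⟨φ, ψ, t, hle, rfl⟩
  exact integral_add_nonneg_of_forall_lipschitzWith hκ hle

theorem dualValue_smul_le
    (hκ : ∀ u : C(X, ℝ), LipschitzWith 1 u → ∫ x, u x ∂μ - ∫ x, u x ∂ν ≤ κ)
    {c : ℝ} (hc : 0 < c) (h : C(X × X, ℝ)) :
    dualValue μ ν κ (c • h) ≤ c * dualValue μ ν κ h := by
  rw [← div_le_iff₀' hc]
  refine le_csInf (dualValues_nonempty μ ν κ h) ?_
  rintro r ⟨φ, ψ, t, hle, rfl⟩
  rw [div_le_iff₀' hc]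
  lift c to NNReal using hc.le
  refine (dualValue_le hκ (φ := (c : ℝ) • φ) (ψ := (c : ℝ) • ψ) (t := c * t)
    fun x y => ?_).trans_eq ?_
  · have := mul_le_mul_of_nonneg_left (hle x y) hc.le
    simp only [ContinuousMap.smul_apply, smul_eq_mul, NNReal.coe_mul]
    linarith
  · simp only [ContinuousMap.smul_apply, smul_eq_mul, integral_const_mul, NNReal.coe_mul]
    ring

theorem dualValue_smul
    (hκ : ∀ u : C(X, ℝ), LipschitzWith 1 u → ∫ x, u x ∂μ - ∫ x, u x ∂ν ≤ κ)
    {c : ℝ} (hc : 0 < c) (h : C(X × X, ℝ)) :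
    dualValue μ ν κ (c • h) = c * dualValue μ ν κ h := by
  refine (dualValue_smul_le hκ hc h).antisymm ?_
  have hinv := dualValue_smul_le hκ (inv_pos.2 hc) (c • h)
  rwa [inv_smul_smul₀ hc.ne', ← div_eq_inv_mul, le_div_iff₀' hc] at hinv

theorem dualValue_add_le
    (hκ : ∀ u : C(X, ℝ), LipschitzWith 1 u → ∫ x, u x ∂μ - ∫ x, u x ∂ν ≤ κ)
    (h k : C(X × X, ℝ)) :
    dualValue μ ν κ (h + k) ≤ dualValue μ ν κ h + dualValue μ ν κ k := by
  rw [← sub_le_iff_le_add]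
  refine le_csInf (dualValues_nonempty μ ν κ h) ?_
  rintro r ⟨φ, ψ, t, hle, rfl⟩
  rw [sub_le_comm]
  refine le_csInf (dualValues_nonempty μ ν κ k) ?_
  rintro r ⟨φ', ψ', t', hle', rfl⟩
  rw [sub_le_iff_le_add]
  refine (dualValue_le hκ (φ := φ + φ') (ψ := ψ + ψ') (t := t + t') fun x y => ?_).trans_eq ?_
  · simp only [ContinuousMap.add_apply, NNReal.coe_add]
    linarith [hle x y, hle' x y]
  · simp only [ContinuousMap.add_apply, NNReal.coe_add]
    rw [integral_add (integrable_continuousMap μ φ) (integrable_continuousMap μ φ'),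
      integral_add (integrable_continuousMap ν ψ) (integrable_continuousMap ν ψ')]
    ring

theorem exists_linearMap_forall_le_dualValue
    (hκ : ∀ u : C(X, ℝ), LipschitzWith 1 u → ∫ x, u x ∂μ - ∫ x, u x ∂ν ≤ κ) :
    ∃ L : C(X × X, ℝ) →ₗ[ℝ] ℝ, ∀ h, L h ≤ dualValue μ ν κ h := by
  obtain ⟨L, -, hL⟩ := exists_extension_of_le_sublinear (⊥ : C(X × X, ℝ) →ₗ.[ℝ] ℝ)
    (dualValue μ ν κ) (fun _ hc => dualValue_smul hκ hc) (dualValue_add_le hκ) (by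
      rintro ⟨_, rfl⟩
      exact dualValue_zero_nonneg hκ)
  exact ⟨L, hL⟩

theorem mem_joinings_of_forall_integral {X : Type*} [MetricSpace X]
    [MeasurableSpace X] [BorelSpace X] {μ ν : Measure X} [IsFiniteMeasure μ] [IsFiniteMeasure ν]
    (ι : ProbabilityMeasure (X × X))
    (hfst : ∀ f : C(X, ℝ), ∫ p, f p.1 ∂(ι : Measure (X × X)) = ∫ x, f x ∂μ)
    (hsnd : ∀ f : C(X, ℝ), ∫ p, f p.2 ∂(ι : Measure (X × X)) = ∫ x, f x ∂ν) :
    (ι : Measure (X × X)) ∈ joinings μ ν := by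
  refine ⟨inferInstance, ext_of_forall_integral_eq_of_IsFiniteMeasure fun f => ?_,
    ext_of_forall_integral_eq_of_IsFiniteMeasure fun f => ?_⟩
  · rw [integral_map measurable_fst.aemeasurable f.continuous.aestronglyMeasurable]
    exact hfst f.toContinuousMap
  · rw [integral_map measurable_snd.aemeasurable f.continuous.aestronglyMeasurable]
    exact hsnd f.toContinuousMap

-- By Hahn–Banach some linear functional lies below the sublinear functional `dualValue`; it is
-- integration against a joining of `μ` and `ν` whose cost is at most `κ`.
theorem wasserstein_le_of_forall_lipschitzWith
    (hκ : ∀ u : C(X, ℝ), LipschitzWith 1 u → ∫ x, u x ∂μ - ∫ x, u x ∂ν ≤ κ) :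
    wasserstein μ ν ≤ κ := by
  obtain ⟨L, hL⟩ := exists_linearMap_forall_le_dualValue hκ
  have hL_nonneg (h : C(X × X, ℝ)) (hh : 0 ≤ h) : 0 ≤ L h := by
    have hneg := (hL (-h)).trans (dualValue_le hκ (φ := 0) (ψ := 0) (t := 0) fun x y => by
      simpa using hh (x, y))
    simpa using hneg
  have hfst : L ∘ₗ (ContinuousMap.compRightAlgHom ℝ ℝ .fst).toLinearMap = integralCLM μ :=
    linearMap_eq_of_forall_le fun φ => (hL _).trans <|
      (dualValue_le hκ (φ := φ) (ψ := 0) (t := 0) fun x y => by simp).trans_eq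
        (by simp [integralCLM])
  have hsnd : L ∘ₗ (ContinuousMap.compRightAlgHom ℝ ℝ .snd).toLinearMap = integralCLM ν :=
    linearMap_eq_of_forall_le fun ψ => (hL _).trans <|
      (dualValue_le hκ (φ := 0) (ψ := ψ) (t := 0) fun x y => by simp).trans_eq
        (by simp [integralCLM])
  have hL_one : L 1 = 1 := (LinearMap.congr_fun hfst 1).trans (by simp [integralCLM])
  obtain ⟨ι, hι⟩ := exists_probabilityMeasure_of_functional L hL_nonneg hL_one
  have hmem : (ι : Measure (X × X)) ∈ joinings μ ν :=
    mem_joinings_of_forall_integral ι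
      (fun f => (hι (f.comp .fst)).trans (LinearMap.congr_fun hfst f))
      (fun f => (hι (f.comp .snd)).trans (LinearMap.congr_fun hsnd f))
  calc wasserstein μ ν ≤ ∫ p, dist p.1 p.2 ∂(ι : Measure (X × X)) := wasserstein_le hmem
    _ = L ⟨fun p => dist p.1 p.2, continuous_dist⟩ := hι ⟨_, continuous_dist⟩
    _ ≤ κ := (hL _).trans <|
      (dualValue_le hκ (φ := 0) (ψ := 0) (t := 1) fun x y => by simp).trans_eq (by simp)

theorem integral_sub_le_wasserstein {f : C(X, ℝ)} (hf : LipschitzWith 1 f) :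
    ∫ x, f x ∂μ - ∫ x, f x ∂ν ≤ wasserstein μ ν := by
  refine le_csInf ⟨_, _, prod_mem_joinings μ ν, rfl⟩ ?_
  rintro _ ⟨ι, hι, rfl⟩
  have := hι.1
  rw [integral_sub_integral_of_mem_joinings hι]
  refine integral_mono (integrable_continuousMap ι (f.comp .fst - f.comp .snd))
    (integrable_dist ι) fun p => (le_abs_self _).trans ?_
  simpa [Real.dist_eq] using hf.dist_le_mul p.1 p.2

end Kantorovich

section ContinuityWasserstein

/-- The `1`-Lipschitz functions vanishing at `x₀`. The normalization makes them a compact set,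
without changing the differences `∫ f dμ - ∫ f dν`. -/
def lipschitzFunctions {X : Type*} [PseudoMetricSpace X] (x₀ : X) : Set (X →ᵇ ℝ) :=
  {f | LipschitzWith 1 f ∧ f x₀ = 0}

theorem isClosed_lipschitzFunctions {X : Type*} [PseudoMetricSpace X] (x₀ : X) :
    IsClosed (lipschitzFunctions x₀) := by
  simp only [lipschitzFunctions, lipschitzWith_iff_dist_le_mul, Set.ofPred_and, Set.ofPred_forall]
  exact (isClosed_iInter fun x => isClosed_iInter fun y =>
      isClosed_le ((continuous_eval_const x).dist (continuous_eval_const y)) continuous_const).inter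
    (isClosed_eq (continuous_eval_const x₀) continuous_const)

theorem isCompact_lipschitzFunctions {X : Type*} [PseudoMetricSpace X] [CompactSpace X] (x₀ : X) :
    IsCompact (lipschitzFunctions x₀) := by
  refine BoundedContinuousFunction.arzela_ascoli₂
    (Set.Icc (-Metric.diam (Set.univ : Set X)) (Metric.diam (Set.univ : Set X))) isCompact_Icc
    _ (isClosed_lipschitzFunctions x₀) (fun f x hf => abs_le.1 ?_) ?_
  · calc |f x| = dist (f x) (f x₀) := by rw [hf.2, dist_zero_right, Real.norm_eq_abs]
      _ ≤ dist x x₀ := by simpa using hf.1.dist_le_mul x x₀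
      _ ≤ Metric.diam (Set.univ : Set X) :=
        Metric.dist_le_diam_of_mem isCompact_univ.isBounded (Set.mem_univ x) (Set.mem_univ x₀)
  · exact Metric.equicontinuous_of_continuity_modulus (fun r => r) tendsto_id _ fun x y f => by
      simpa using f.2.1.dist_le_mul x y

variable {X : Type*} [MetricSpace X] [CompactSpace X] [MeasurableSpace X] [BorelSpace X]

theorem wasserstein_eq_sSup (x₀ : X) (μ ν : Measure X) [IsProbabilityMeasure μ]
    [IsProbabilityMeasure ν] :
    wasserstein μ ν =
      sSup ((fun f : X →ᵇ ℝ => ∫ x, f x ∂μ - ∫ x, f x ∂ν) '' lipschitzFunctions x₀) := by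
  have hle : ∀ r ∈ (fun f : X →ᵇ ℝ => ∫ x, f x ∂μ - ∫ x, f x ∂ν) '' lipschitzFunctions x₀,
      r ≤ wasserstein μ ν := by
    rintro _ ⟨f, hf, rfl⟩
    exact integral_sub_le_wasserstein (f := f.toContinuousMap) hf.1
  refine le_antisymm (wasserstein_le_of_forall_lipschitzWith fun u hu => ?_)
    (csSup_le (Set.Nonempty.image _ ⟨0, LipschitzWith.const' 0, rfl⟩) hle)
  refine le_csSup ⟨_, hle⟩
    ⟨.mkOfCompact (u - ContinuousMap.const X (u x₀)), ⟨?_, by simp⟩, ?_⟩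
  · exact LipschitzWith.of_dist_le_mul fun x y => by simpa [Real.dist_eq] using hu.dist_le_mul x y
  · simp only [BoundedContinuousFunction.mkOfCompact_apply, ContinuousMap.sub_apply,
      ContinuousMap.const_apply]
    rw [integral_sub (integrable_continuousMap _ u) (integrable_const _),
      integral_sub (integrable_continuousMap _ u) (integrable_const _)]
    simp

theorem continuous_integral_probabilityMeasure {X : Type*} [TopologicalSpace X]
    [MeasurableSpace X] [OpensMeasurableSpace X] :
    Continuous fun p : ProbabilityMeasure X × (X →ᵇ ℝ) => ∫ x, p.2 x ∂(p.1 : Measure X) := by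
  refine continuous_iff_continuousAt.2 fun ⟨μ, f⟩ => ?_
  have hfixed : Tendsto (fun p : ProbabilityMeasure X × (X →ᵇ ℝ) => ∫ x, f x ∂(p.1 : Measure X))
      (𝓝 (μ, f)) (𝓝 (∫ x, f x ∂(μ : Measure X))) :=
    (ProbabilityMeasure.tendsto_iff_forall_integral_tendsto.1 tendsto_id f).comp
      (continuous_fst.tendsto (μ, f))
  have hnorm : Tendsto (fun p : ProbabilityMeasure X × (X →ᵇ ℝ) => ‖p.2 - f‖) (𝓝 (μ, f)) (𝓝 0) :=
    (Continuous.tendsto' (by fun_prop) _ _ (by simp))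
  have hdiff : Tendsto (fun p : ProbabilityMeasure X × (X →ᵇ ℝ) =>
      ∫ x, p.2 x ∂(p.1 : Measure X) - ∫ x, f x ∂(p.1 : Measure X)) (𝓝 (μ, f)) (𝓝 0) := by
    refine squeeze_zero_norm (fun p => ?_) hnorm
    rw [← integral_sub (p.2.integrable _) (f.integrable _)]
    simpa using norm_integral_le_of_norm_le_const (μ := (p.1 : Measure X))
      (ae_of_all _ fun x => (p.2 - f).norm_coe_le_norm x)
  simpa [ContinuousAt] using hdiff.add hfixed

theorem continuous_wasserstein :
    Continuous fun p : ProbabilityMeasure X × ProbabilityMeasure X =>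
      wasserstein (p.1 : Measure X) (p.2 : Measure X) := by
  rcases isEmpty_or_nonempty X with hX | ⟨⟨x₀⟩⟩
  · have (μ : ProbabilityMeasure X) : False :=
      hX.false (nonempty_of_isProbabilityMeasure (μ : Measure X)).some
    exact continuous_iff_continuousAt.2 fun p => (this p.1).elim
  simp only [wasserstein_eq_sSup x₀]
  refine (isCompact_lipschitzFunctions x₀).continuous_sSup (.sub ?_ ?_)
  · exact continuous_integral_probabilityMeasure.comp
      ((continuous_fst.comp continuous_fst).prodMk continuous_snd)
  · exact continuous_integral_probabilityMeasure.comp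
      ((continuous_snd.comp continuous_fst).prodMk continuous_snd)

end ContinuityWasserstein

section Equivalence

variable {G : Type*} [Group G] [TopologicalSpace G] [MeasurableSpace G] [BorelSpace G]
variable {X : Type*} [MetricSpace X] [CompactSpace X] [MulAction G X] [ContinuousSMul G X]
variable [MeasurableSpace X] [BorelSpace X] {θ : Measure G} {P : (ℕ → Set G) → Prop}

theorem folnerW_eq_of_tendsto_integral {μ : X → ProbabilityMeasure X} {F : ℕ → Set G}
    (h₀ : ∀ n, θ (F n) ≠ 0) (h_top : ∀ n, θ (F n) ≠ ⊤)
    (h : ∀ (f : C(X, ℝ)) x,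
      Tendsto (fun n => avgOp X θ (F n) f x) atTop (𝓝 (∫ y, f y ∂(μ x : Measure X)))) (x y : X) :
    folnerW θ F x y = wasserstein (μ x : Measure X) (μ y : Measure X) := by
  let m (x : X) (n : ℕ) : ProbabilityMeasure X :=
    ⟨orbitMeasure θ (F n) x, isProbabilityMeasure_orbitMeasure (h₀ n) (h_top n) x⟩
  have hm (x : X) : Tendsto (m x) atTop (𝓝 (μ x)) :=
    ProbabilityMeasure.tendsto_iff_forall_integral_tendsto.2 fun f =>
      (h f.toContinuousMap x).congr fun n =>
        (integral_orbitMeasure θ (F n) x f.toContinuousMap).symm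
  exact ((continuous_wasserstein.tendsto (μ x, μ y)).comp
    ((hm x).prodMk_nhds (hm y))).limsup_eq

theorem ContinuouslyUniquelyErgodic.weaklyMeanEquicontinuous (hP : IsAveragingClass X θ P)
    (h : ContinuouslyUniquelyErgodic G X) : WeaklyMeanEquicontinuous X θ P := by
  obtain ⟨μ, hμ, hu⟩ := h
  have folnerW_eq (F : {F : ℕ → Set G // P F}) (x y : X) :
      folnerW θ F.1 x y = wasserstein (μ x : Measure X) (μ y : Measure X) :=
    folnerW_eq_of_tendsto_integral (hP.ne_zero _ F.2) (hP.ne_top _ F.2)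
      (fun f x => (hP.asymptoticallyInvariant _ F.2).tendsto_avgOp_apply (fun x => (hu x).1)
        (hP.ne_zero _ F.2) (hP.ne_top _ F.2) f x) x y
  have : Nonempty {F : ℕ → Set G // P F} := nonempty_subtype.2 hP.nonempty
  simp only [WeaklyMeanEquicontinuous, supW, folnerW_eq, ciSup_const]
  exact continuous_wasserstein.comp ((hμ.comp continuous_fst).prodMk (hμ.comp continuous_snd))

theorem ContinuouslyUniquelyErgodic.weaklyMeanEquicontinuous_and_averagesConverge
    (hP : IsAveragingClass X θ P) (h : ContinuouslyUniquelyErgodic G X) :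
    WeaklyMeanEquicontinuous X θ P ∧ ContinuouslyUniquelyErgodic G X ∧ AveragesConverge X θ P :=
  ⟨h.weaklyMeanEquicontinuous hP, h, h.averagesConverge hP⟩

theorem IsAveragingClass.tfae (hG : IsAmenable G) (hP : IsAveragingClass X θ P) :
    List.TFAE [WeaklyMeanEquicontinuous X θ P, ContinuouslyUniquelyErgodic G X,
      AveragesConverge X θ P] := by
  tfae_have 1 → 2 := fun h => h.continuouslyUniquelyErgodic hG hP
  tfae_have 2 → 3 := fun h => h.averagesConverge hP
  tfae_have 3 → 2 := fun h => h.continuouslyUniquelyErgodic hG hP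
  tfae_have 2 → 1 := fun h => h.weaklyMeanEquicontinuous hP
  tfae_finish

end Equivalence

section AlmostInvariance

variable {G : Type*} [Group G] [TopologicalSpace G] [ContinuousMul G]

/-- The element of `rucb G` given by a bounded right uniformly continuous function. -/
def rucbOf (F : G → ℝ) (C : ℝ) (hC : ∀ x, |F x| ≤ C)
    (hF : ∀ ε > 0, ∀ᶠ u in 𝓝 (1 : G), ∀ x, |F (u * x) - F x| < ε) : rucb G :=
  ⟨BoundedContinuousFunction.ofNormedAddCommGroup F (by
    refine continuous_iff_continuousAt.2 fun x => Metric.tendsto_nhds.2 fun ε hε => ?_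
    have hdiv : Tendsto (fun y : G => y * x⁻¹) (𝓝 x) (𝓝 1) :=
      ((continuous_mul_const x⁻¹).tendsto' x 1 (mul_inv_cancel x))
    filter_upwards [hdiv.eventually (hF ε hε)] with y hy
    simpa [Real.dist_eq] using hy x) C hC, hF⟩

/-- Left translation on `rucb G`. -/
def leftTranslate (g : G) (f : rucb G) : rucb G :=
  rucbOf (fun x => f.1 (g * x)) ‖f.1‖ (fun x => f.1.norm_coe_le_norm _) fun ε hε => by
    have hconj : Tendsto (fun u : G => g * u * g⁻¹) (𝓝 1) (𝓝 1) :=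
      ((continuous_mul_const g⁻¹).comp (continuous_const_mul g)).tendsto' 1 1 (by simp)
    filter_upwards [hconj.eventually (f.2 ε hε)] with u hu x
    simpa [mul_assoc] using hu (g * x)

theorem IsAmenable.exists_sum_translate_sub_lt (hG : IsAmenable G) {κ : Type*}
    (s : Finset κ) (g : κ → G) (F : κ → rucb G) {u : ℝ} (hu : 0 < u) :
    ∃ x, ∑ k ∈ s, ((F k).1 (g k * x) - (F k).1 x) < u := by
  by_contra! hle
  obtain ⟨m, hpos, hone, hinv⟩ := hG
  let one : rucb G := rucbOf (fun _ => 1) 1 (by simp) (fun ε hε => by simp [hε])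
  have hmean := hpos (∑ k ∈ s, (leftTranslate (g k) (F k) - F k) - u • one) fun x => by
    have heq : (∑ k ∈ s, (leftTranslate (g k) (F k) - F k) - u • one).1 x =
        ∑ k ∈ s, ((F k).1 (g k * x) - (F k).1 x) - u * 1 := by
      simp only [Submodule.coe_sub, Submodule.coe_sum, Submodule.coe_smul,
        BoundedContinuousFunction.coe_sub, Pi.sub_apply, BoundedContinuousFunction.sum_apply,
        BoundedContinuousFunction.coe_smul]
      rfl
    linarith [hle x]
  have htranslate (k : κ) : m (leftTranslate (g k) (F k)) = m (F k) :=
    hinv (g k) (F k) _ fun x => rfl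
  simp only [map_sub m, map_sum, map_smul, hone one fun _ => rfl, htranslate, sub_self,
    Finset.sum_const_zero, smul_eq_mul, mul_one] at hmean
  linarith

-- Day's argument: a functional separating `0` from the convex hull would, composed with `b`, give
-- functions whose differences to their translates have positive mean.
theorem IsAmenable.zero_mem_closure_convexHull (hG : IsAmenable G) {V : Type*}
    [NormedAddCommGroup V] [NormedSpace ℝ V] {b : G → V} {C : ℝ} (hC : ∀ x, ‖b x‖ ≤ C)
    (hb : ∀ ε > 0, ∀ᶠ u in 𝓝 (1 : G), ∀ x, ‖b (u * x) - b x‖ < ε) (E : Finset G) :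
    (0 : E → V) ∈
      closure (convexHull ℝ (Set.range fun (x : G) (g : E) => b (g * x) - b x)) := by
  classical
  by_contra h
  obtain ⟨ℓ, u, hu, hℓ⟩ := geometric_hahn_banach_point_closed
    (convex_convexHull ℝ _).closure isClosed_closure h
  rw [map_zero] at hu
  have hsingle (g : E) (v : V) : |ℓ (Pi.single g v)| ≤ ‖ℓ‖ * ‖v‖ :=
    (ℓ.le_opNorm _).trans_eq (by rw [Pi.norm_single])
  let F (g : E) : rucb G := rucbOf (fun x => ℓ (Pi.single g (b x))) (‖ℓ‖ * C)
    (fun x => (hsingle g _).trans (by gcongr; exact hC x)) fun ε hε => by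
      filter_upwards [hb (ε / (‖ℓ‖ + 1)) (by positivity)] with v hv x
      rw [← map_sub, ← Pi.single_sub]
      calc |ℓ (Pi.single g (b (v * x) - b x))| ≤ ‖ℓ‖ * ‖b (v * x) - b x‖ := hsingle g _
        _ ≤ ‖ℓ‖ * (ε / (‖ℓ‖ + 1)) := by gcongr; exact (hv x).le
        _ < (‖ℓ‖ + 1) * (ε / (‖ℓ‖ + 1)) := by gcongr; linarith
        _ = ε := by field_simp
  obtain ⟨x, hx⟩ := hG.exists_sum_translate_sub_lt Finset.univ (fun g : E => (g : G)) F hu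
  have hsum : ∑ g : E, ((F g).1 (g * x) - (F g).1 x) = ℓ fun g : E => b (g * x) - b x := by
    conv_rhs => rw [← Finset.univ_sum_single fun g : E => b (g * x) - b x, map_sum]
    exact Finset.sum_congr rfl fun g _ => by rw [Pi.single_sub, map_sub]; rfl
  exact (hℓ _ (subset_closure (subset_convexHull ℝ _ ⟨x, rfl⟩))).not_gt (hsum ▸ hx)

theorem IsAmenable.exists_almost_invariant (hG : IsAmenable G) {I : Type*}
    (f : I → G → ℝ) {C : ℝ} (hC : ∀ i x, |f i x| ≤ C)
    (hf : ∀ ε > 0, ∀ᶠ u in 𝓝 (1 : G), ∀ i x, |f i (u * x) - f i x| < ε)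
    (E : Finset G) {ε : ℝ} (hε : 0 < ε) :
    ∃ (t : Finset G) (w : G → ℝ), (∀ x ∈ t, 0 ≤ w x) ∧ ∑ x ∈ t, w x = 1 ∧
      ∀ g ∈ E, ∀ i, |∑ x ∈ t, w x * (f i (g * x) - f i x)| ≤ ε := by
  rcases isEmpty_or_nonempty I with hI | ⟨⟨i₀⟩⟩
  · exact ⟨{1}, 1, by simp, by simp, fun g _ i => hI.elim i⟩
  let tI : TopologicalSpace I := ⊥
  have : DiscreteTopology I := ⟨rfl⟩
  let b (x : G) : I →ᵇ ℝ := .ofNormedAddCommGroup (fun i => f i x)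
    continuous_of_discreteTopology C fun i => hC i x
  have hb : ∀ ε > 0, ∀ᶠ u in 𝓝 (1 : G), ∀ x, ‖b (u * x) - b x‖ < ε := fun ε hε => by
    filter_upwards [hf (ε / 2) (half_pos hε)] with u hu x
    exact ((BoundedContinuousFunction.norm_le (half_pos hε).le).2 fun i => (hu i x).le).trans_lt
      (half_lt_self hε)
  obtain ⟨v, hv, hvε⟩ := Metric.mem_closure_iff.1 (hG.zero_mem_closure_convexHull
    (fun x => BoundedContinuousFunction.norm_ofNormedAddCommGroup_le _
      ((abs_nonneg _).trans (hC i₀ 1)) _) hb E) ε hε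
  rw [convexHull_range_eq_exists_affineCombination] at hv
  obtain ⟨t, w, hw, hw_one, rfl⟩ := hv
  refine ⟨t, w, hw, hw_one, fun g hg i => ?_⟩
  rw [Finset.affineCombination_eq_linear_combination _ _ _ hw_one, dist_zero_left] at hvε
  have hcoord := (((∑ x ∈ t, w x • fun g : E => b (g * x) - b x) ⟨g, hg⟩).norm_coe_le_norm i).trans
    ((norm_le_pi_norm _ _).trans hvε.le)
  rwa [Finset.sum_apply, BoundedContinuousFunction.sum_apply, Real.norm_eq_abs] at hcoord

theorem abs_sum_mul_le_of_sum_eq_one {κ : Type*} {t : Finset κ} {w a : κ → ℝ}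
    (hw : ∀ k ∈ t, 0 ≤ w k) (hw_one : ∑ k ∈ t, w k = 1) {ε : ℝ} (ha : ∀ k ∈ t, |a k| ≤ ε) :
    |∑ k ∈ t, w k * a k| ≤ ε :=
  calc |∑ k ∈ t, w k * a k| ≤ ∑ k ∈ t, |w k * a k| := Finset.abs_sum_le_sum_abs _ _
    _ ≤ ∑ k ∈ t, w k * ε := Finset.sum_le_sum fun k hk => by
        rw [abs_mul, abs_of_nonneg (hw k hk)]
        exact mul_le_mul_of_nonneg_left (ha k hk) (hw k hk)
    _ = ε := by rw [← Finset.sum_mul, hw_one, one_mul]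

theorem IsAmenable.exists_almost_invariant_of_isCompact (hG : IsAmenable G)
    {I : Type*} (f : I → G → ℝ) {C : ℝ} (hC : ∀ i x, |f i x| ≤ C)
    (hf : ∀ ε > 0, ∀ᶠ u in 𝓝 (1 : G), ∀ i x, |f i (u * x) - f i x| < ε)
    {K : Set G} (hK : IsCompact K) {ε : ℝ} (hε : 0 < ε) :
    ∃ (t : Finset G) (w : G → ℝ), (∀ x ∈ t, 0 ≤ w x) ∧ ∑ x ∈ t, w x = 1 ∧
      ∀ g ∈ K, ∀ i, |∑ x ∈ t, w x * (f i (g * x) - f i x)| ≤ ε := by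
  obtain ⟨E, -, hE⟩ := hK.elim_nhds_subcover
    (fun k => {g | ∀ i y, |f i (g * k⁻¹ * y) - f i y| < ε / 2}) fun k _ =>
      ((continuous_mul_const k⁻¹).tendsto' k 1 (mul_inv_cancel k)).eventually
        (hf (ε / 2) (half_pos hε))
  obtain ⟨t, w, hw, hw_one, hinv⟩ := hG.exists_almost_invariant f hC hf E (half_pos hε)
  refine ⟨t, w, hw, hw_one, fun g hg i => ?_⟩
  obtain ⟨k, hk, hgk⟩ := Set.mem_iUnion₂.1 (hE hg)
  have hclose : |∑ x ∈ t, w x * (f i (g * x) - f i (k * x))| ≤ ε / 2 :=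
    abs_sum_mul_le_of_sum_eq_one hw hw_one fun x _ => by
      simpa only [mul_assoc, inv_mul_cancel_left] using (hgk i (k * x)).le
  calc |∑ x ∈ t, w x * (f i (g * x) - f i x)|
      = |∑ x ∈ t, w x * (f i (k * x) - f i x) + ∑ x ∈ t, w x * (f i (g * x) - f i (k * x))| := by
        rw [← Finset.sum_add_distrib]
        congr 1
        exact Finset.sum_congr rfl fun x _ => by ring
    _ ≤ ε := (abs_add_le _ _).trans (by linarith [hinv k hk i])

end AlmostInvariance

section Smoothing

section CompactSupport

variable {X : Type*} [TopologicalSpace X] [MeasurableSpace X] [BorelSpace X] {μ : Measure X}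
  [IsFiniteMeasureOnCompacts μ]

theorem integrable_mul_of_hasCompactSupport {φ k : X → ℝ} (hφ : Continuous φ)
    (hc : HasCompactSupport φ) (hk : Continuous k) : Integrable (fun u => k u * φ u) μ :=
  (hk.mul hφ).integrable_of_hasCompactSupport hc.mul_left

theorem abs_integral_mul_le {φ k : X → ℝ} (hφ : Continuous φ) (hc : HasCompactSupport φ)
    {C : ℝ} (hk : ∀ x, |k x| ≤ C) : |∫ u, k u * φ u ∂μ| ≤ C * ∫ u, |φ u| ∂μ := by
  rw [← Real.norm_eq_abs, ← integral_const_mul]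
  refine norm_integral_le_of_norm_le
    ((hφ.abs.integrable_of_hasCompactSupport hc.abs).const_mul C) (ae_of_all _ fun u => ?_)
  rw [norm_mul]
  exact mul_le_mul_of_nonneg_right (hk u) (norm_nonneg _)

-- `D / (|D| + δ)` is a continuous replacement for the sign of `D`.
theorem integral_abs_le_of_forall {D : X → ℝ} (hD : Continuous D) (hc : HasCompactSupport D)
    {ε : ℝ} (hε : ∀ h : X → ℝ, Continuous h → (∀ x, |h x| ≤ 1) → ∫ y, h y * D y ∂μ ≤ ε) :
    ∫ y, |D y| ∂μ ≤ ε := by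
  have happrox (δ : ℝ) (hδ : 0 < δ) : ∫ y, |D y| ∂μ ≤ ε + δ * μ.real (tsupport D) := by
    have hpos (y : X) : 0 < |D y| + δ := by positivity
    have hsign : Continuous fun y => D y / (|D y| + δ) :=
      hD.div (hD.abs.add continuous_const) fun y => (hpos y).ne'
    have hsign_int := integrable_mul_of_hasCompactSupport (μ := μ) hD hc hsign
    have hind : Integrable ((tsupport D).indicator fun _ => δ) μ :=
      (integrable_indicator_iff (isClosed_tsupport D).measurableSet).2
        (integrableOn_const hc.isCompact.measure_lt_top.ne)
    have hle (y : X) : |D y| ≤ D y / (|D y| + δ) * D y + (tsupport D).indicator (fun _ => δ) y := by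
      by_cases hy : y ∈ tsupport D
      · rw [Set.indicator_of_mem hy, div_mul_eq_mul_div, ← abs_mul_abs_self, ← sub_le_iff_le_add,
          le_div_iff₀ (hpos y)]
        nlinarith [abs_nonneg (D y)]
      · simp [Set.indicator_of_notMem hy, image_eq_zero_of_notMem_tsupport hy]
    calc ∫ y, |D y| ∂μ
        ≤ ∫ y, (D y / (|D y| + δ) * D y + (tsupport D).indicator (fun _ => δ) y) ∂μ :=
          integral_mono (hD.abs.integrable_of_hasCompactSupport hc.abs) (hsign_int.add hind) hle
      _ = ∫ y, D y / (|D y| + δ) * D y ∂μ + δ * μ.real (tsupport D) := by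
          rw [integral_add hsign_int hind,
            integral_indicator (isClosed_tsupport D).measurableSet, setIntegral_const, smul_eq_mul,
            mul_comm δ]
      _ ≤ ε + δ * μ.real (tsupport D) := by
          gcongr
          refine hε _ hsign fun y => ?_
          rw [abs_div, abs_of_pos (hpos y), div_le_one (hpos y)]
          linarith
  have hlim : Tendsto (fun δ : ℝ => ε + δ * μ.real (tsupport D)) (𝓝[>] 0) (𝓝 ε) :=
    ((by fun_prop : Continuous fun δ : ℝ => ε + δ * μ.real (tsupport D)).tendsto' 0 ε
      (by simp)).mono_left nhdsWithin_le_nhds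
  exact ge_of_tendsto hlim (eventually_mem_nhdsWithin.mono happrox)

end CompactSupport

variable {G : Type*} [Group G] [TopologicalSpace G] [MeasurableSpace G] [BorelSpace G]
  {θ : Measure G}

theorem tendsto_integral_abs_zero [IsFiniteMeasureOnCompacts θ] {k : G → G → ℝ}
    (hk : Continuous (Function.uncurry k)) {N S : Set G} (hN : N ∈ 𝓝 (1 : G)) (hS : IsCompact S)
    (hkS : ∀ v ∈ N, ∀ u ∉ S, k v u = 0) (hk_one : ∀ u, k 1 u = 0) :
    Tendsto (fun v => ∫ u, |k v u| ∂θ) (𝓝 1) (𝓝 0) := by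
  have hcont : ContinuousOn (fun v => ∫ u, |k v u| ∂θ) N :=
    continuousOn_integral_of_compact_support (f := fun v u => |k v u|) hS hk.abs.continuousOn
      fun v u hv hu => by simp [hkS v hv u hu]
  simpa [hk_one] using (hcont.continuousAt hN).tendsto

/-- The average `x ↦ ∫ h (u x) φ u dθ(u)` of the right translates of `h` with density `φ`. -/
def smear (θ : Measure G) (φ h : G → ℝ) (x : G) : ℝ := ∫ u, h (u * x) * φ u ∂θ

theorem abs_smear_le [IsFiniteMeasureOnCompacts θ] {φ h : G → ℝ} (hφ : Continuous φ)
    (hc : HasCompactSupport φ) (h_le : ∀ x, |h x| ≤ 1) (x : G) : |smear θ φ h x| ≤ ∫ u, |φ u| ∂θ :=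
  (abs_integral_mul_le hφ hc fun _ => h_le _).trans_eq (one_mul _)

variable [IsTopologicalGroup G]

theorem exists_bump [LocallyCompactSpace G] (θ : Measure G) [θ.IsHaarMeasure] {U : Set G}
    (hU : U ∈ 𝓝 (1 : G)) :
    ∃ φ : G → ℝ, Continuous φ ∧ HasCompactSupport φ ∧ (∀ x, 0 ≤ φ x) ∧ ∫ x, φ x ∂θ = 1 ∧
      ∀ x, φ x ≠ 0 → x ∈ U := by
  obtain ⟨χ, hχ_one, hχ_zero, hc, hχ⟩ := exists_continuous_one_zero_of_isCompact
    (isCompact_singleton (x := (1 : G))) isOpen_interior.isClosed_compl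
    (Set.disjoint_compl_right_iff_subset.2
      (Set.singleton_subset_iff.2 (mem_interior_iff_mem_nhds.2 hU)))
  have hpos : 0 < ∫ x, χ x ∂θ :=
    χ.continuous.integral_pos_of_hasCompactSupport_nonneg_nonzero hc (fun x => (hχ x).1)
      (x := 1) (by simp [hχ_one rfl])
  refine ⟨fun x => (∫ x, χ x ∂θ)⁻¹ * χ x, χ.continuous.const_mul _, hc.mul_left, fun x =>
    mul_nonneg (inv_nonneg.2 hpos.le) (hχ x).1, ?_, fun x hx => ?_⟩
  · rw [integral_const_mul, inv_mul_cancel₀ hpos.ne']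
  · by_contra hxU
    exact hx (by simp [hχ_zero fun h : x ∈ interior U => hxU (interior_subset h)])

theorem integral_mul_right_eq_modular [LocallyCompactSpace G] (θ : Measure G) [θ.IsHaarMeasure]
    {f : G → ℝ} (hf : Continuous f) (hc : HasCompactSupport f) (x : G) :
    ∫ y, f (y * x) ∂θ = Measure.modularCharacterFun x * ∫ y, f y ∂θ := by
  rw [Measure.modularCharacterFun_eq_haarScalarFactor θ x]
  have h := Measure.integral_isMulLeftInvariant_eq_smul_of_hasCompactSupport
    (θ.map (fun y => y * x)) θ hf hc
  rwa [integral_smul_nnreal_measure, integral_map (by fun_prop) hf.aestronglyMeasurable] at h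

section Translation

variable [LocallyCompactSpace G] [IsFiniteMeasureOnCompacts θ] {φ : G → ℝ}

theorem tendsto_integral_abs_right_translate_sub (hφ : Continuous φ) (hc : HasCompactSupport φ) :
    Tendsto (fun v => ∫ u, |φ (u * v⁻¹) - φ u| ∂θ) (𝓝 1) (𝓝 0) := by
  obtain ⟨N, hNc, hN⟩ := exists_compact_mem_nhds (1 : G)
  refine tendsto_integral_abs_zero (k := fun v u => φ (u * v⁻¹) - φ u)
    (by simp only [Function.uncurry_def]; fun_prop) hN (hc.isCompact.mul hNc |>.union hc.isCompact)
    (fun v hv u hu => ?_) (by simp)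
  rw [image_eq_zero_of_notMem_tsupport fun h => hu (.inr h),
    image_eq_zero_of_notMem_tsupport fun h => hu (.inl ⟨_, h, v, hv, by simp⟩), sub_zero]

theorem tendsto_integral_abs_left_translate_sub (hφ : Continuous φ) (hc : HasCompactSupport φ) :
    Tendsto (fun v => ∫ u, |φ (v⁻¹ * u) - φ u| ∂θ) (𝓝 1) (𝓝 0) := by
  obtain ⟨N, hNc, hN⟩ := exists_compact_mem_nhds (1 : G)
  refine tendsto_integral_abs_zero (k := fun v u => φ (v⁻¹ * u) - φ u)
    (by simp only [Function.uncurry_def]; fun_prop) hN (hNc.mul hc.isCompact |>.union hc.isCompact)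
    (fun v hv u hu => ?_) (by simp)
  rw [image_eq_zero_of_notMem_tsupport fun h => hu (.inr h),
    image_eq_zero_of_notMem_tsupport fun h => hu (.inl ⟨v, hv, _, h, by simp⟩), sub_zero]

end Translation

theorem tendsto_modularCharacterFun_one [LocallyCompactSpace G] :
    Tendsto (fun v : G => (Measure.modularCharacterFun v : ℝ)) (𝓝 1) (𝓝 1) := by
  obtain ⟨φ, hφ, hc, -, hφ_int, -⟩ := exists_bump (Measure.haar : Measure G) univ_mem
  have heq (v : G) : (Measure.modularCharacterFun v : ℝ) - 1 =
      ∫ u, (φ (u * v) - φ u) ∂Measure.haar := by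
    rw [integral_sub ((by fun_prop : Continuous fun u => φ (u * v)).integrable_of_hasCompactSupport
        (hc.comp_homeomorph (Homeomorph.mulRight v))) (hφ.integrable_of_hasCompactSupport hc),
      integral_mul_right_eq_modular Measure.haar hφ hc v, hφ_int, mul_one]
  have hlim : Tendsto (fun v : G => ∫ u, |φ (u * v) - φ u| ∂Measure.haar) (𝓝 1) (𝓝 0) := by
    simpa only [Function.comp_def, inv_inv] using
      (tendsto_integral_abs_right_translate_sub (θ := Measure.haar) hφ hc).comp
        (continuous_inv.tendsto' (1 : G) 1 inv_one)
  rw [← tendsto_sub_nhds_zero_iff]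
  refine squeeze_zero_norm (fun v => ?_) hlim
  rw [heq]
  exact norm_integral_le_integral_norm _

section Smear

variable {φ ψ h : G → ℝ}

theorem smear_mul [LocallyCompactSpace G] [θ.IsHaarMeasure] (hφ : Continuous φ)
    (hc : HasCompactSupport φ) (hh : Continuous h) (v x : G) :
    smear θ φ h (v * x) =
      Measure.modularCharacterFun v * smear θ (fun u => φ (u * v⁻¹)) h x := by
  have h_int := integral_mul_right_eq_modular θ (f := fun u => h (u * x) * φ (u * v⁻¹))
    (by fun_prop) (hc.comp_homeomorph (Homeomorph.mulRight v⁻¹)).mul_left v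
  simpa [smear, mul_assoc] using h_int

theorem abs_smear_sub_smear_le [IsFiniteMeasureOnCompacts θ] (hφ : Continuous φ)
    (hφc : HasCompactSupport φ) (hψ : Continuous ψ) (hψc : HasCompactSupport ψ)
    (hh : Continuous h) (h_le : ∀ x, |h x| ≤ 1) (x : G) :
    |smear θ φ h x - smear θ ψ h x| ≤ ∫ u, |φ u - ψ u| ∂θ := by
  have hhx : Continuous fun u => h (u * x) := by fun_prop
  rw [smear, smear, ← integral_sub (integrable_mul_of_hasCompactSupport hφ hφc hhx)
    (integrable_mul_of_hasCompactSupport hψ hψc hhx)]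
  simp only [← mul_sub]
  exact (abs_integral_mul_le (hφ.sub hψ) (hφc.sub hψc) fun _ => h_le _).trans_eq (one_mul _)

theorem eventually_abs_smear_sub_lt [LocallyCompactSpace G] [θ.IsHaarMeasure] (hφ : Continuous φ)
    (hc : HasCompactSupport φ) {ε : ℝ} (hε : 0 < ε) :
    ∀ᶠ v in 𝓝 (1 : G), ∀ h : G → ℝ, Continuous h → (∀ x, |h x| ≤ 1) →
      ∀ x, |smear θ φ h (v * x) - smear θ φ h x| < ε := by
  have hlim : Tendsto (fun v : G => (Measure.modularCharacterFun v : ℝ) *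
      ∫ u, |φ (u * v⁻¹) - φ u| ∂θ + |(Measure.modularCharacterFun v : ℝ) - 1| * ∫ u, |φ u| ∂θ)
      (𝓝 1) (𝓝 0) := by
    simpa using (tendsto_modularCharacterFun_one.mul
      (tendsto_integral_abs_right_translate_sub (θ := θ) hφ hc)).add
      (((tendsto_modularCharacterFun_one (G := G)).sub_const 1).abs.mul_const (∫ u, |φ u| ∂θ))
  filter_upwards [hlim.eventually (gt_mem_nhds hε)] with v hv h hh h_le x
  refine lt_of_le_of_lt ?_ hv
  set Δ : ℝ := (Measure.modularCharacterFun v : ℝ)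
  have hΔ : 0 ≤ Δ := NNReal.coe_nonneg _
  have hsplit : smear θ φ h (v * x) - smear θ φ h x =
      Δ * (smear θ (fun u => φ (u * v⁻¹)) h x - smear θ φ h x) + (Δ - 1) * smear θ φ h x := by
    rw [smear_mul hφ hc hh]
    ring
  rw [hsplit]
  refine (abs_add_le _ _).trans ?_
  rw [abs_mul, abs_mul, abs_of_nonneg hΔ]
  gcongr
  · exact abs_smear_sub_smear_le (by fun_prop) (hc.comp_homeomorph (Homeomorph.mulRight v⁻¹)) hφ hc
      hh h_le x
  · exact abs_smear_le hφ hc h_le x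

theorem smear_left_translate [θ.IsMulLeftInvariant] (u x : G) :
    smear θ (fun g => ψ (u⁻¹ * g)) h x = ∫ g, h (u * (g * x)) * ψ g ∂θ := by
  rw [smear, ← integral_mul_left_eq_self (fun g => h (g * x) * ψ (u⁻¹ * g)) u]
  simp [mul_assoc]

variable [IsFiniteMeasureOnCompacts θ]

theorem continuous_smear (hφ : Continuous φ) (hc : HasCompactSupport φ) (hh : Continuous h) :
    Continuous (smear θ φ h) := by
  rw [← continuousOn_univ]
  refine continuousOn_integral_of_compact_support (f := fun x u => h (u * x) * φ u) hc.isCompact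
    (by simp only [Function.uncurry_def]; fun_prop) fun x u _ hu => ?_
  rw [image_eq_zero_of_notMem_tsupport hu, mul_zero]

theorem integral_smear_mul [θ.IsMulLeftInvariant] (hφ : Continuous φ) (hφc : HasCompactSupport φ)
    (hψ : Continuous ψ) (hψc : HasCompactSupport ψ) (hh : Continuous h) (x : G) :
    ∫ g, smear θ φ h (g * x) * ψ g ∂θ =
      ∫ u, smear θ (fun g => ψ (u⁻¹ * g)) h x * φ u ∂θ := by
  simp only [smear_left_translate]
  simp only [smear, ← integral_mul_const]
  rw [integral_integral_swap_of_hasCompactSupport (f := fun g u => h (u * (g * x)) * φ u * ψ g)]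
  · simp only [mul_right_comm]
  · simp only [Function.uncurry_def]
    fun_prop
  · refine HasCompactSupport.intro (hψc.isCompact.prod hφc.isCompact) ?_
    rintro ⟨g, u⟩ hgu
    simp only [Function.uncurry_apply_pair]
    by_cases hg : g ∈ tsupport ψ
    · rw [image_eq_zero_of_notMem_tsupport (f := φ) fun hu => hgu ⟨hg, hu⟩, mul_zero, zero_mul]
    · rw [image_eq_zero_of_notMem_tsupport hg, mul_zero]

theorem continuous_smear_left_translate [θ.IsMulLeftInvariant] (hψ : Continuous ψ)
    (hψc : HasCompactSupport ψ) (hh : Continuous h) (x : G) :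
    Continuous fun u => smear θ (fun g => ψ (u⁻¹ * g)) h x := by
  simp only [smear_left_translate]
  rw [← continuousOn_univ]
  refine continuousOn_integral_of_compact_support (f := fun u g => h (u * (g * x)) * ψ g)
    hψc.isCompact (by simp only [Function.uncurry_def]; fun_prop) fun u g _ hg => ?_
  rw [image_eq_zero_of_notMem_tsupport hg, mul_zero]

theorem abs_smear_sub_integral_smear_le [θ.IsMulLeftInvariant] (hφ : Continuous φ)
    (hφc : HasCompactSupport φ) (hφ_nonneg : ∀ x, 0 ≤ φ x) (hφ_int : ∫ x, φ x ∂θ = 1)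
    (hψ : Continuous ψ) (hψc : HasCompactSupport ψ) (hh : Continuous h) (h_le : ∀ x, |h x| ≤ 1)
    {ε : ℝ} (hε : ∀ u, φ u ≠ 0 → ∫ g, |ψ (u⁻¹ * g) - ψ g| ∂θ ≤ ε) (x : G) :
    |smear θ ψ h x - ∫ g, smear θ φ h (g * x) * ψ g ∂θ| ≤ ε := by
  have hφ_integrable := hφ.integrable_of_hasCompactSupport (μ := θ) hφc
  have hle (u : G) :
      ‖(smear θ ψ h x - smear θ (fun g => ψ (u⁻¹ * g)) h x) * φ u‖ ≤ ε * φ u := by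
    by_cases hu : φ u = 0
    · simp [hu]
    rw [norm_mul, Real.norm_of_nonneg (hφ_nonneg u), norm_sub_rev]
    refine mul_le_mul_of_nonneg_right (le_trans ?_ (hε u hu)) (hφ_nonneg u)
    exact abs_smear_sub_smear_le (by fun_prop) (hψc.comp_homeomorph (Homeomorph.mulLeft u⁻¹)) hψ
      hψc hh h_le x
  calc |smear θ ψ h x - ∫ g, smear θ φ h (g * x) * ψ g ∂θ|
      = ‖∫ u, (smear θ ψ h x - smear θ (fun g => ψ (u⁻¹ * g)) h x) * φ u ∂θ‖ := by
        simp only [sub_mul]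
        rw [integral_sub (hφ_integrable.const_mul _) (integrable_mul_of_hasCompactSupport hφ hφc
            (continuous_smear_left_translate hψ hψc hh x)), integral_const_mul, hφ_int, mul_one,
          integral_smear_mul hφ hφc hψ hψc hh, Real.norm_eq_abs]
    _ ≤ ∫ u, ε * φ u ∂θ :=
        norm_integral_le_of_norm_le (hφ_integrable.const_mul ε) (ae_of_all _ hle)
    _ = ε := by rw [integral_const_mul, hφ_int, mul_one]

end Smear

end Smoothing

section Majorant

variable {G : Type*} [Group G]

/-- A function which dominates all left translates of `f` by elements of `E`, and has almost the
same integral as `f` if these translates are close to `f` in `L¹`. -/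
def translateMajorant (E : Finset G) (f : G → ℝ) (y : G) : ℝ :=
  f y + ∑ k ∈ E, |f (k⁻¹ * y) - f y|

theorem le_translateMajorant {E : Finset G} {k : G} (hk : k ∈ E) (f : G → ℝ) (y : G) :
    f (k⁻¹ * y) ≤ translateMajorant E f y := by
  have hsingle := Finset.single_le_sum (f := fun k => |f (k⁻¹ * y) - f y|)
    (fun k _ => abs_nonneg _) hk
  have := le_abs_self (f (k⁻¹ * y) - f y)
  simp only [translateMajorant]
  linarith

variable [TopologicalSpace G] [IsTopologicalGroup G]

theorem eventually_le_left_translate_add {ψ : G → ℝ} (hψ : Continuous ψ) (hc : HasCompactSupport ψ)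
    {N : Set G} (hN : N ∈ 𝓝 (1 : G)) {χ : G → ℝ} (hψ_nonneg : ∀ x, 0 ≤ ψ x)
    (hχ_nonneg : ∀ x, 0 ≤ χ x) (hχ_one : ∀ x ∈ N * tsupport ψ, χ x = 1) {δ : ℝ} (hδ : 0 < δ) :
    ∀ᶠ u in 𝓝 (1 : G), ∀ v, ψ v ≤ ψ (u * v) + δ * χ (u * v) := by
  have hclose : ∀ᶠ u in 𝓝 (1 : G), ∀ v ∈ tsupport ψ, ψ v - ψ (u * v) < δ :=
    hc.isCompact.eventually_forall_of_forall_eventually fun v _ =>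
      ((by fun_prop : Continuous fun z : G × G => ψ z.2 - ψ (z.1 * z.2)).tendsto' (1, v) 0
        (by simp)).eventually (gt_mem_nhds hδ)
  filter_upwards [hclose, hN] with u hu huN v
  by_cases hv : v ∈ tsupport ψ
  · rw [hχ_one _ (Set.mul_mem_mul huN hv)]
    linarith [hu v hv]
  · rw [image_eq_zero_of_notMem_tsupport hv]
    exact add_nonneg (hψ_nonneg _) (mul_nonneg hδ.le (hχ_nonneg _))

variable [MeasurableSpace G] [BorelSpace G] {θ : Measure G} [IsFiniteMeasureOnCompacts θ]

theorem integrable_abs_left_translate_sub {f : G → ℝ} (hf : Continuous f)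
    (hc : HasCompactSupport f) (k : G) : Integrable (fun y => |f (k⁻¹ * y) - f y|) θ :=
  ((hf.comp (continuous_const_mul k⁻¹)).sub hf).abs.integrable_of_hasCompactSupport
    ((hc.comp_homeomorph (Homeomorph.mulLeft k⁻¹)).sub hc).abs

theorem integrable_translateMajorant {f : G → ℝ} (hf : Continuous f) (hc : HasCompactSupport f)
    (E : Finset G) : Integrable (translateMajorant E f) θ :=
  (hf.integrable_of_hasCompactSupport hc).add
    (integrable_finsetSum _ fun k _ => integrable_abs_left_translate_sub hf hc k)

theorem integral_translateMajorant_le {f : G → ℝ} (hf : Continuous f) (hc : HasCompactSupport f)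
    {E : Finset G} {δ : ℝ} (hE : ∀ k ∈ E, ∫ y, |f (k⁻¹ * y) - f y| ∂θ ≤ δ) :
    ∫ y, translateMajorant E f y ∂θ ≤ ∫ y, f y ∂θ + E.card * δ := by
  simp only [translateMajorant]
  rw [integral_add (hf.integrable_of_hasCompactSupport hc)
      (integrable_finsetSum _ fun k _ => integrable_abs_left_translate_sub hf hc k),
    integral_finsetSum _ fun k _ => integrable_abs_left_translate_sub hf hc k, ← nsmul_eq_mul]
  gcongr
  exact Finset.sum_le_card_nsmul E _ δ hE

end Majorant

-- Otherwise the layer cake formula would give the opposite inequality of the integrals.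
theorem exists_level {Ω : Type*} [MeasurableSpace Ω] (μ : Measure Ω) {R M : Ω → ℝ}
    (hR : Integrable R μ) (hR_nonneg : ∀ y, 0 ≤ R y) (hM : Integrable M μ)
    (hM_nonneg : ∀ y, 0 ≤ M y) {a : ℝ} (ha : 0 ≤ a) (hRM : ∫ y, M y ∂μ < a * ∫ y, R y ∂μ) :
    ∃ s > 0, μ {y | s ≤ R y} ≠ 0 ∧ μ {y | s ≤ M y} ≤ ENNReal.ofReal a * μ {y | s ≤ R y} := by
  by_contra! h
  have hle (s : ℝ) (hs : s ∈ Set.Ioi (0 : ℝ)) :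
      ENNReal.ofReal a * μ {y | s ≤ R y} ≤ μ {y | s ≤ M y} := by
    by_cases hzero : μ {y | s ≤ R y} = 0
    · simp [hzero]
    · exact (h s hs hzero).le
  have hint := setLIntegral_mono' (μ := volume) measurableSet_Ioi hle
  rw [lintegral_const_mul' _ _ ENNReal.ofReal_ne_top,
    ← lintegral_eq_lintegral_meas_le μ (ae_of_all _ hR_nonneg) hR.aemeasurable,
    ← lintegral_eq_lintegral_meas_le μ (ae_of_all _ hM_nonneg) hM.aemeasurable,
    ← ofReal_integral_eq_lintegral_ofReal hR (ae_of_all _ hR_nonneg),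
    ← ofReal_integral_eq_lintegral_ofReal hM (ae_of_all _ hM_nonneg), ← ENNReal.ofReal_mul ha,
    ENNReal.ofReal_le_ofReal_iff (integral_nonneg hM_nonneg)] at hint
  exact hRM.not_ge hint

section Smear

variable {G : Type*} [Group G] [TopologicalSpace G] [IsTopologicalGroup G] [MeasurableSpace G]
  [BorelSpace G] {θ : Measure G} [IsFiniteMeasureOnCompacts θ] {t : Finset G}
  {w φ ψ h : G → ℝ} {η : ℝ}

theorem abs_sum_integral_smear_mul_sub_le (hφ : Continuous φ) (hφc : HasCompactSupport φ)
    (hψ : Continuous ψ) (hψc : HasCompactSupport ψ) (hh : Continuous h)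
    (hinv : ∀ g, ψ g ≠ 0 → |∑ x ∈ t, w x * (smear θ φ h (g * x) - smear θ φ h x)| ≤ η) :
    |∑ x ∈ t, w x * ∫ g, smear θ φ h (g * x) * ψ g ∂θ -
      (∑ x ∈ t, w x * smear θ φ h x) * ∫ g, ψ g ∂θ| ≤ η * ∫ g, |ψ g| ∂θ := by
  have hint (x : G) : Integrable (fun g => w x * (smear θ φ h (g * x) * ψ g)) θ :=
    (integrable_mul_of_hasCompactSupport hψ hψc
      ((continuous_smear hφ hφc hh).comp (continuous_mul_const x))).const_mul _
  have hcombine : ∑ x ∈ t, w x * ∫ g, smear θ φ h (g * x) * ψ g ∂θ -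
      (∑ x ∈ t, w x * smear θ φ h x) * ∫ g, ψ g ∂θ =
      ∫ g, (∑ x ∈ t, w x * (smear θ φ h (g * x) - smear θ φ h x)) * ψ g ∂θ := by
    simp only [← integral_const_mul]
    rw [← integral_finsetSum _ fun x _ => hint x,
      ← integral_sub (integrable_finsetSum _ fun x _ => hint x)
        ((hψ.integrable_of_hasCompactSupport hψc).const_mul _)]
    refine integral_congr_ae (ae_of_all _ fun g => ?_)
    simp only [Finset.sum_mul, ← Finset.sum_sub_distrib]
    exact Finset.sum_congr rfl fun x _ => by ring
  rw [hcombine, ← Real.norm_eq_abs, ← integral_const_mul]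
  refine norm_integral_le_of_norm_le
    ((hψ.abs.integrable_of_hasCompactSupport hψc.abs).const_mul _) (ae_of_all _ fun g => ?_)
  by_cases hg : ψ g = 0
  · simp [hg]
  · rw [norm_mul]
    exact mul_le_mul_of_nonneg_right (hinv g hg) (norm_nonneg _)

theorem abs_sum_smear_sub_le [θ.IsMulLeftInvariant] (hw : ∀ x ∈ t, 0 ≤ w x)
    (hw_one : ∑ x ∈ t, w x = 1) (hφ : Continuous φ) (hφc : HasCompactSupport φ)
    (hφ_nonneg : ∀ x, 0 ≤ φ x) (hφ_int : ∫ x, φ x ∂θ = 1) (hψ : Continuous ψ)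
    (hψc : HasCompactSupport ψ) (hφψ : ∀ u, φ u ≠ 0 → ∫ g, |ψ (u⁻¹ * g) - ψ g| ∂θ ≤ η)
    (hh : Continuous h) (h_le : ∀ x, |h x| ≤ 1)
    (hinv : ∀ g, ψ g ≠ 0 → |∑ x ∈ t, w x * (smear θ φ h (g * x) - smear θ φ h x)| ≤ η) :
    |∑ x ∈ t, w x * smear θ ψ h x - (∑ x ∈ t, w x * smear θ φ h x) * ∫ g, ψ g ∂θ| ≤
      η + η * ∫ g, |ψ g| ∂θ := by
  have hsmear : |∑ x ∈ t, w x * smear θ ψ h x -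
      ∑ x ∈ t, w x * ∫ g, smear θ φ h (g * x) * ψ g ∂θ| ≤ η := by
    simp only [← Finset.sum_sub_distrib, ← mul_sub]
    exact abs_sum_mul_le_of_sum_eq_one hw hw_one fun x _ =>
      abs_smear_sub_integral_smear_le hφ hφc hφ_nonneg hφ_int hψ hψc hh h_le hφψ x
  exact (abs_sub_le _ _ _).trans
    (add_le_add hsmear (abs_sum_integral_smear_mul_sub_le hφ hφc hψ hψc hh hinv))

end Smear

section Convolution

variable {G : Type*} [Group G] [TopologicalSpace G] [IsTopologicalGroup G] [LocallyCompactSpace G]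
  {t : Finset G} {w ψ ψ' : G → ℝ}

/-- The density of the convolution of `ψ θ` with the measure `∑ x ∈ t, w x • δ x`. -/
def convDensity (t : Finset G) (w ψ : G → ℝ) (y : G) : ℝ :=
  ∑ x ∈ t, w x * Measure.modularCharacterFun x * ψ (y * x⁻¹)

theorem continuous_convDensity (hψ : Continuous ψ) : Continuous (convDensity t w ψ) := by
  unfold convDensity
  fun_prop

theorem hasCompactSupport_convDensity (hc : HasCompactSupport ψ) :
    HasCompactSupport (convDensity t w ψ) := by
  refine HasCompactSupport.intro (t.isCompact_biUnion fun x _ =>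
    hc.isCompact.image (continuous_mul_const x)) fun y hy => Finset.sum_eq_zero fun x hx => ?_
  rw [image_eq_zero_of_notMem_tsupport (f := ψ), mul_zero]
  exact fun h => hy (Set.mem_biUnion hx ⟨_, h, by simp⟩)

theorem convDensity_nonneg (hw : ∀ x ∈ t, 0 ≤ w x) (hψ : ∀ x, 0 ≤ ψ x) (y : G) :
    0 ≤ convDensity t w ψ y :=
  Finset.sum_nonneg fun x hx => mul_nonneg (mul_nonneg (hw x hx) (NNReal.coe_nonneg _)) (hψ _)

theorem convDensity_le_convDensity_mul (hw : ∀ x ∈ t, 0 ≤ w x) {u : G}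
    (hu : ∀ v, ψ v ≤ ψ' (u * v)) (y : G) : convDensity t w ψ y ≤ convDensity t w ψ' (u * y) :=
  Finset.sum_le_sum fun x hx => mul_le_mul_of_nonneg_left
    (by simpa only [mul_assoc] using hu (y * x⁻¹)) (mul_nonneg (hw x hx) (NNReal.coe_nonneg _))

variable [MeasurableSpace G] [BorelSpace G] {θ : Measure G} [θ.IsHaarMeasure]

theorem integral_mul_convDensity (hψ : Continuous ψ) (hc : HasCompactSupport ψ)
    {h : G → ℝ} (hh : Continuous h) :
    ∫ y, h y * convDensity t w ψ y ∂θ = ∑ x ∈ t, w x * smear θ ψ h x := by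
  simp only [convDensity, Finset.mul_sum]
  rw [integral_finsetSum]
  · refine Finset.sum_congr rfl fun x _ => ?_
    have hsmear := smear_mul (θ := θ) hψ hc hh x 1
    rw [mul_one] at hsmear
    rw [hsmear, smear, ← mul_assoc, ← integral_const_mul]
    simp only [mul_one, mul_left_comm]
  · intro x _
    exact integrable_mul_of_hasCompactSupport (by fun_prop)
      (hc.comp_homeomorph (Homeomorph.mulRight x⁻¹)).mul_left hh

theorem integral_convDensity (hψ : Continuous ψ) (hc : HasCompactSupport ψ)
    (hw_one : ∑ x ∈ t, w x = 1) : ∫ y, convDensity t w ψ y ∂θ = ∫ y, ψ y ∂θ := by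
  simpa [smear, ← Finset.sum_mul, hw_one] using
    integral_mul_convDensity (θ := θ) (t := t) (w := w) hψ hc (h := fun _ => 1) continuous_const

theorem integral_abs_convDensity_sub_le {ψ₁ ψ₂ : G → ℝ} (hψ₁ : Continuous ψ₁)
    (hc₁ : HasCompactSupport ψ₁) (hψ₂ : Continuous ψ₂) (hc₂ : HasCompactSupport ψ₂) {ε : ℝ}
    (hε : ∀ h : G → ℝ, Continuous h → (∀ x, |h x| ≤ 1) →
      ∑ x ∈ t, w x * smear θ ψ₁ h x - ∑ x ∈ t, w x * smear θ ψ₂ h x ≤ ε) :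
    ∫ y, |convDensity t w ψ₁ y - convDensity t w ψ₂ y| ∂θ ≤ ε := by
  have hcont₁ := continuous_convDensity (t := t) (w := w) hψ₁
  have hcont₂ := continuous_convDensity (t := t) (w := w) hψ₂
  have hconv₁ := hasCompactSupport_convDensity (t := t) (w := w) hc₁
  have hconv₂ := hasCompactSupport_convDensity (t := t) (w := w) hc₂
  refine integral_abs_le_of_forall (D := fun y => convDensity t w ψ₁ y - convDensity t w ψ₂ y)
    (hcont₁.sub hcont₂) (hconv₁.sub hconv₂) fun h hh h_le => ?_
  simp only [mul_sub]
  rw [integral_sub (integrable_mul_of_hasCompactSupport hcont₁ hconv₁ hh)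
    (integrable_mul_of_hasCompactSupport hcont₂ hconv₂ hh), integral_mul_convDensity hψ₁ hc₁ hh,
    integral_mul_convDensity hψ₂ hc₂ hh]
  exact hε h hh h_le

-- Day's almost invariance is applied to the family of all functions smeared with a bump `φ`, which
-- is uniformly equicontinuous; testing against all bounded continuous functions bounds `L¹` norms.
theorem IsAmenable.exists_convDensity_almost_invariant (hG : IsAmenable G) (hψ : Continuous ψ)
    (hc : HasCompactSupport ψ) (E : Finset G) {ε : ℝ} (hε : 0 < ε) :
    ∃ (t : Finset G) (w : G → ℝ), (∀ x ∈ t, 0 ≤ w x) ∧ ∑ x ∈ t, w x = 1 ∧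
      ∀ k ∈ E, ∫ y, |convDensity t w ψ (k⁻¹ * y) - convDensity t w ψ y| ∂θ ≤ ε := by
  classical
  let I : ℝ := ∫ g, |ψ g| ∂θ
  have hI : 0 ≤ I := integral_nonneg fun g => abs_nonneg _
  let η : ℝ := ε / (2 * (1 + I))
  have hη : 0 < η := by positivity
  let ψ_ (k g : G) : ℝ := ψ (k⁻¹ * g)
  have hψ_ (k : G) : Continuous (ψ_ k) := by fun_prop
  have hc_ (k : G) : HasCompactSupport (ψ_ k) := hc.comp_homeomorph (Homeomorph.mulLeft k⁻¹)
  have hU : ∀ᶠ u in 𝓝 (1 : G), ∀ k ∈ insert 1 E, ∫ g, |ψ_ k (u⁻¹ * g) - ψ_ k g| ∂θ ≤ η :=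
    (Finset.eventually_all _).2 fun k _ =>
      ((tendsto_integral_abs_left_translate_sub (θ := θ) (hψ_ k) (hc_ k)).eventually
        (gt_mem_nhds hη)).mono fun u hu => hu.le
  obtain ⟨φ, hφ, hφc, hφ_nonneg, hφ_int, hφU⟩ := exists_bump θ hU
  obtain ⟨t, w, hw, hw_one, hinv⟩ := hG.exists_almost_invariant_of_isCompact
    (I := {h : G → ℝ // Continuous h ∧ ∀ x, |h x| ≤ 1}) (fun h => smear θ φ h.1)
    (C := ∫ u, |φ u| ∂θ) (fun h x => abs_smear_le hφ hφc h.2.2 x)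
    (fun ε hε => (eventually_abs_smear_sub_lt (θ := θ) hφ hφc hε).mono
      fun u hu h x => hu h.1 h.2.1 h.2.2 x)
    ((insert 1 E).isCompact_biUnion fun k _ => (hc_ k).isCompact) hη
  refine ⟨t, w, hw, hw_one, fun k hk => ?_⟩
  have hclose (h : G → ℝ) (hh : Continuous h) (h_le : ∀ x, |h x| ≤ 1) (k : G)
      (hk : k ∈ insert 1 E) :
      |∑ x ∈ t, w x * smear θ (ψ_ k) h x - (∑ x ∈ t, w x * smear θ φ h x) * ∫ g, ψ g ∂θ| ≤
        ε / 2 := by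
    have hmass : ∫ g, ψ_ k g ∂θ = ∫ g, ψ g ∂θ := integral_mul_left_eq_self (fun g => ψ g) k⁻¹
    have hmass_abs : ∫ g, |ψ_ k g| ∂θ = I := integral_mul_left_eq_self (fun g => |ψ g|) k⁻¹
    have hη_eq : η + η * I = ε / 2 := by simp only [η]; field_simp
    rw [← hη_eq, ← hmass, ← hmass_abs]
    exact abs_sum_smear_sub_le hw hw_one hφ hφc hφ_nonneg hφ_int (hψ_ k) (hc_ k)
      (fun u hu => hφU u hu k hk) hh h_le fun g hg =>
        hinv g (Set.mem_biUnion hk (subset_tsupport _ hg)) ⟨h, hh, h_le⟩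
  have htranslate (y : G) : convDensity t w ψ (k⁻¹ * y) = convDensity t w (ψ_ k) y := by
    simp [convDensity, ψ_, mul_assoc]
  have hψ_one : ψ_ 1 = ψ := by ext g; simp [ψ_]
  simp only [htranslate]
  refine integral_abs_convDensity_sub_le (hψ_ k) (hc_ k) hψ hc fun h hh h_le => ?_
  have hk_close := (abs_le.1 (hclose h hh h_le k (Finset.mem_insert_of_mem hk))).2
  have hone_close := (abs_le.1 (hclose h hh h_le 1 (Finset.mem_insert_self 1 E))).1
  rw [hψ_one] at hone_close
  linarith

theorem exists_bump_le_left_translate (θ : Measure G) [θ.IsHaarMeasure] {ε : ℝ} (hε : 0 < ε) :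
    ∃ ψ ψ' : G → ℝ, (Continuous ψ ∧ HasCompactSupport ψ ∧ (∀ x, 0 ≤ ψ x) ∧ ∫ x, ψ x ∂θ = 1) ∧
      (Continuous ψ' ∧ HasCompactSupport ψ' ∧ (∀ x, 0 ≤ ψ' x) ∧ ∫ x, ψ' x ∂θ ≤ 1 + ε) ∧
      ∀ᶠ u in 𝓝 (1 : G), ∀ v, ψ v ≤ ψ' (u * v) := by
  obtain ⟨ψ, hψ, hc, hψ_nonneg, hψ_int, -⟩ := exists_bump θ univ_mem
  obtain ⟨N, hNc, hN⟩ := exists_compact_mem_nhds (1 : G)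
  obtain ⟨χ, hχ_one, -, hχc, hχ⟩ := exists_continuous_one_zero_of_isCompact
    (hNc.mul hc.isCompact) isClosed_empty (Set.disjoint_empty _)
  have hχ_int : 0 ≤ ∫ x, χ x ∂θ := integral_nonneg fun x => (hχ x).1
  have hδ : 0 < ε / (∫ x, χ x ∂θ + 1) := by positivity
  refine ⟨ψ, fun x => ψ x + ε / (∫ x, χ x ∂θ + 1) * χ x, ⟨hψ, hc, hψ_nonneg, hψ_int⟩,
    ⟨hψ.add (χ.continuous.const_mul _), hc.add hχc.mul_left,
      fun x => add_nonneg (hψ_nonneg x) (mul_nonneg hδ.le (hχ x).1), ?_⟩,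
    eventually_le_left_translate_add hψ hc hN hψ_nonneg (fun x => (hχ x).1) hχ_one hδ⟩
  rw [integral_add (hψ.integrable_of_hasCompactSupport hc)
    ((χ.continuous.integrable_of_hasCompactSupport hχc).const_mul _), integral_const_mul, hψ_int,
    add_le_add_iff_left, div_mul_eq_mul_div, div_le_iff₀ (by positivity)]
  nlinarith

-- The set is a superlevel set of a density that is almost invariant in `L¹`.
theorem IsAmenable.exists_isCompact_measure_mul_le (hG : IsAmenable G) (θ : Measure G)
    [θ.IsHaarMeasure] {K : Set G} (hK : IsCompact K) {ε : ℝ} (hε : 0 < ε) :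
    ∃ F : Set G, IsCompact F ∧ θ F ≠ 0 ∧ θ (K * F) ≤ ENNReal.ofReal (1 + ε) * θ F := by
  obtain ⟨ψ, ψ', ⟨hψ, hc, hψ_nonneg, hψ_int⟩, ⟨hψ', hc', hψ'_nonneg, hψ'_int⟩, hψψ'⟩ :=
    exists_bump_le_left_translate θ (ε := ε / 3) (by positivity)
  obtain ⟨E, -, hE⟩ := hK.elim_nhds_subcover (fun k => {x | ∀ v, ψ v ≤ ψ' (k⁻¹ * x * v)})
    fun k _ => ((continuous_const_mul k⁻¹).tendsto' k 1 (inv_mul_cancel k)).eventually hψψ'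
  obtain ⟨t, w, hw, hw_one, hinv⟩ := hG.exists_convDensity_almost_invariant (θ := θ) hψ' hc' E
    (ε := ε / (3 * (E.card + 1))) (by positivity)
  have hR := continuous_convDensity (t := t) (w := w) hψ
  have hRc := hasCompactSupport_convDensity (t := t) (w := w) hc
  have hR' := continuous_convDensity (t := t) (w := w) hψ'
  have hR'c := hasCompactSupport_convDensity (t := t) (w := w) hc'
  have hmass : ∫ y, translateMajorant E (convDensity t w ψ') y ∂θ <
      (1 + ε) * ∫ y, convDensity t w ψ y ∂θ := by
    have hcard : E.card * (ε / (3 * (E.card + 1))) ≤ ε / 3 := by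
      rw [mul_div_assoc', div_le_div_iff₀ (by positivity) (by positivity)]
      nlinarith
    have hle := integral_translateMajorant_le hR' hR'c hinv
    rw [integral_convDensity hψ' hc' hw_one] at hle
    rw [integral_convDensity hψ hc hw_one, hψ_int]
    linarith
  obtain ⟨s, hs, h₀, hle⟩ := exists_level θ (hR.integrable_of_hasCompactSupport hRc)
    (convDensity_nonneg hw hψ_nonneg) (integrable_translateMajorant hR' hR'c E)
    (fun y => add_nonneg (convDensity_nonneg hw hψ'_nonneg y)
      (Finset.sum_nonneg fun k _ => abs_nonneg _)) (by positivity) hmass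
  refine ⟨{y | s ≤ convDensity t w ψ y}, ?_, h₀, (measure_mono ?_).trans hle⟩
  · exact hRc.isCompact.of_isClosed_subset (isClosed_le continuous_const hR) fun y hy =>
      subset_tsupport _ (hs.trans_le hy).ne'
  · rintro _ ⟨x, hx, z, hz, rfl⟩
    obtain ⟨k, hk, hkx⟩ := Set.mem_iUnion₂.1 (hE hx)
    calc s ≤ convDensity t w ψ z := hz
      _ ≤ convDensity t w ψ' (k⁻¹ * x * z) := convDensity_le_convDensity_mul hw hkx z
      _ ≤ translateMajorant E (convDensity t w ψ') (x * z) := by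
        rw [mul_assoc]
        exact le_translateMajorant hk _ _

end Convolution

section ScaledMeasure

variable {G : Type*} [TopologicalSpace G] [MeasurableSpace G] [BorelSpace G] {θ : Measure G}
  {m : NNReal} {T : G ≃ₜ G}

theorem measure_image_of_map_eq_smul (hT : θ.map T = m • θ) (F : Set G) :
    m * θ (T '' F) = θ F := by
  have hmap := T.measurableEmbedding.map_apply θ (T '' F)
  rwa [Set.preimage_image_eq _ T.injective, hT] at hmap

variable [Group G] {X : Type*} [MetricSpace X] [CompactSpace X] [MulAction G X]
  [ContinuousSMul G X]

theorem avgOp_eq_inv_mul (θ : Measure G) (F : Set G) (f : C(X, ℝ)) (x : X) :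
    avgOp X θ F f x = (θ.real F)⁻¹ * ∫ g in F, f (g • x) ∂θ := by
  rw [avgOp_apply, setAverage_eq, smul_eq_mul]

theorem avgOp_image_of_map_eq_smul (hm : m ≠ 0) (hT : θ.map T = m • θ) (F : Set G) (f : C(X, ℝ))
    (x : X) : avgOp X θ (T '' F) f x = (θ.real F)⁻¹ * ∫ g in F, f (T g • x) ∂θ := by
  have hintegral : ∫ g in F, f (T g • x) ∂θ = m * ∫ g in T '' F, f (g • x) ∂θ := by
    have himage := MeasurePreserving.setIntegral_image_emb ⟨T.measurable, hT⟩
      T.measurableEmbedding (fun g => f (g • x)) F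
    rw [← himage, Measure.restrict_smul, integral_smul_nnreal_measure, NNReal.smul_def, smul_eq_mul]
  have hmeasure : θ.real F = m * θ.real (T '' F) := by
    rw [measureReal_def, ← measure_image_of_map_eq_smul hT, ENNReal.toReal_mul,
      ENNReal.coe_toReal, measureReal_def]
  have hm' : (m : ℝ) ≠ 0 := NNReal.coe_ne_zero.2 hm
  rw [avgOp_eq_inv_mul, hintegral, hmeasure]
  field_simp

variable [ContinuousMul G]

theorem avgOp_image_mul_left [θ.IsMulLeftInvariant] (g : G) (F : Set G) (f : C(X, ℝ)) :
    avgOp X θ ((fun h => g * h) '' F) f = avgOp X θ F (translate g f) := by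
  ext x
  have himage := avgOp_image_of_map_eq_smul (T := Homeomorph.mulLeft g) one_ne_zero
    ((map_mul_left_eq_self θ g).trans (one_smul _ _).symm) F f x
  simpa only [avgOp_eq_inv_mul θ F, translate_apply, Homeomorph.coe_mulLeft, mul_smul] using himage

theorem avgOp_image_mul_right_of_map_eq_smul {c : G} (hm : m ≠ 0)
    (hθ : θ.map (fun h => h * c) = m • θ) (F : Set G) (f : C(X, ℝ)) (x : X) :
    avgOp X θ ((fun h => h * c) '' F) f x = avgOp X θ F f (c • x) := by
  have himage := avgOp_image_of_map_eq_smul (T := Homeomorph.mulRight c) hm hθ F f x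
  simpa only [avgOp_eq_inv_mul θ F, Homeomorph.coe_mulRight, mul_smul] using himage

theorem avgOp_image_mul_right [θ.IsMulRightInvariant] (c : G) (F : Set G) (f : C(X, ℝ)) (x : X) :
    avgOp X θ ((fun h => h * c) '' F) f x = avgOp X θ F f (c • x) :=
  avgOp_image_mul_right_of_map_eq_smul one_ne_zero
    ((map_mul_right_eq_self θ c).trans (one_smul _ _).symm) F f x

end ScaledMeasure

section Thick

theorem abs_setIntegral_sub_le {Ω : Type*} [MeasurableSpace Ω] {μ : Measure Ω} {A B : Set Ω}
    (hA : MeasurableSet A) (hB : MeasurableSet B) {φ : Ω → ℝ} {C : ℝ} (hC : ∀ x, |φ x| ≤ C)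
    (hφA : IntegrableOn φ A μ) (hφB : IntegrableOn φ B μ) (h_top : μ (A ∆ B) ≠ ⊤) :
    |∫ x in A, φ x ∂μ - ∫ x in B, φ x ∂μ| ≤ C * μ.real (A ∆ B) := by
  have hAB := hA.symmDiff hB
  calc |∫ x in A, φ x ∂μ - ∫ x in B, φ x ∂μ|
      = ‖∫ x, (A.indicator φ x - B.indicator φ x) ∂μ‖ := by
        rw [← integral_indicator hA, ← integral_indicator hB, ← integral_sub
          ((integrable_indicator_iff hA).2 hφA) ((integrable_indicator_iff hB).2 hφB),
          Real.norm_eq_abs]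
    _ ≤ ∫ x, (A ∆ B).indicator (fun _ => C) x ∂μ := by
        refine norm_integral_le_of_norm_le
          ((integrable_indicator_iff hAB).2 (integrableOn_const h_top)) (ae_of_all _ fun x => ?_)
        by_cases hxA : x ∈ A <;> by_cases hxB : x ∈ B <;> simp [hxA, hxB, Set.mem_symmDiff, hC x]
    _ = C * μ.real (A ∆ B) := by
        rw [integral_indicator hAB, setIntegral_const, smul_eq_mul, mul_comm]

variable {G : Type*} [Group G] [TopologicalSpace G] [T2Space G] [MeasurableSpace G] [BorelSpace G]
  {X : Type*} [MetricSpace X] [CompactSpace X] [MulAction G X] [ContinuousSMul G X]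
  {θ : Measure G} [IsFiniteMeasureOnCompacts θ] {F : ℕ → Set G}

theorem norm_avgOp_sub_avgOp_le {A B : Set G} (hA : IsCompact A) (hB : IsCompact B)
    (hAB : θ B = θ A) (f : C(X, ℝ)) :
    ‖avgOp X θ B f - avgOp X θ A f‖ ≤ ‖f‖ * (θ (A ∆ B) / θ A).toReal := by
  refine (ContinuousMap.norm_le _ (by positivity)).2 fun x => ?_
  have integrableOn {F : Set G} (hF : IsCompact F) : IntegrableOn (fun g => f (g • x)) F θ := by
    have : IsFiniteMeasure (θ.restrict F) := ⟨by simpa using hF.measure_lt_top⟩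
    exact integrable_orbit _ f x
  calc |avgOp X θ B f x - avgOp X θ A f x|
      = (θ.real A)⁻¹ * |∫ g in A, f (g • x) ∂θ - ∫ g in B, f (g • x) ∂θ| := by
        rw [avgOp_eq_inv_mul, avgOp_eq_inv_mul, measureReal_def, hAB, ← measureReal_def, ← mul_sub,
          abs_mul, abs_inv, abs_of_nonneg measureReal_nonneg, abs_sub_comm]
    _ ≤ (θ.real A)⁻¹ * (‖f‖ * θ.real (A ∆ B)) := by
        gcongr
        exact abs_setIntegral_sub_le hA.isClosed.measurableSet hB.isClosed.measurableSet
          (fun g => f.norm_coe_le_norm (g • x)) (integrableOn hA) (integrableOn hB)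
          (measure_symmDiff_ne_top hA.measure_lt_top.ne hB.measure_lt_top.ne)
    _ = ‖f‖ * (θ (A ∆ B) / θ A).toReal := by
        rw [ENNReal.toReal_div, measureReal_def, measureReal_def]
        ring

theorem tendsto_avgOp_sub_avgOp_zero {E : ℕ → Set G} (hF : ∀ n, IsCompact (F n))
    (hE : ∀ n, IsCompact (E n)) (hFE : ∀ n, θ (E n) = θ (F n))
    (hlim : Tendsto (fun n => θ (F n ∆ E n) / θ (F n)) atTop (𝓝 0)) (f : C(X, ℝ)) :
    Tendsto (fun n => avgOp X θ (E n) f - avgOp X θ (F n) f) atTop (𝓝 0) := by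
  refine squeeze_zero_norm (fun n => norm_avgOp_sub_avgOp_le (hF n) (hE n) (hFE n) f) ?_
  simpa using ((ENNReal.tendsto_toReal ENNReal.zero_ne_top).comp hlim).const_mul ‖f‖

theorem IsThickFolner.asymptoticallyInvariant [ContinuousMul G] [θ.IsMulLeftInvariant]
    (hF : IsThickFolner θ F) : AsymptoticallyInvariant X θ F := by
  intro g f
  have hlim := hF.tendsto {g} isCompact_singleton (Set.singleton_nonempty g)
  simp only [Set.singleton_mul] at hlim
  simpa only [avgOp_image_mul_left] using tendsto_avgOp_sub_avgOp_zero hF.isCompact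
    (fun n => (hF.isCompact n).image (continuous_const_mul g)) (fun n => measure_smul θ g (F n))
    hlim f

theorem IsRightThickFolner.tendsto_sub [ContinuousMul G] [θ.IsMulRightInvariant]
    (hF : IsRightThickFolner θ F) (f : C(X, ℝ)) (g : G) (x : X) :
    Tendsto (fun n => avgOp X θ (F n) f (g • x) - avgOp X θ (F n) f x) atTop (𝓝 0) := by
  have hlim := hF.tendsto {g} isCompact_singleton (Set.singleton_nonempty g)
  simp only [Set.mul_singleton] at hlim
  have hmeasure (n : ℕ) : θ ((fun h => h * g) '' F n) = θ (F n) := by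
    simpa only [ENNReal.coe_one, one_mul, Homeomorph.coe_mulRight] using
      measure_image_of_map_eq_smul (T := Homeomorph.mulRight g)
        ((map_mul_right_eq_self θ g).trans (one_smul NNReal θ).symm) (F n)
  have hsub := tendsto_avgOp_sub_avgOp_zero hF.isCompact
    (fun n => (hF.isCompact n).image (continuous_mul_const g)) hmeasure hlim f
  simpa only [Function.comp_def, ContinuousMap.sub_apply, ContinuousMap.zero_apply,
    avgOp_image_mul_right] using ((continuous_eval_const x).tendsto _).comp hsub

theorem IsRightThickFolner.continuouslyUniquelyErgodic [ContinuousMul G] [θ.IsMulRightInvariant]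
    [MeasurableSpace X] [BorelSpace X] (hG : IsAmenable G) (hF : IsRightThickFolner θ F)
    (h : FolnerWeaklyMeanEquicontinuous X θ F) : ContinuouslyUniquelyErgodic G X := by
  have h₀ (n : ℕ) : θ (F n) ≠ 0 := (hF.measure_pos n).ne'
  have h_top (n : ℕ) : θ (F n) ≠ ⊤ := (hF.isCompact n).measure_lt_top.ne
  exact (h.asymptoticallyEquicontinuous h₀ h_top).continuouslyUniquelyErgodic hG h₀ h_top
    hF.tendsto_sub

end Thick

section ThickExistence

variable {G : Type*} [Group G] [TopologicalSpace G] [IsTopologicalGroup G] [MeasurableSpace G]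
  [BorelSpace G] {θ : Measure G}

theorem IsThickFolner.image_mul_right [LocallyCompactSpace G] [θ.IsHaarMeasure] [θ.InnerRegular]
    {F : ℕ → Set G} (hF : IsThickFolner θ F) (c : ℕ → G) :
    IsThickFolner θ fun n => (fun h => h * c n) '' F n := by
  have hscale (n : ℕ) (A : Set G) :
      Measure.modularCharacterFun (c n) * θ ((fun h => h * c n) '' A) = θ A :=
    measure_image_of_map_eq_smul (T := Homeomorph.mulRight (c n))
      (Measure.map_right_mul_eq_modularCharacterFun_smul θ (c n)) A
  refine ⟨fun n => (hF.isCompact n).image (continuous_mul_const _),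
    fun n => (hF.nonempty n).image _, fun n => ?_, fun K hK hne => ?_⟩
  · have hpos := hF.measure_pos n
    rw [← hscale n] at hpos
    exact pos_of_mul_pos_right hpos bot_le
  · refine (hF.tendsto K hK hne).congr fun n => ?_
    have himage : K * (fun h => h * c n) '' F n = (fun h => h * c n) '' (K * F n) := by
      rw [← Set.mul_singleton, ← Set.mul_singleton, mul_assoc]
    have hpos := Measure.modularCharacterFun_pos (c n)
    rw [himage, ← Set.image_symmDiff (mul_left_injective (c n)), ← hscale n (F n ∆ (K * F n)),
      ← hscale n (F n), ENNReal.mul_div_mul_left _ _ (ENNReal.coe_ne_zero.2 hpos.ne')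
        ENNReal.coe_ne_top]

variable [T2Space G] [IsFiniteMeasureOnCompacts θ] [θ.IsMulLeftInvariant]

theorem measure_symmDiff_mul_le {F K L : Set G} (hF : IsCompact F) (hLK : L ⊆ K) (hL : L.Nonempty)
    (hK : (1 : G) ∈ K) {ε : ENNReal} (hKF : θ (K * F) ≤ (1 + ε) * θ F) :
    θ (F ∆ (L * F)) ≤ 2 * ε * θ F := by
  obtain ⟨k, hk⟩ := hL
  have h_top : θ F ≠ ⊤ := hF.measure_lt_top.ne
  have hmeas : MeasurableSet F := hF.isClosed.measurableSet
  have hmeas_smul : MeasurableSet (k • F) := (hF.smul k).isClosed.measurableSet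
  have hFKF : F ⊆ K * F := fun x hx => ⟨1, hK, x, hx, one_mul x⟩
  have hkF : k • F ⊆ L * F := Set.smul_set_subset_mul hk
  have houter : θ ((L * F) \ F) ≤ ε * θ F := calc
    θ ((L * F) \ F) ≤ θ ((K * F) \ F) :=
      measure_mono (Set.sdiff_subset_sdiff_left (Set.mul_subset_mul_right hLK))
    _ ≤ ε * θ F := by
      rw [measure_sdiff hFKF hmeas.nullMeasurableSet h_top, tsub_le_iff_right]
      exact hKF.trans_eq (by ring)
  have hinner : θ (F \ (L * F)) ≤ ε * θ F := calc
    θ (F \ (L * F)) ≤ θ (F \ (k • F)) := measure_mono (Set.sdiff_subset_sdiff_right hkF)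
    _ = θ ((k • F) \ F) := measure_sdiff_symm hmeas.nullMeasurableSet hmeas_smul.nullMeasurableSet
      (measure_smul θ k F).symm (measure_ne_top_of_subset Set.inter_subset_left h_top)
    _ ≤ θ ((L * F) \ F) := measure_mono (Set.sdiff_subset_sdiff_left hkF)
    _ ≤ ε * θ F := houter
  calc θ (F ∆ (L * F)) ≤ θ (F \ (L * F)) + θ ((L * F) \ F) := measure_union_le _ _
    _ ≤ ε * θ F + ε * θ F := add_le_add hinner houter
    _ = 2 * ε * θ F := by ring

end ThickExistence

section ThickAveragingClass

variable {G : Type*} [Group G] [TopologicalSpace G] [IsTopologicalGroup G] [T2Space G]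
  [LocallyCompactSpace G] [SigmaCompactSpace G] [MeasurableSpace G] [BorelSpace G]

theorem IsAmenable.exists_isThickFolner (hG : IsAmenable G) (θ : Measure G) [θ.IsHaarMeasure] :
    ∃ F, IsThickFolner θ F := by
  let K := CompactExhaustion.choice G
  let ε (n : ℕ) : ENNReal := ENNReal.ofReal (1 / ((n : ℝ) + 1))
  choose F hF h₀ hKF using fun n : ℕ => hG.exists_isCompact_measure_mul_le θ
    ((K.isCompact n).insert 1) (ε := 1 / ((n : ℝ) + 1)) (by positivity)
  refine ⟨F, hF, fun n => nonempty_of_measure_ne_zero (h₀ n), fun n => (h₀ n).bot_lt,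
    fun L hL hne => ?_⟩
  obtain ⟨N, hN⟩ := K.exists_superset_of_isCompact hL
  have hε : Tendsto (fun n => 2 * ε n) atTop (𝓝 0) := by
    have hlim := ENNReal.tendsto_ofReal tendsto_one_div_add_atTop_nhds_zero_nat
    rw [ENNReal.ofReal_zero] at hlim
    simpa [ε] using ENNReal.Tendsto.const_mul hlim (a := 2) (Or.inr ENNReal.ofNat_ne_top)
  refine tendsto_of_tendsto_of_tendsto_of_le_of_le' tendsto_const_nhds hε
    (Eventually.of_forall fun n => bot_le) ?_
  filter_upwards [eventually_ge_atTop N] with n hn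
  rw [ENNReal.div_le_iff (h₀ n) (hF n).measure_lt_top.ne]
  refine measure_symmDiff_mul_le (hF n)
    ((hN.trans (K.subset hn)).trans (Set.subset_insert _ _)) hne (Set.mem_insert _ _) ?_
  simpa only [ENNReal.ofReal_add zero_le_one (Nat.one_div_pos_of_nat (α := ℝ) (n := n)).le,
    ENNReal.ofReal_one] using hKF n

theorem isAveragingClass_isThickFolner {X : Type*} [MetricSpace X] [CompactSpace X] [MulAction G X]
    [ContinuousSMul G X] (hG : IsAmenable G) (θ : Measure G) [θ.IsHaarMeasure] [θ.InnerRegular] :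
    IsAveragingClass X θ (IsThickFolner θ) where
  ne_zero _ hF n := (hF.measure_pos n).ne'
  ne_top _ hF n := (hF.isCompact n).measure_lt_top.ne
  asymptoticallyInvariant _ hF := hF.asymptoticallyInvariant
  translate _ hF c := hF.image_mul_right c
  avgOp_translate F _ n c := avgOp_image_mul_right_of_map_eq_smul
    (Measure.modularCharacterFun_pos c).ne'
    (Measure.map_right_mul_eq_modularCharacterFun_smul θ c) (F n)
  nonempty := hG.exists_isThickFolner θ

end ThickAveragingClass

section Matching

theorem exists_ncard_eq_sSup {α : Type*} {F : Set α} (hF : F.Finite) {p : Set α → Prop}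
    (hp : p ∅) :
    ∃ M ⊆ F, M.ncard = sSup {k | ∃ M, M ⊆ F ∧ M.ncard = k ∧ p M} ∧ p M := by
  obtain ⟨M, hM, hcard, hpM⟩ := Nat.sSup_mem (s := {k | ∃ M, M ⊆ F ∧ M.ncard = k ∧ p M})
    ⟨0, ∅, Set.empty_subset F, Set.ncard_empty α, hp⟩
    ⟨F.ncard, by rintro _ ⟨M, hM, rfl, -⟩; exact Set.ncard_le_ncard hM hF⟩
  exact ⟨M, hM, hcard, hpM⟩

variable {G : Type*} [Group G]

theorem exists_eq_matchingNumber {F : Set G} (hF : F.Finite) (V E : Set G) :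
    ∃ M ⊆ F, M.ncard = matchingNumber V F E ∧
      ∃ φ : G → G, Set.InjOn φ M ∧ Set.MapsTo φ M E ∧ ∀ f ∈ M, ∃ v ∈ V, φ f = v * f :=
  exists_ncard_eq_sSup hF ⟨id, Set.injOn_empty _, Set.mapsTo_empty _ _, by simp⟩

theorem exists_eq_rightMatchingNumber {F : Set G} (hF : F.Finite) (V E : Set G) :
    ∃ M ⊆ F, M.ncard = rightMatchingNumber V F E ∧
      ∃ φ : G → G, Set.InjOn φ M ∧ Set.MapsTo φ M E ∧ ∀ f ∈ M, ∃ v ∈ V, φ f = f * v :=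
  exists_ncard_eq_sSup hF ⟨id, Set.injOn_empty _, Set.mapsTo_empty _ _, by simp⟩

theorem matchingNumber_div_ncard_le_one {F : Set G} (hF : F.Finite) (V E : Set G) :
    (matchingNumber V F E : ℝ) / F.ncard ≤ 1 := by
  obtain ⟨M, hM, hcard, -⟩ := exists_eq_matchingNumber hF V E
  exact div_le_one_of_le₀ (mod_cast hcard ▸ Set.ncard_le_ncard hM hF) (Nat.cast_nonneg _)

theorem ncard_le_matchingNumber {F : Set G} (hF : F.Finite) {V E M : Set G} (hM : M ⊆ F)
    {φ : G → G} (hφ : Set.InjOn φ M) (hE : Set.MapsTo φ M E)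
    (hV : ∀ f ∈ M, ∃ v ∈ V, φ f = v * f) : M.ncard ≤ matchingNumber V F E :=
  le_csSup ⟨F.ncard, by rintro _ ⟨M, hM, rfl, -⟩; exact Set.ncard_le_ncard hM hF⟩
    ⟨M, hM, rfl, φ, hφ, hE, hV⟩

theorem matchingNumber_le_image_mul_right {F : Set G} (hF : F.Finite) (V E : Set G) (c : G) :
    matchingNumber V F E ≤
      matchingNumber V ((fun h => h * c) '' F) ((fun h => h * c) '' E) := by
  obtain ⟨M, hM, hcard, φ, hφ, hE, hV⟩ := exists_eq_matchingNumber hF V E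
  rw [← hcard, ← Set.ncard_image_of_injective M (mul_left_injective c)]
  refine ncard_le_matchingNumber (hF.image _) (Set.image_mono hM)
    (φ := fun y => φ (y * c⁻¹) * c) ?_ ?_ ?_
  · rintro _ ⟨a, ha, rfl⟩ _ ⟨b, hb, rfl⟩ hab
    simp only [mul_inv_cancel_right, mul_left_inj] at hab ⊢
    exact hφ ha hb hab
  · rintro _ ⟨a, ha, rfl⟩
    simp only [mul_inv_cancel_right]
    exact ⟨_, hE ha, rfl⟩
  · rintro _ ⟨a, ha, rfl⟩
    obtain ⟨v, hv, hva⟩ := hV a ha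
    exact ⟨v, hv, by rw [mul_inv_cancel_right, hva, mul_assoc]⟩

theorem abs_sum_sub_sum_le_of_matching {α : Type*} {A B : Finset α} {M : Set α}
    (hAB : B.card = A.card) (hM : M ⊆ A) {φ : α → α} (hφ : Set.InjOn φ M)
    (hφB : Set.MapsTo φ M B) {u : α → ℝ} {C ε : ℝ} (hε : 0 ≤ ε) (hC : ∀ a, |u a| ≤ C)
    (hu : ∀ a ∈ M, |u (φ a) - u a| ≤ ε) :
    |∑ b ∈ B, u b - ∑ a ∈ A, u a| ≤ ε * A.card + 2 * C * (A.card - M.ncard) := by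
  classical
  lift M to Finset α using A.finite_toSet.subset hM
  rw [Finset.coe_subset] at hM
  rw [Set.ncard_coe_finset]
  have himage : M.image φ ⊆ B := Finset.image_subset_iff.2 hφB
  have abs_sum_le {S : Finset α} {v : α → ℝ} {c : ℝ} (hv : ∀ a ∈ S, |v a| ≤ c) :
      |∑ a ∈ S, v a| ≤ c * S.card :=
    (Finset.abs_sum_le_sum_abs _ _).trans
      ((Finset.sum_le_card_nsmul _ _ _ hv).trans_eq (by rw [nsmul_eq_mul, mul_comm]))
  have h_matched : |∑ a ∈ M, (u (φ a) - u a)| ≤ ε * A.card :=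
    (abs_sum_le hu).trans (by gcongr)
  have h_unmatchedB : |∑ b ∈ B \ M.image φ, u b| ≤ C * (A.card - M.card) := by
    simpa only [Finset.cast_card_sdiff himage, Finset.card_image_of_injOn hφ, hAB] using
      abs_sum_le fun b (_ : b ∈ B \ M.image φ) => hC b
  have h_unmatchedA : |∑ a ∈ A \ M, u a| ≤ C * (A.card - M.card) := by
    simpa only [Finset.cast_card_sdiff hM] using abs_sum_le fun a (_ : a ∈ A \ M) => hC a
  calc |∑ b ∈ B, u b - ∑ a ∈ A, u a|
      = |∑ a ∈ M, (u (φ a) - u a) + ∑ b ∈ B \ M.image φ, u b - ∑ a ∈ A \ M, u a| := by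
        rw [← Finset.sum_sdiff himage, ← Finset.sum_sdiff hM, Finset.sum_image hφ,
          Finset.sum_sub_distrib]
        congr 1
        ring
    _ ≤ |∑ a ∈ M, (u (φ a) - u a)| + |∑ b ∈ B \ M.image φ, u b| + |∑ a ∈ A \ M, u a| :=
        (abs_sub _ _).trans (by gcongr; exact abs_add_le _ _)
    _ ≤ ε * A.card + 2 * C * (A.card - M.card) := by linarith

theorem abs_avg_sub_avg_le_of_matching {α : Type*} {A B : Finset α} {M : Set α}
    (hA : A.Nonempty) (hAB : B.card = A.card) (hM : M ⊆ A) {φ : α → α} (hφ : Set.InjOn φ M)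
    (hφB : Set.MapsTo φ M B) {u : α → ℝ} {C ε : ℝ} (hε : 0 ≤ ε) (hC : ∀ a, |u a| ≤ C)
    (hu : ∀ a ∈ M, |u (φ a) - u a| ≤ ε) :
    |(B.card : ℝ)⁻¹ * ∑ b ∈ B, u b - (A.card : ℝ)⁻¹ * ∑ a ∈ A, u a|
      ≤ ε + 2 * C * (1 - M.ncard / A.card) := by
  have hpos : (0 : ℝ) < A.card := by exact_mod_cast hA.card_pos
  rw [hAB, ← mul_sub, abs_mul, abs_of_pos (inv_pos.2 hpos), inv_mul_le_iff₀ hpos]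
  refine (abs_sum_sub_sum_le_of_matching hAB hM hφ hφB hε hC hu).trans_eq ?_
  field_simp

theorem eventually_add_mul_one_sub_lt {r : ℕ → ℝ} (hr : Tendsto r atTop (𝓝 1)) (C : ℝ) {ε δ : ℝ}
    (hεδ : ε < δ) : ∀ᶠ n in atTop, ε + C * (1 - r n) < δ := by
  refine (((hr.const_sub 1).const_mul C).const_add ε).eventually_lt_const ?_
  simpa using hεδ

end Matching

section Thin

variable {G : Type*} [Group G] [TopologicalSpace G] [MeasurableSpace G] [BorelSpace G]
  {X : Type*} [MetricSpace X] [CompactSpace X] [MulAction G X] [ContinuousSMul G X]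

section

variable [MeasurableSingletonClass G]

theorem avgOp_count (A : Finset G) (f : C(X, ℝ)) (x : X) :
    avgOp X Measure.count (A : Set G) f x = (A.card : ℝ)⁻¹ * ∑ h ∈ A, f (h • x) := by
  have hinteg : IntegrableOn (fun g => f (g • x)) (A : Set G) Measure.count := by
    have : IsFiniteMeasure ((Measure.count : Measure G).restrict (A : Set G)) := ⟨by simp⟩
    exact integrable_orbit _ f x
  rw [avgOp_eq_inv_mul, setIntegral_finset _ (hf := hinteg)]
  simp [measureReal_def]

theorem norm_avgOp_count_sub_le {V E F : Set G} (hF : F.Finite) (hne : F.Nonempty)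
    (hE : E.Finite) (hFE : E.ncard = F.ncard) (f : C(X, ℝ)) {ε : ℝ} (hε : 0 ≤ ε)
    (hV : ∀ v ∈ V, ∀ x, |f (v • x) - f x| ≤ ε) :
    ‖avgOp X Measure.count E f - avgOp X Measure.count F f‖
      ≤ ε + 2 * ‖f‖ * (1 - matchingNumber V F E / F.ncard) := by
  have h_le : (0 : ℝ) ≤ 1 - matchingNumber V F E / F.ncard :=
    sub_nonneg.2 (matchingNumber_div_ncard_le_one hF V E)
  obtain ⟨M, hM, hcard, φ, hφ, hφE, hφV⟩ := exists_eq_matchingNumber hF V E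
  lift F to Finset G using hF
  lift E to Finset G using hE
  rw [Set.ncard_coe_finset, Set.ncard_coe_finset] at hFE
  refine (ContinuousMap.norm_le _ (by positivity)).2 fun x => ?_
  rw [ContinuousMap.sub_apply, avgOp_count, avgOp_count, ← hcard, Set.ncard_coe_finset]
  refine abs_avg_sub_avg_le_of_matching hne hFE hM hφ hφE hε
    (fun h => f.norm_coe_le_norm (h • x)) fun h hh => ?_
  obtain ⟨v, hv, hvh⟩ := hφV h hh
  simpa only [hvh, mul_smul] using hV v hv (h • x)

theorem tendsto_avgOp_count_sub_zero {E F : ℕ → Set G} (hF : ∀ n, (F n).Finite)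
    (hne : ∀ n, (F n).Nonempty) (hE : ∀ n, (E n).Finite) (hFE : ∀ n, (E n).ncard = (F n).ncard)
    (h : ∀ V : Set G, IsOpen V → (1 : G) ∈ V →
      Tendsto (fun n => (matchingNumber V (F n) (E n) : ℝ) / (F n).ncard) atTop (𝓝 1))
    (f : C(X, ℝ)) :
    Tendsto (fun n => avgOp X Measure.count (E n) f - avgOp X Measure.count (F n) f)
      atTop (𝓝 0) := by
  refine Metric.tendsto_nhds.2 fun ε hε => ?_
  obtain ⟨V, hV, hVo, hV₁⟩ := mem_nhds_iff.1
    (eventually_forall_abs_smul_sub_lt (G := G) f (half_pos hε))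
  filter_upwards [eventually_add_mul_one_sub_lt (h V hVo hV₁) (2 * ‖f‖) (half_lt_self hε)]
    with n hn
  rw [dist_zero_right]
  exact (norm_avgOp_count_sub_le (hF n) (hne n) (hE n) (hFE n) f (half_pos hε).le
    fun v hv x => (hV hv x).le).trans_lt hn

variable {F : ℕ → Set G} [ContinuousMul G]

theorem IsThinFolner.asymptoticallyInvariant (hF : IsThinFolner F) :
    AsymptoticallyInvariant X Measure.count F := by
  intro g f
  simpa only [avgOp_image_mul_left] using
    tendsto_avgOp_count_sub_zero hF.finite hF.nonempty (fun n => (hF.finite n).image _)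
      (fun n => Set.ncard_image_of_injective _ (mul_right_injective g)) (hF.tendsto g) f

theorem IsRightThinFolner.tendsto_sub (hF : IsRightThinFolner F) (f : C(X, ℝ)) (g : G) (x : X) :
    Tendsto (fun n => avgOp X Measure.count (F n) f (g • x) - avgOp X Measure.count (F n) f x)
      atTop (𝓝 0) := by
  have hsub := tendsto_avgOp_count_sub_zero (X := X) hF.finite hF.nonempty
    (fun n => (hF.finite n).image _)
    (fun n => Set.ncard_image_of_injective _ (mul_left_injective g)) (hF.tendsto g) f
  simpa only [Function.comp_def, ContinuousMap.sub_apply, ContinuousMap.zero_apply,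
    avgOp_image_mul_right] using ((continuous_eval_const x).tendsto _).comp hsub

theorem IsRightThinFolner.continuouslyUniquelyErgodic [MeasurableSpace X] [BorelSpace X]
    (hG : IsAmenable G) (hF : IsRightThinFolner F)
    (h : FolnerWeaklyMeanEquicontinuous X Measure.count F) : ContinuouslyUniquelyErgodic G X := by
  have h₀ (n : ℕ) : Measure.count (F n) ≠ 0 := Measure.count_ne_zero (hF.nonempty n)
  have h_top (n : ℕ) : Measure.count (F n) ≠ ⊤ := (Measure.count_apply_lt_top.2 (hF.finite n)).ne
  exact (h.asymptoticallyEquicontinuous h₀ h_top).continuouslyUniquelyErgodic hG h₀ h_top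
    hF.tendsto_sub

end

theorem IsThinFolner.image_mul_right {G : Type*} [Group G] [TopologicalSpace G] {F : ℕ → Set G}
    (hF : IsThinFolner F) (c : ℕ → G) : IsThinFolner fun n => (fun h => h * c n) '' F n := by
  refine ⟨fun n => (hF.finite n).image _, fun n => (hF.nonempty n).image _, fun g V hV hV₁ => ?_⟩
  refine tendsto_of_tendsto_of_tendsto_of_le_of_le (hF.tendsto g V hV hV₁) tendsto_const_nhds
    (fun n => ?_) (fun n => matchingNumber_div_ncard_le_one ((hF.finite n).image _) _ _)
  have hcomm : (fun h => g * h) '' ((fun h => h * c n) '' F n) =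
      (fun h => h * c n) '' ((fun h => g * h) '' F n) := by
    simp only [Set.image_image, mul_assoc]
  rw [hcomm, Set.ncard_image_of_injective _ (mul_left_injective (c n))]
  gcongr
  exact matchingNumber_le_image_mul_right (hF.finite n) _ _ _

theorem isAveragingClass_isThinFolner [MeasurableSingletonClass G] [ContinuousMul G]
    (h : ∃ F : ℕ → Set G, IsThinFolner F) :
    IsAveragingClass X (Measure.count : Measure G) IsThinFolner where
  ne_zero _ hF n := Measure.count_ne_zero (hF.nonempty n)
  ne_top _ hF n := (Measure.count_apply_lt_top.2 (hF.finite n)).ne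
  asymptoticallyInvariant _ hF := hF.asymptoticallyInvariant
  translate _ hF c := hF.image_mul_right c
  avgOp_translate F _ n c f x := avgOp_image_mul_right c (F n) f x
  nonempty := h

end Thin

section Combinatorics

-- Hall's theorem for the relation in which `D` extra elements of the target are related to all.
theorem exists_injOn_of_card_le_add {α β : Type*} [Fintype α] [Fintype β] [Nonempty β]
    (r : α → β → Prop) [DecidableRel r] (D : ℕ)
    (hr : ∀ A : Finset α, A.card ≤ (Finset.univ.filter fun b => ∃ a ∈ A, r a b).card + D) :
    ∃ (M : Finset α) (σ : α → β), Set.InjOn σ M ∧ (∀ a ∈ M, r a (σ a)) ∧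
      Fintype.card α ≤ M.card + D := by
  classical
  let r' (a : α) : β ⊕ Fin D → Prop := Sum.elim (r a) fun _ => True
  have hHall (A : Finset α) : A.card ≤ (Finset.univ.filter fun b => ∃ a ∈ A, r' a b).card := by
    rcases A.eq_empty_or_nonempty with rfl | ⟨a, ha⟩
    · simp
    · refine (hr A).trans ?_
      calc _ = ((Finset.univ.filter fun b => ∃ a ∈ A, r a b).disjSum
            (Finset.univ : Finset (Fin D))).card := by rw [Finset.card_disjSum, Finset.card_fin]
        _ ≤ _ := Finset.card_le_card fun c hc => by
          rcases c with b | d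
          · simpa [r'] using hc
          · simpa [r'] using ⟨a, ha⟩
  obtain ⟨φ, hφ, hφr⟩ := (Fintype.all_card_le_filter_rel_iff_exists_injective r').1 hHall
  let σ (a : α) : β := (φ a).elim id fun _ => Classical.ofNonempty
  let M := Finset.univ.filter fun a => (φ a).isLeft = true
  have hM {a : α} (ha : a ∈ M) : φ a = Sum.inl (σ a) := by
    obtain ⟨b, hb⟩ := Sum.isLeft_iff.1 (Finset.mem_filter.1 ha).2
    simp only [σ, hb, Sum.elim_inl, id]
  refine ⟨M, σ, fun a ha b hb hab => hφ ?_, fun a ha => ?_, ?_⟩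
  · rw [hM ha, hM hb, hab]
  · have hra := hφr a
    rwa [hM ha] at hra
  · have hright : (Finset.univ.filter fun a => ¬ (φ a).isLeft = true).card ≤ D := calc
      _ ≤ ((Finset.univ : Finset (Fin D)).map .inr : Finset (β ⊕ Fin D)).card := by
        refine Finset.card_le_card_of_injOn φ (fun a ha => ?_) hφ.injOn
        obtain ⟨d, hd⟩ := Sum.isRight_iff.1 (Sum.not_isLeft.1 (Finset.mem_filter.1 ha).2)
        exact hd ▸ Finset.mem_coe.2 (Finset.mem_map_of_mem _ (Finset.mem_univ d))
      _ = D := by simp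
    have hsplit : M.card + _ = _ := Finset.card_filter_add_card_filter_not _
    rw [Finset.card_univ] at hsplit
    omega

theorem exists_nat_weights {α : Type*} {t : Finset α} {w : α → ℝ} (hw : ∀ x ∈ t, 0 ≤ w x)
    (hw_one : ∑ x ∈ t, w x = 1) {ε : ℝ} (hε : 0 < ε) :
    ∃ n : α → ℕ, 0 < ∑ x ∈ t, n x ∧
      ∑ x ∈ t, |n x - (∑ y ∈ t, n y : ℕ) * w x| ≤ ε * (∑ x ∈ t, n x : ℕ) := by
  obtain ⟨N, hN⟩ := exists_nat_gt (2 * t.card / ε + t.card : ℝ)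
  let n (x : α) : ℕ := ⌊N * w x⌋₊
  have h_round : ∀ x ∈ t, |n x - N * w x| ≤ 1 := fun x hx => by
    have h_le := Nat.floor_le (mul_nonneg N.cast_nonneg (hw x hx))
    have h_lt := Nat.lt_floor_add_one (N * w x)
    exact abs_le.2 ⟨by linarith, by linarith⟩
  have h_sum_round : ∑ x ∈ t, |n x - N * w x| ≤ t.card := by
    simpa using Finset.sum_le_sum h_round
  have h_total : |(N : ℝ) - (∑ x ∈ t, n x : ℕ)| ≤ t.card := calc
    |(N : ℝ) - (∑ x ∈ t, n x : ℕ)| = |∑ x ∈ t, (n x - N * w x)| := by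
      rw [Finset.sum_sub_distrib, ← Finset.mul_sum, hw_one, mul_one, abs_sub_comm, Nat.cast_sum]
    _ ≤ t.card := (Finset.abs_sum_le_sum_abs _ _).trans h_sum_round
  have h_ge : N - t.card ≤ ((∑ x ∈ t, n x : ℕ) : ℝ) := by linarith [(abs_le.1 h_total).2]
  have h_large : 2 * t.card ≤ ε * (N - t.card) := by
    rw [← div_le_iff₀' hε]
    linarith
  refine ⟨n, ?_, ?_⟩
  · have h_quot : (0 : ℝ) ≤ 2 * t.card / ε := by positivity
    exact_mod_cast (by linarith : (0 : ℝ) < N - t.card).trans_le h_ge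
  · calc ∑ x ∈ t, |n x - (∑ y ∈ t, n y : ℕ) * w x|
        ≤ ∑ x ∈ t, (|n x - N * w x| + t.card * w x) := Finset.sum_le_sum fun x hx => by
          rw [show n x - (∑ y ∈ t, n y : ℕ) * w x =
            n x - N * w x + (N - (∑ y ∈ t, n y : ℕ)) * w x by ring]
          refine (abs_add_le _ _).trans ?_
          rw [abs_mul, abs_of_nonneg (hw x hx)]
          gcongr
          exact hw x hx
      _ ≤ t.card + t.card := by
          rw [Finset.sum_add_distrib, ← Finset.mul_sum, hw_one, mul_one]
          gcongr
      _ ≤ ε * (N - t.card) := by linarith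
      _ ≤ ε * (∑ x ∈ t, n x : ℕ) := by gcongr

end Combinatorics

section FiniteMatching

variable {G : Type*} [Group G]

theorem exists_injOn_of_almost_invariant {J : Type*} [Fintype J] [Nonempty J] {V : Set G}
    {f : Set G → G → ℝ} (hf : ∀ S y, f S y ∈ Set.Icc (0 : ℝ) 1) (hf_one : ∀ S, ∀ y ∈ S, f S y = 1)
    (hfV : ∀ S y, f S y ≠ 0 → y ∈ V * S) {q : J → G} {g : G} {ε : ℝ} (hε : 0 ≤ ε)
    (hq : ∀ S, |∑ j, (f S (g * q j) - f S (q j))| ≤ ε * Fintype.card J) :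
    ∃ (M : Finset J) (σ : J → J), Set.InjOn σ M ∧
      (∀ i ∈ M, ∃ v ∈ V, g * q (σ i) = v * q i) ∧ (1 - ε) * Fintype.card J ≤ M.card := by
  classical
  have hHall (A : Finset J) : A.card ≤ (Finset.univ.filter fun j =>
      ∃ i ∈ A, ∃ v ∈ V, g * q j = v * q i).card + ⌊ε * Fintype.card J⌋₊ := by
    let S := q '' A
    let B := Finset.univ.filter fun j => ∃ i ∈ A, ∃ v ∈ V, g * q j = v * q i
    have hA : (A.card : ℝ) ≤ ∑ j, f S (q j) := calc
      (A.card : ℝ) = ∑ j ∈ A, f S (q j) := by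
        simp [Finset.sum_congr rfl fun j hj => hf_one S (q j) ⟨j, hj, rfl⟩]
      _ ≤ ∑ j, f S (q j) := Finset.sum_le_sum_of_subset_of_nonneg (Finset.subset_univ _)
        fun j _ _ => (hf S (q j)).1
    have hB : ∑ j, f S (g * q j) ≤ B.card := calc
      ∑ j, f S (g * q j) = ∑ j ∈ B, f S (g * q j) := by
        refine (Finset.sum_subset (Finset.subset_univ B) fun j _ hj => ?_).symm
        by_contra hne
        obtain ⟨v, hv, _, ⟨i, hi, rfl⟩, hvi⟩ := hfV S _ hne
        exact hj (Finset.mem_filter.2 ⟨Finset.mem_univ j, i, hi, v, hv, hvi.symm⟩)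
      _ ≤ B.card := by simpa using Finset.sum_le_sum fun j (_ : j ∈ B) => (hf S (g * q j)).2
    have hAB := (abs_le.1 (hq S)).1
    rw [Finset.sum_sub_distrib] at hAB
    rw [add_comm, ← Nat.floor_add_natCast (by positivity)]
    exact Nat.le_floor (by linarith)
  obtain ⟨M, σ, hσ, hσV, hM⟩ := exists_injOn_of_card_le_add _ _ hHall
  refine ⟨M, σ, hσ, hσV, ?_⟩
  have hM' : (Fintype.card J : ℝ) ≤ M.card + ⌊ε * Fintype.card J⌋₊ := mod_cast hM
  have hfloor : (⌊ε * Fintype.card J⌋₊ : ℝ) ≤ ε * Fintype.card J := Nat.floor_le (by positivity)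
  linarith

theorem card_le_matchingNumber_range_mul {J : Type*} [Finite J] {U V : Set G}
    (hUV : ∀ a ∈ U, ∀ b ∈ U, ∀ c ∈ U, a * b * c⁻¹ ∈ V) {q v : J → G} {g : G} (hv : ∀ j, v j ∈ U)
    (hgv : ∀ j, g * v j * g⁻¹ ∈ U) (hinj : Function.Injective fun j => v j * q j) {M : Finset J}
    {σ : J → J} (hσ : Set.InjOn σ M) (hσU : ∀ i ∈ M, ∃ u ∈ U, g * q (σ i) = u * q i) :
    M.card ≤ matchingNumber V (Set.range fun j => v j * q j)
      ((fun h => g * h) '' Set.range fun j => v j * q j) := by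
  let r (j : J) : G := v j * q j
  let φ : G → G := Function.extend r (fun i => g * r (σ i)) 1
  have hφ (i : J) : φ (r i) = g * r (σ i) := Function.Injective.extend_apply hinj _ _ i
  rw [← Set.ncard_coe_finset, ← Set.ncard_image_of_injective _ hinj]
  refine ncard_le_matchingNumber (Set.finite_range r) (Set.image_subset_range _ _) (φ := φ) ?_ ?_ ?_
  · rintro _ ⟨i, hi, rfl⟩ _ ⟨j, hj, rfl⟩ hij
    rw [hφ, hφ, mul_right_inj] at hij
    rw [hσ hi hj (hinj hij)]
  · rintro _ ⟨i, _, rfl⟩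
    exact ⟨r (σ i), ⟨σ i, rfl⟩, (hφ i).symm⟩
  · rintro _ ⟨i, hi, rfl⟩
    obtain ⟨u, hu, hui⟩ := hσU i hi
    refine ⟨_, hUV _ (hgv (σ i)) _ hu _ (hv i), (hφ i).trans ?_⟩
    calc g * (v (σ i) * q (σ i)) = g * v (σ i) * g⁻¹ * (g * q (σ i)) := by group
      _ = g * v (σ i) * g⁻¹ * u * (v i)⁻¹ * (v i * q i) := by rw [hui]; group

theorem matchingNumber_le_mul_left {F : Set G} (hF : F.Finite) {V W : Set G} (g k : G)
    (hkV : ∀ v ∈ V, k * v ∈ W) :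
    matchingNumber V F ((fun h => g * h) '' F) ≤
      matchingNumber W F ((fun h => k * g * h) '' F) := by
  obtain ⟨M, hM, hcard, φ, hφ, hE, hV⟩ := exists_eq_matchingNumber hF V ((fun h => g * h) '' F)
  rw [← hcard]
  refine ncard_le_matchingNumber hF hM (φ := fun y => k * φ y)
    (fun a ha b hb hab => hφ ha hb (mul_left_cancel hab)) (fun a ha => ?_) fun a ha => ?_
  · obtain ⟨b, hb, hba⟩ := hE ha
    exact ⟨b, hb, by simp only [← hba, mul_assoc]⟩
  · obtain ⟨v, hv, hva⟩ := hV a ha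
    exact ⟨k * v, hkV v hv, by rw [hva, mul_assoc]⟩

variable [TopologicalSpace G]

theorem exists_injective_mul_mem [T1Space G] [(𝓝[≠] (1 : G)).NeBot] {J : Type*} [Finite J]
    (q : J → G) {V : Set G} (hV : V ∈ 𝓝 (1 : G)) :
    ∃ v : J → G, (∀ j, v j ∈ V) ∧ Function.Injective fun j => v j * q j := by
  classical
  have := Fintype.ofFinite J
  obtain ⟨T, hTV, hT⟩ := (infinite_of_mem_nhds 1 hV).exists_subset_card_eq (Fintype.card J)
  have hHall (A : Finset J) :
      A.card ≤ (A.biUnion fun j => T.image fun v => v * q j).card := by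
    rcases A.eq_empty_or_nonempty with rfl | ⟨j, hj⟩
    · simp
    calc A.card ≤ T.card := hT ▸ Finset.card_le_univ A
      _ = (T.image fun v => v * q j).card :=
        (Finset.card_image_of_injective _ (mul_left_injective (q j))).symm
      _ ≤ _ := Finset.card_le_card
        (Finset.subset_biUnion_of_mem (fun j => T.image fun v => v * q j) hj)
  obtain ⟨φ, hφ, hφT⟩ := (Finset.all_card_le_biUnion_card_iff_exists_injective _).1 hHall
  refine ⟨fun j => φ j * (q j)⁻¹, fun j => ?_, by simpa using hφ⟩
  obtain ⟨v, hv, hvj⟩ := Finset.mem_image.1 (hφT j)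
  simp only [← hvj, mul_inv_cancel_right]
  exact hTV hv

theorem IsAmenable.exists_uniform_almost_invariant [ContinuousMul G] (hG : IsAmenable G)
    {I : Type*} {f : I → G → ℝ}
    (hf_le : ∀ i x, |f i x| ≤ 1)
    (hf : ∀ ε > 0, ∀ᶠ u in 𝓝 (1 : G), ∀ i x, |f i (u * x) - f i x| < ε)
    (E : Finset G) {ε : ℝ} (hε : 0 < ε) :
    ∃ (m : ℕ) (_ : NeZero m) (q : Fin m → G),
      ∀ g ∈ E, ∀ i, |∑ j, (f i (g * q j) - f i (q j))| ≤ ε * m := by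
  obtain ⟨t, w, hw, hw_one, hwE⟩ := hG.exists_almost_invariant f hf_le hf E (half_pos hε)
  obtain ⟨n, hn_pos, hn⟩ := exists_nat_weights hw hw_one (ε := ε / 4) (by positivity)
  set m := ∑ x ∈ t, n x with hm
  have hcard : Fintype.card (Σ x : t, Fin (n x)) = m := by
    simp only [Fintype.card_sigma, Fintype.card_fin, Finset.sum_coe_sort t n, hm]
  let e := (Fintype.equivFinOfCardEq hcard).symm
  refine ⟨m, ⟨hn_pos.ne'⟩, fun j => (e j).1, fun g hg i => ?_⟩
  let a (x : G) : ℝ := f i (g * x) - f i x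
  have ha (x : G) : |a x| ≤ 2 :=
    (abs_sub _ _).trans ((add_le_add (hf_le i _) (hf_le i _)).trans_eq one_add_one_eq_two)
  have hsum : ∑ j, a (e j).1 = ∑ x ∈ t, n x * a x := by
    rw [e.sum_comp fun j => a j.1, Fintype.sum_sigma]
    simp only [Finset.sum_const, Finset.card_univ, Fintype.card_fin, nsmul_eq_mul]
    exact Finset.sum_coe_sort t fun x => n x * a x
  calc |∑ j, a (e j).1| = |∑ x ∈ t, (n x - m * w x) * a x + m * ∑ x ∈ t, w x * a x| := by
        rw [hsum, Finset.mul_sum, ← Finset.sum_add_distrib]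
        congr! 2 with x
        ring
    _ ≤ (∑ x ∈ t, |n x - m * w x|) * 2 + m * (ε / 2) := by
        refine (abs_add_le _ _).trans (add_le_add ?_ ?_)
        · refine (Finset.abs_sum_le_sum_abs _ _).trans ?_
          rw [Finset.sum_mul]
          gcongr with x
          rw [abs_mul]
          gcongr
          exact ha x
        · rw [abs_mul, Nat.abs_cast]
          gcongr
          exact hwE g hg i
    _ ≤ ε * m := by linarith

variable [IsTopologicalGroup G]

theorem exists_equicontinuous_separating [FirstCountableTopology G] {V : Set G}
    (hV : V ∈ 𝓝 (1 : G)) :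
    ∃ f : Set G → G → ℝ, (∀ S y, f S y ∈ Set.Icc (0 : ℝ) 1) ∧ (∀ S, ∀ y ∈ S, f S y = 1) ∧
      (∀ S y, f S y ≠ 0 → y ∈ V * S) ∧
      ∀ ε > 0, ∀ᶠ u in 𝓝 (1 : G), ∀ S y, |f S (u * y) - f S y| < ε := by
  let _ : UniformSpace G := IsTopologicalGroup.rightUniformSpace G
  have : (uniformity G).IsCountablyGenerated :=
    inferInstanceAs (comap (fun p : G × G => p.2 * p.1⁻¹) (𝓝 (1 : G))).IsCountablyGenerated
  let _ : PseudoMetricSpace G := UniformSpace.pseudoMetricSpace G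
  have huniformity : uniformity G = comap (fun p : G × G => p.2 * p.1⁻¹) (𝓝 (1 : G)) := rfl
  obtain ⟨r, hr, hrV⟩ := Metric.mem_uniformity_dist.1
    (huniformity ▸ preimage_mem_comap hV : {p : G × G | p.2 * p.1⁻¹ ∈ V} ∈ uniformity G)
  refine ⟨fun S y => thickenedIndicator hr S y,
    fun S y => ⟨NNReal.coe_nonneg _, mod_cast thickenedIndicator_le_one hr S y⟩,
    fun S y hy => by simp [thickenedIndicator_one hr S hy], fun S y hne => ?_, fun ε hε => ?_⟩
  · have hy : y ∈ Metric.thickening r S := by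
      by_contra hy
      exact hne (by simp [thickenedIndicator_zero hr S hy])
    obtain ⟨s, hs, hys⟩ := Metric.mem_thickening_iff.1 hy
    exact ⟨y * s⁻¹, hrV (dist_comm y s ▸ hys), s, hs, inv_mul_cancel_right y s⟩
  · obtain ⟨U, hU, hUdist⟩ := mem_comap.1
      (huniformity ▸ Metric.dist_mem_uniformity (α := G) (mul_pos hr hε))
    filter_upwards [hU] with u hu S y
    have hdist : dist y (u * y) < r * ε := hUdist (a := (y, u * y)) (by simpa using hu)
    have hlip := (lipschitzWith_thickenedIndicator hr S).dist_le_mul (u * y) y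
    rw [NNReal.coe_inv, Real.coe_toNNReal _ hr.le, dist_comm (u * y) y, NNReal.dist_eq] at hlip
    exact hlip.trans_lt ((inv_mul_lt_iff₀ hr).2 hdist)

theorem exists_nhds_one_mul_mul_inv_mem {V : Set G} (hV : V ∈ 𝓝 (1 : G)) :
    ∃ U ∈ 𝓝 (1 : G), ∀ a ∈ U, ∀ b ∈ U, ∀ c ∈ U, a * b * c⁻¹ ∈ V := by
  obtain ⟨U, hU, hUV⟩ := exists_nhds_one_split4 hV
  refine ⟨U ∩ U⁻¹, inter_mem hU (inv_mem_nhds_one G hU), fun a ha b hb c hc => ?_⟩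
  simpa only [mul_one] using hUV ha.1 hb.1 hc.2 (mem_of_mem_nhds hU)

-- Hall's theorem applies to a finite family of points that may repeat; a perturbation then makes
-- the points distinct.
theorem IsAmenable.exists_finite_matching_of_neBot (hG : IsAmenable G) [T1Space G]
    [FirstCountableTopology G] [(𝓝[≠] (1 : G)).NeBot] (E : Finset G) {V : Set G}
    (hV : V ∈ 𝓝 (1 : G)) {ε : ℝ} (hε : 0 < ε) :
    ∃ F : Set G, F.Finite ∧ F.Nonempty ∧ ∀ g ∈ E,
      (1 - ε) * F.ncard ≤ matchingNumber V F ((fun h => g * h) '' F) := by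
  obtain ⟨U, hU, hUV⟩ := exists_nhds_one_mul_mul_inv_mem hV
  obtain ⟨f, hf, hf_one, hfU, hf_unif⟩ := exists_equicontinuous_separating hU
  obtain ⟨m, _, q, hq⟩ := hG.exists_uniform_almost_invariant
    (fun S y => abs_le.2 ⟨by linarith [(hf S y).1], (hf S y).2⟩) hf_unif E hε
  have hW : U ∩ ⋂ g ∈ E, {v | g * v * g⁻¹ ∈ U} ∈ 𝓝 (1 : G) := by
    refine inter_mem hU ((Filter.biInter_finset_mem E).2 fun g _ => ?_)
    have hconj : Continuous fun v : G => g * v * g⁻¹ := by fun_prop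
    exact hconj.tendsto' 1 1 (by simp) hU
  obtain ⟨v, hv, hinj⟩ := exists_injective_mul_mem q hW
  refine ⟨Set.range fun j => v j * q j, Set.finite_range _, Set.range_nonempty _, fun g hg => ?_⟩
  obtain ⟨M, σ, hσ, hσU, hM⟩ := exists_injOn_of_almost_invariant hf hf_one hfU hε.le
    (q := q) (g := g) (by simpa only [Fintype.card_fin] using hq g hg)
  have hcard : (Set.range fun j => v j * q j).ncard = Fintype.card (Fin m) := by
    rw [← Set.image_univ, Set.ncard_image_of_injective _ hinj, Set.ncard_univ,
      Nat.card_eq_fintype_card]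
  rw [hcard]
  exact hM.trans (mod_cast card_le_matchingNumber_range_mul hUV (fun j => (hv j).1)
    (fun j => Set.mem_iInter₂.1 (hv j).2 g hg) hinj hσ hσU)

theorem isHaarMeasure_count [DiscreteTopology G] [MeasurableSpace G] [BorelSpace G] :
    (Measure.count : Measure G).IsHaarMeasure where
  lt_top_of_isCompact _ hK := Measure.count_apply_lt_top.2 hK.finite_of_discrete
  map_mul_left_eq_self g := map_mul_left_eq_self _ g
  open_pos _ _ hne := Measure.count_ne_zero hne

theorem IsAmenable.exists_finite_matching_of_discrete (hG : IsAmenable G) [DiscreteTopology G]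
    (E : Finset G) {V : Set G} (hV : (1 : G) ∈ V) {ε : ℝ} (hε : 0 < ε) :
    ∃ F : Set G, F.Finite ∧ F.Nonempty ∧ ∀ g ∈ E,
      (1 - ε) * F.ncard ≤ matchingNumber V F ((fun h => g * h) '' F) := by
  let _ : MeasurableSpace G := borel G
  have : BorelSpace G := ⟨rfl⟩
  have := isHaarMeasure_count (G := G)
  have hE : (insert 1 (E : Set G)).Finite := E.finite_toSet.insert 1
  obtain ⟨F, hF_compact, hF₀, hEF⟩ :=
    hG.exists_isCompact_measure_mul_le (Measure.count : Measure G) hE.isCompact hε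
  have hF : F.Finite := hF_compact.finite_of_discrete
  refine ⟨F, hF, nonempty_of_measure_ne_zero hF₀, fun g hg => ?_⟩
  let gF : Set G := (fun h => g * h) '' F
  have hEF_card : ((insert 1 (E : Set G) * F).ncard : ℝ) ≤ (1 + ε) * F.ncard := by
    rw [Measure.count_apply_finite _ hF, Measure.count_apply_finite _ (hE.mul hF),
      ← Set.ncard_eq_toFinset_card _ hF, ← Set.ncard_eq_toFinset_card _ (hE.mul hF),
      ← ENNReal.ofReal_natCast, ← ENNReal.ofReal_natCast, ← ENNReal.ofReal_mul (by positivity),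
      ENNReal.ofReal_le_ofReal_iff (by positivity)] at hEF
    exact hEF
  have hunion : ((F ∪ gF).ncard : ℝ) ≤ (insert 1 (E : Set G) * F).ncard := by
    refine mod_cast Set.ncard_le_ncard ?_ (hE.mul hF)
    rintro x (hx | ⟨y, hy, rfl⟩)
    · exact ⟨1, Set.mem_insert _ _, x, hx, one_mul x⟩
    · exact ⟨g, Set.mem_insert_of_mem _ hg, y, hy, rfl⟩
  have hinter : ((F ∩ gF).ncard : ℝ) ≤ matchingNumber V F gF :=
    mod_cast ncard_le_matchingNumber hF Set.inter_subset_left (φ := id)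
      Function.injective_id.injOn (fun _ hx => hx.2) fun x _ => ⟨1, hV, (one_mul x).symm⟩
  have hcard : ((F ∪ gF).ncard : ℝ) + (F ∩ gF).ncard = F.ncard + F.ncard := by
    have h_add := Set.ncard_union_add_ncard_inter F gF hF (hF.image _)
    rw [Set.ncard_image_of_injective _ (mul_right_injective g)] at h_add
    exact_mod_cast h_add
  linarith

theorem IsAmenable.exists_finite_matching (hG : IsAmenable G) [T1Space G]
    [FirstCountableTopology G] (E : Finset G) {V : Set G} (hV : V ∈ 𝓝 (1 : G)) {ε : ℝ}
    (hε : 0 < ε) :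
    ∃ F : Set G, F.Finite ∧ F.Nonempty ∧ ∀ g ∈ E,
      (1 - ε) * F.ncard ≤ matchingNumber V F ((fun h => g * h) '' F) := by
  rcases eq_or_neBot (𝓝[≠] (1 : G)) with hbot | _
  · have : DiscreteTopology G :=
      discreteTopology_of_isOpen_singleton_one (isOpen_singleton_iff_punctured_nhds 1 |>.2 hbot)
    exact hG.exists_finite_matching_of_discrete E (mem_of_mem_nhds hV) hε
  · exact hG.exists_finite_matching_of_neBot E hV hε

theorem IsAmenable.exists_isThinFolner (hG : IsAmenable G) [T1Space G]
    [SecondCountableTopology G] : ∃ F : ℕ → Set G, IsThinFolner F := by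
  classical
  obtain ⟨V, hV⟩ := (𝓝 (1 : G)).exists_antitone_basis
  let d := TopologicalSpace.denseSeq G
  choose F hF_finite hF_nonempty hF using fun n : ℕ => hG.exists_finite_matching
    ((Finset.range (n + 1)).image d) (hV.mem n) (Nat.one_div_pos_of_nat (α := ℝ) (n := n))
  refine ⟨F, hF_finite, hF_nonempty, fun g W hW hW₁ => ?_⟩
  obtain ⟨U, hUo, hU₁, hUW⟩ := exists_open_nhds_one_mul_subset (hW.mem_nhds hW₁)
  have hU : U ∈ 𝓝 (1 : G) := hUo.mem_nhds hU₁
  obtain ⟨k, hk⟩ := hV.mem_iff.1 hU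
  obtain ⟨j, hj⟩ : ∃ j, g * (d j)⁻¹ ∈ U := by
    have hcont : Continuous fun y : G => g * y⁻¹ := by fun_prop
    obtain ⟨_, ⟨j, rfl⟩, hy⟩ := (TopologicalSpace.denseRange_denseSeq G).inter_nhds_nonempty
      (hcont.tendsto' g 1 (mul_inv_cancel g) hU)
    exact ⟨j, hy⟩
  have hlim : Tendsto (fun n : ℕ => 1 - 1 / ((n : ℝ) + 1)) atTop (𝓝 1) := by
    simpa using tendsto_one_div_add_atTop_nhds_zero_nat.const_sub (1 : ℝ)
  refine tendsto_of_tendsto_of_tendsto_of_le_of_le' hlim tendsto_const_nhds ?_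
    (Eventually.of_forall fun n => matchingNumber_div_ncard_le_one (hF_finite n) _ _)
  filter_upwards [eventually_ge_atTop k, eventually_ge_atTop j] with n hkn hjn
  have hpos : (0 : ℝ) < (F n).ncard := mod_cast (Set.ncard_pos (hF_finite n)).2 (hF_nonempty n)
  rw [le_div_iff₀ hpos]
  refine (hF n (d j) (Finset.mem_image_of_mem d (Finset.mem_range.2 (by lia)))).trans ?_
  have hmul := matchingNumber_le_mul_left (hF_finite n) (V := V n) (W := W) (d j) (g * (d j)⁻¹)
    fun v hv => hUW ⟨_, hj, v, hk (hV.antitone hkn hv), rfl⟩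
  rw [inv_mul_cancel_right] at hmul
  exact_mod_cast hmul

end FiniteMatching

section Mirrored

theorem eventually_abs_integral_mul_sub_lt {α : Type*} [MeasurableSpace α] {μ : Measure α}
    {ψ : α → ℝ} (hψ : Integrable ψ μ) (hψ_nonneg : ∀ w, 0 ≤ ψ w) (hψ_int : ∫ w, ψ w ∂μ = 1)
    {u : ℕ → α → ℝ} (hu : ∀ n, AEStronglyMeasurable (u n) μ) {a : ℕ → ℝ} {C : ℝ}
    (hC : ∀ n w, |u n w - a n| ≤ C) {ε δ : ℝ} (hεδ : ε < δ)
    (h : ∀ w, ψ w ≠ 0 → ∀ᶠ n in atTop, |u n w - a n| ≤ ε) :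
    ∀ᶠ n in atTop, |∫ w, u n w * ψ w ∂μ - a n| < δ := by
  let k (n : ℕ) (w : α) : ℝ := max |u n w - a n| ε * ψ w
  have hk_meas (n : ℕ) : AEStronglyMeasurable (k n) μ :=
    (((hu n).sub aestronglyMeasurable_const).norm.sup aestronglyMeasurable_const).mul hψ.1
  have hk_le (n : ℕ) (w : α) : ‖k n w‖ ≤ max C |ε| * ψ w := by
    rw [norm_mul, Real.norm_of_nonneg (hψ_nonneg w),
      Real.norm_of_nonneg ((abs_nonneg _).trans (le_max_left _ _))]
    exact mul_le_mul_of_nonneg_right (max_le_max (hC n w) (le_abs_self ε)) (hψ_nonneg w)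
  have hlim : Tendsto (fun n => ∫ w, k n w ∂μ) atTop (𝓝 ε) := by
    rw [← mul_one ε, ← hψ_int, ← integral_const_mul]
    refine tendsto_integral_of_dominated_convergence _ hk_meas (hψ.const_mul (max C |ε|))
      (fun n => ae_of_all _ (hk_le n)) (ae_of_all _ fun w => ?_)
    rcases eq_or_ne (ψ w) 0 with hw | hw
    · simp [k, hw]
    · exact tendsto_const_nhds.congr' ((h w hw).mono fun n hn => by rw [← max_eq_right hn])
  filter_upwards [hlim.eventually_lt_const hεδ] with n hn
  have hu_int : Integrable (fun w => (u n w - a n) * ψ w) μ :=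
    hψ.bdd_mul ((hu n).sub aestronglyMeasurable_const) (ae_of_all _ (hC n))
  calc |∫ w, u n w * ψ w ∂μ - a n| = ‖∫ w, (u n w - a n) * ψ w ∂μ‖ := by
        have hsplit : ∫ w, u n w * ψ w ∂μ = ∫ w, ((u n w - a n) * ψ w + a n * ψ w) ∂μ := by
          congr with w
          ring
        rw [hsplit, integral_add hu_int (hψ.const_mul _), integral_const_mul, hψ_int, mul_one,
          add_sub_cancel_right, Real.norm_eq_abs]
    _ ≤ ∫ w, k n w ∂μ := by
        refine norm_integral_le_of_norm_le
          ((hψ.const_mul (max C |ε|)).mono' (hk_meas n) (ae_of_all _ (hk_le n)))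
          (ae_of_all _ fun w => ?_)
        rw [norm_mul, Real.norm_of_nonneg (hψ_nonneg w)]
        exact mul_le_mul_of_nonneg_right (le_max_left _ _) (hψ_nonneg w)
    _ < δ := hn

variable {G : Type*} [Group G] [TopologicalSpace G] [IsTopologicalGroup G]

theorem abs_integral_mul_left_sub_le [MeasurableSpace G] [BorelSpace G] {θ : Measure G}
    [IsFiniteMeasureOnCompacts θ] [θ.IsMulLeftInvariant] {ψ k : G → ℝ} (hψ : Continuous ψ)
    (hc : HasCompactSupport ψ) (hk : Continuous k) {C : ℝ} (hC : ∀ w, |k w| ≤ C) (v : G) :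
    |∫ w, k (v * w) * ψ w ∂θ - ∫ w, k w * ψ w ∂θ| ≤ C * ∫ w, |ψ (v⁻¹ * w) - ψ w| ∂θ := by
  have hψv : Continuous fun w => ψ (v⁻¹ * w) := by fun_prop
  have hcv : HasCompactSupport fun w => ψ (v⁻¹ * w) := hc.comp_homeomorph (Homeomorph.mulLeft v⁻¹)
  have htranslate : ∫ w, k (v * w) * ψ w ∂θ = ∫ w, k w * ψ (v⁻¹ * w) ∂θ := by
    rw [← integral_mul_left_eq_self (fun w => k w * ψ (v⁻¹ * w)) v]
    simp only [inv_mul_cancel_left]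
  rw [htranslate, ← integral_sub (integrable_mul_of_hasCompactSupport hψv hcv hk)
    (integrable_mul_of_hasCompactSupport hψ hc hk)]
  simp only [← mul_sub]
  exact abs_integral_mul_le (hψv.sub hψ) (hcv.sub hc) hC

variable [MeasurableSpace G] [BorelSpace G]
  {X : Type*} [MetricSpace X] [CompactSpace X] [MulAction G X] [ContinuousSMul G X]

theorem integral_avgOp_count_mul [MeasurableSingletonClass G] {θ : Measure G}
    [IsFiniteMeasureOnCompacts θ] {ψ : G → ℝ} (hψ : Continuous ψ) (hc : HasCompactSupport ψ)
    (A : Finset G) (f : C(X, ℝ)) (g : G) (x : X) :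
    ∫ w, avgOp X Measure.count (A : Set G) f ((g * w) • x) * ψ w ∂θ =
      (A.card : ℝ)⁻¹ * ∑ h ∈ A, ∫ w, f ((h * g * w) • x) * ψ w ∂θ := by
  rw [← integral_finsetSum _ fun h _ => integrable_mul_of_hasCompactSupport hψ hc (by fun_prop),
    ← integral_const_mul]
  simp only [avgOp_count, smul_smul, mul_assoc, Finset.sum_mul]

theorem IsMirroredThinFolner.tendsto_integral_avgOp_mul_sub [MeasurableSingletonClass G]
    [LocallyCompactSpace G] {F : ℕ → Set G} (hF : IsMirroredThinFolner F) (θ : Measure G)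
    [IsFiniteMeasureOnCompacts θ] [θ.IsMulLeftInvariant] {ψ : G → ℝ} (hψ : Continuous ψ)
    (hc : HasCompactSupport ψ) (f : C(X, ℝ)) (g : G) (x : X) :
    Tendsto (fun n => ∫ w, avgOp X Measure.count (F n) f ((g * w) • x) * ψ w ∂θ -
      ∫ w, avgOp X Measure.count (F n) f (w • x) * ψ w ∂θ) atTop (𝓝 0) := by
  classical
  refine Metric.tendsto_nhds.2 fun ε hε => ?_
  let u (h : G) : ℝ := ∫ w, f ((h * w) • x) * ψ w ∂θ
  have hu (h : G) : |u h| ≤ ‖f‖ * ∫ w, |ψ w| ∂θ :=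
    abs_integral_mul_le hψ hc fun w => f.norm_coe_le_norm ((h * w) • x)
  have hlim : Tendsto (fun v => ‖f‖ * ∫ w, |ψ (v⁻¹ * w) - ψ w| ∂θ) (𝓝 1) (𝓝 0) := by
    simpa using (tendsto_integral_abs_left_translate_sub (θ := θ) hψ hc).const_mul ‖f‖
  obtain ⟨V, hV, hVo, hV₁⟩ := mem_nhds_iff.1 (hlim.eventually_lt_const (half_pos hε))
  have huV (h : G) {v : G} (hv : v ∈ V) : |u (h * v) - u h| ≤ ε / 2 := by
    have h_le := abs_integral_mul_left_sub_le (θ := θ) hψ hc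
      (k := fun w => f ((h * w) • x)) (by fun_prop) (fun w => f.norm_coe_le_norm _) v
    simp only [← mul_assoc] at h_le
    exact h_le.trans (hV hv).le
  filter_upwards [eventually_add_mul_one_sub_lt (hF.tendsto g V hVo hV₁)
    (2 * (‖f‖ * ∫ w, |ψ w| ∂θ)) (half_lt_self hε)] with n hn
  obtain ⟨A, hA⟩ := (hF.finite n).exists_finset_coe
  have hne := hF.nonempty n
  rw [← hA] at hn hne ⊢
  obtain ⟨M, hM, hcard, φ, hφ, hφE, hφV⟩ :=
    exists_eq_rightMatchingNumber A.finite_toSet V ((fun h => h * g) '' A)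
  rw [← hcard, Set.ncard_coe_finset] at hn
  have h_match := abs_avg_sub_avg_le_of_matching (B := A.image fun h => h * g) hne
    (Finset.card_image_of_injective _ (mul_left_injective g)) hM hφ
    (by rwa [Finset.coe_image]) (half_pos hε).le hu fun h hh => by
      obtain ⟨v, hv, hvh⟩ := hφV h hh
      exact hvh ▸ huV h hv
  rw [Finset.sum_image (mul_left_injective g).injOn,
    Finset.card_image_of_injective _ (mul_left_injective g)] at h_match
  have h_one := integral_avgOp_count_mul (θ := θ) hψ hc A f 1 x
  simp only [one_mul, mul_one] at h_one
  rw [dist_zero_right, integral_avgOp_count_mul hψ hc, h_one]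
  exact h_match.trans_lt hn

-- A right displacement of the group element cannot be absorbed by the continuity of `f`; averaging
-- the base point over a bump function at the identity turns it into a left translation of the bump.
theorem IsMirroredThinFolner.tendsto_sub [T1Space G] [LocallyCompactSpace G] {F : ℕ → Set G}
    (hF : IsMirroredThinFolner F) (hE : AsymptoticallyEquicontinuous X Measure.count F)
    (f : C(X, ℝ)) (g : G) (x : X) :
    Tendsto (fun n => avgOp X Measure.count (F n) f (g • x) - avgOp X Measure.count (F n) f x)
      atTop (𝓝 0) := by
  refine Metric.tendsto_nhds.2 fun ε hε => ?_
  let S (n : ℕ) : C(X, ℝ) := avgOp X Measure.count (F n) f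
  have hε₄ : 0 < ε / 4 := by positivity
  have hnear (k : G) : ∀ᶠ w in 𝓝 (1 : G), ∀ᶠ n in atTop,
      |S n ((k * w) • x) - S n (k • x)| < ε / 4 := by
    have hcont : Continuous fun w : G => (k * w) • x := by fun_prop
    exact (hcont.tendsto' 1 (k • x) (by rw [mul_one])).eventually (hE f _ hε₄ (k • x))
  obtain ⟨ψ, hψ, hc, hψ_nonneg, hψ_int, hψ_near⟩ :=
    exists_bump (Measure.haar : Measure G) ((hnear g).and (hnear 1))
  have hsmooth (k : G) (hk : ∀ w, ψ w ≠ 0 → ∀ᶠ n in atTop,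
      |S n ((k * w) • x) - S n (k • x)| < ε / 4) :
      ∀ᶠ n in atTop, |∫ w, S n ((k * w) • x) * ψ w ∂Measure.haar - S n (k • x)| < ε / 3 :=
    eventually_abs_integral_mul_sub_lt (hψ.integrable_of_hasCompactSupport hc) hψ_nonneg hψ_int
      (fun n => (by fun_prop : Continuous fun w => S n ((k * w) • x)).aestronglyMeasurable)
      (fun n w => (abs_sub _ _).trans
        (add_le_add (abs_avgOp_le _ _ f ((k * w) • x)) (abs_avgOp_le _ _ f (k • x))))
      (by linarith : ε / 4 < ε / 3) fun w hw => (hk w hw).mono fun n hn => hn.le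
  have h_shift := Metric.tendsto_nhds.1
    (hF.tendsto_integral_avgOp_mul_sub Measure.haar hψ hc f g x) (ε / 3) (by positivity)
  filter_upwards [hsmooth g fun w hw => (hψ_near w hw).1, hsmooth 1 fun w hw => (hψ_near w hw).2,
    h_shift] with n hg h_one h_sub
  simp only [one_mul, one_smul] at h_one
  rw [dist_zero_right, Real.norm_eq_abs, abs_lt] at h_sub ⊢
  rw [abs_lt] at hg h_one
  change -ε < S n (g • x) - S n x ∧ S n (g • x) - S n x < ε
  constructor <;> linarith

theorem IsMirroredThinFolner.continuouslyUniquelyErgodic [T1Space G] [LocallyCompactSpace G]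
    [MeasurableSpace X] [BorelSpace X] (hG : IsAmenable G) {F : ℕ → Set G}
    (hF : IsMirroredThinFolner F) (h : FolnerWeaklyMeanEquicontinuous X Measure.count F) :
    ContinuouslyUniquelyErgodic G X := by
  have h₀ (n : ℕ) : Measure.count (F n) ≠ 0 := Measure.count_ne_zero (hF.nonempty n)
  have h_top (n : ℕ) : Measure.count (F n) ≠ ⊤ := (Measure.count_apply_lt_top.2 (hF.finite n)).ne
  have hE := h.asymptoticallyEquicontinuous h₀ h_top
  exact hE.continuouslyUniquelyErgodic hG h₀ h_top (hF.tendsto_sub hE)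

end Mirrored

end WeakMean

end

open WeakMean in
theorem theorem3p10 {G : Type*} [Group G] [TopologicalSpace G] [IsTopologicalGroup G] [T2Space G]
    [MeasurableSpace G] [BorelSpace G] (hG : IsAmenable G)
    {X : Type*} [MetricSpace X] [CompactSpace X] [MeasurableSpace X] [BorelSpace X]
    [MulAction G X] [ContinuousSMul G X] :
    -- thick Følner sequences in a σ-compact locally compact group
    (∀ [LocallyCompactSpace G] [SigmaCompactSpace G]
      (θ : Measure G) [θ.IsHaarMeasure] [θ.Regular]
      (θr : Measure G) [θr.IsMulRightInvariant] [θr.IsOpenPosMeasure] [θr.Regular],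
      List.TFAE [
        WeaklyMeanEquicontinuous X θ (IsThickFolner θ),
        ContinuouslyUniquelyErgodic G X,
        AveragesConverge X θ (IsThickFolner θ)] ∧
      ((∃ F, IsThickFolner θ F ∧ FolnerWeaklyMeanEquicontinuous X θ F) →
        HasFullySupportedInvariantMeasure G X →
        WeaklyMeanEquicontinuous X θ (IsThickFolner θ) ∧
        ContinuouslyUniquelyErgodic G X ∧
        AveragesConverge X θ (IsThickFolner θ)) ∧
      ((∃ F, IsRightThickFolner θr F ∧ FolnerWeaklyMeanEquicontinuous X θr F) →
        WeaklyMeanEquicontinuous X θ (IsThickFolner θ) ∧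
        ContinuouslyUniquelyErgodic G X ∧
        AveragesConverge X θ (IsThickFolner θ))) ∧
    -- thin Følner sequences in a second countable group
    (∀ [SecondCountableTopology G],
      List.TFAE [
        WeaklyMeanEquicontinuous X (Measure.count : Measure G) IsThinFolner,
        ContinuouslyUniquelyErgodic G X,
        AveragesConverge X (Measure.count : Measure G) IsThinFolner] ∧
      ((∃ F, IsThinFolner F ∧
          FolnerWeaklyMeanEquicontinuous X (Measure.count : Measure G) F) →
        HasFullySupportedInvariantMeasure G X →
        WeaklyMeanEquicontinuous X (Measure.count : Measure G) IsThinFolner ∧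
        ContinuouslyUniquelyErgodic G X ∧
        AveragesConverge X (Measure.count : Measure G) IsThinFolner) ∧
      ((∃ F, (IsRightThinFolner F ∨ (LocallyCompactSpace G ∧ IsMirroredThinFolner F)) ∧
          FolnerWeaklyMeanEquicontinuous X (Measure.count : Measure G) F) →
        WeaklyMeanEquicontinuous X (Measure.count : Measure G) IsThinFolner ∧
        ContinuouslyUniquelyErgodic G X ∧
        AveragesConverge X (Measure.count : Measure G) IsThinFolner)) := by
  constructor
  · intro _ _ θ _ _ θr _ _ _
    have hP := isAveragingClass_isThickFolner (X := X) hG θ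
    refine ⟨hP.tfae hG, ?_, ?_⟩
    · rintro ⟨F, hF, h⟩ hX
      exact (h.continuouslyUniquelyErgodic hG (hP.ne_zero F hF) (hP.ne_top F hF)
        hF.asymptoticallyInvariant hX).weaklyMeanEquicontinuous_and_averagesConverge hP
    · rintro ⟨F, hF, h⟩
      exact (hF.continuouslyUniquelyErgodic hG h).weaklyMeanEquicontinuous_and_averagesConverge hP
  · intro _
    have hP := isAveragingClass_isThinFolner (X := X) hG.exists_isThinFolner
    refine ⟨hP.tfae hG, ?_, ?_⟩
    · rintro ⟨F, hF, h⟩ hX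
      exact (h.continuouslyUniquelyErgodic hG (hP.ne_zero F hF) (hP.ne_top F hF)
        hF.asymptoticallyInvariant hX).weaklyMeanEquicontinuous_and_averagesConverge hP
    · rintro ⟨F, hF | ⟨_, hF⟩, h⟩ <;>
        exact (hF.continuouslyUniquelyErgodic hG h).weaklyMeanEquicontinuous_and_averagesConverge hP
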